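/- **Proposition (Orthogonality).** Let $n\ge 0$ be an integer, $X=(x_1,\dots,x_n)$, $Y=(y_1,\dots,y_n)$. Let $W_n$ be the hyperoctahedral group of signed permutations of $\{1,\dots,n\}$, written in one-line notation with a bar for a negative sign. It is generated by $s_0$ (sign change of the entry $1$) and $s_1,\dots,s_{n-1}$ ($s_i$ interchanges $i$ and $i+1$); $\ell$ is the length with respect to these generators. Let $S_n\subset W_n$ be the symmetric group, $\varpi_0=(n,n-1,\dots,1)$ and $w_0=(\overline 1,\overline 2,\dots,\overline n)$. The group $W_n$ acts on $A[X]$, for a commutative ring $A$, by letting $s_i$ interchange $x_i$ and $x_{i+1}$ for $i\ge1$ and letting $s_0$ replace $x_1$ by $-x_1$. When $2$ is not a zero divisor in $A$, put $$\partial_0 f=\frac{f-s_0f}{2x_1},\qquad \partial_i f=\frac{f-s_if}{x_i-x_{i+1}}\quad(1\le i\le n-1),\qquad \partial'_0=\partial_0,\quad \partial'_i=-\partial_i\quad (i\ge 1),$$ and $\partial_w=\partial_{a_1}\circ\cdots\circ\partial_{a_r}$, $\partial'_w=\partial'_{a_1}\circ\cdots\circ\partial'_{a_r}$ for a reduced decomposition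 $w=s_{a_1}\cdots s_{a_r}$. Let $\mathcal D_n$ be the set of strict partitions with parts in $\{1,\dots,n\}$. For $\lambda\in\mathcal D_n$ let $\lambda'\in\mathcal D_n$ be the partition whose parts are the elements of $\{1,\dots,n\}$ that are not parts of $\lambda$. Let $\widetilde Q_i(X)=e_i(X)$ be the elementary symmetric polynomials (zero for $i>n$), $$\widetilde Q_{i,j}=\widetilde Q_i\widetilde Q_j+2\sum_{k=1}^{j}(-1)^k\widetilde Q_{i+k}\widetilde Q_{j-k},$$ and $\widetilde Q_\lambda=\mathrm{Pfaffian}[\widetilde Q_{\lambda_i,\lambda_j}]_{1\le i<j\le r}$, where $r$ is the number of parts of $\lambda=(\lambda_1>\lambda_2>\cdots)$ rounded up to an even number and, if necessary, $\lambda_r=0$. For $w\in W_n$ define $$\mathfrak C_w(X,Y)=(-1)^{n(n-1)/2}\,\partial'_{w^{-1}w_0}\Bigl(\prod_{i+j\le n}(x_i-y_j)\cdot\sum_{\lambda\in\mathcal D_n}\widetilde Q_\lambda(X)\widetilde Q_{\lambda'}(Y)\Bigr),\qquad \mathfrak C_w(X)=\mathfrak C_w(X,0),$$ the operator acting on $A[X]$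 with $A=\mathbb Z[Y]$. For $\lambda\in\mathcal D_n$ with $\lambda=(\lambda_1>\dots>\lambda_\ell)$ and $\lambda'=(\lambda'_1>\dots>\lambda'_k)$, where $\ell$ and $k=n-\ell$ are the numbers of parts, put $\mathfrak C_\lambda(X)=\mathfrak C_{w_\lambda}(X)$ with $w_\lambda=(\overline{\lambda}_1,\dots,\overline{\lambda}_\ell,\lambda'_k,\dots,\lambda'_1)$. Finally, for $f,g\in\mathbb Z[X]$ let $\langle f,g\rangle=\partial_{w_0}(fg)$, and let $f(-\varpi_0X)$ denote the result of substituting $-x_{n+1-i}$ for $x_i$ in $f$, for every $i$. (i) The products $\mathfrak C_\varpi(X)\mathfrak C_\lambda(X)$, for $\varpi\in S_n$ and $\lambda\in\mathcal D_n$, form a basis of $\mathbb Z[X]$ as a module over the ring of invariants $\mathbb Z[X]^{W_n}$. Moreover, for all $u,v\in S_n$ and $\lambda,\mu\in\mathcal D_n$, $$\bigl\langle \mathfrak C_u(X)\mathfrak C_\lambda(X),\ \mathfrak C_{v\varpi_0}(-\varpi_0X)\,\mathfrak C_{\mu'}(X)\bigr\rangle=\delta_{u,v}\,\delta_{\lambda,\mu}.$$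 (ii) If $u,v\in S_n$ satisfy $\ell(u)+\ell(v)=n(n-1)/2$ and $\lambda,\mu\in\mathcal D_n$, then $$\bigl\langle \mathfrak C_u(X)\mathfrak C_\lambda(X),\ \mathfrak C_v(X)\mathfrak C_\mu(X)\bigr\rangle=\begin{cases}1&\text{if } v=\varpi_0u \text{ and } \mu=\lambda',\\ 0&\text{otherwise.}\end{cases}$$ -/

import Mathlib

open MvPolynomial

/-! Variables, positions and entries are indexed by `Fin n`: the index `i : Fin n` stands for the
number `i + 1` of `{1, …, n}`. -/

/-! ### The hyperoctahedral group -/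

/-- An element `w` of the hyperoctahedral group `W_n`, in one-line notation: the `i`-th entry is
`w(i) = sign i * perm i`, a barred entry being one with `sign i = -1`. -/
@[ext]
structure SignedPerm (n : ℕ) where
  perm : Equiv.Perm (Fin n)
  sign : Fin n → ℤˣ

namespace SignedPerm

variable {n : ℕ}

/-- Composition of signed permutations: `(v w)(i) = v(w(i))`, where `v(-j) = -v(j)`. -/
instance : Mul (SignedPerm n) :=
  ⟨fun v w => ⟨v.perm * w.perm, fun i => w.sign i * v.sign (w.perm i)⟩⟩

instance : One (SignedPerm n) := ⟨⟨1, fun _ => 1⟩⟩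

instance : Inv (SignedPerm n) := ⟨fun w => ⟨w.perm⁻¹, fun i => w.sign (w.perm⁻¹ i)⟩⟩

@[simp] theorem perm_mul (v w : SignedPerm n) : (v * w).perm = v.perm * w.perm := rfl

@[simp] theorem sign_mul (v w : SignedPerm n) (i : Fin n) :
    (v * w).sign i = w.sign i * v.sign (w.perm i) := rfl

@[simp] theorem perm_one : (1 : SignedPerm n).perm = 1 := rfl

@[simp] theorem sign_one (i : Fin n) : (1 : SignedPerm n).sign i = 1 := rfl

@[simp] theorem perm_inv (w : SignedPerm n) : (w⁻¹).perm = w.perm⁻¹ := rfl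

@[simp] theorem sign_inv (w : SignedPerm n) (i : Fin n) :
    (w⁻¹).sign i = w.sign (w.perm⁻¹ i) := rfl

instance : Group (SignedPerm n) :=
  Group.ofLeftAxioms
    (fun u v w => by
      ext i
      · simp
      · simp [mul_assoc])
    (fun w => by
      ext i
      · simp
      · simp)
    (fun w => by
      ext i
      · simp
      · simp)

/-- The symmetric group `S_n` inside `W_n`. -/
def ofPerm : Equiv.Perm (Fin n) →* SignedPerm n where
  toFun u := ⟨u, fun _ => 1⟩
  map_one' := rfl
  map_mul' u v := by
    ext i
    · simp
    · simp

/-- The sign changes inside `W_n`. -/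
def ofSign : (Fin n → ℤˣ) →* SignedPerm n where
  toFun e := ⟨1, e⟩
  map_one' := rfl
  map_mul' d e := by
    ext i
    · simp
    · simp [mul_comm]

/-- The simple reflections `s_0, s_1, …, s_{n-1}`: the reflection `s_0` changes the sign of the
first entry, and for `1 ≤ i ≤ n - 1` the reflection `s_i` interchanges the numbers `i` and `i + 1`
(that is, the indices `i - 1` and `i` of `Fin n`). -/
def simpleRefl (i : Fin n) : SignedPerm n :=
  if (i : ℕ) = 0 then ofSign (Pi.mulSingle i (-1))
  else ofPerm (Equiv.swap ⟨i - 1, (Nat.sub_le _ _).trans_lt i.isLt⟩ i)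

/-- The product `s_{a_1} ⋯ s_{a_r}`. -/
def wordProd (a : List (Fin n)) : SignedPerm n := (a.map simpleRefl).prod

theorem ofPerm_mem (u : Equiv.Perm (Fin n)) :
    ofPerm u ∈ Submonoid.closure (Set.range (simpleRefl (n := n))) := by
  cases n with
  | zero =>
    have : u = 1 := Subsingleton.elim _ _
    rw [this, map_one]
    exact one_mem _
  | succ m =>
    have hu : u ∈ Submonoid.closure
        (Set.range fun i : Fin m => Equiv.swap i.castSucc i.succ) := by
      rw [Equiv.Perm.mclosure_swap_castSucc_succ]
      trivial
    refine (Submonoid.closure_le (S := (Submonoid.closure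
      (Set.range (simpleRefl (n := m + 1)))).comap ofPerm)).2 ?_ hu
    rintro _ ⟨i, rfl⟩
    refine Submonoid.subset_closure ⟨i.succ, ?_⟩
    simp only [simpleRefl, Fin.val_succ, Nat.add_eq_zero_iff, one_ne_zero, and_false, if_false]
    rfl

theorem ofSign_mem (e : Fin n → ℤˣ) :
    ofSign e ∈ Submonoid.closure (Set.range (simpleRefl (n := n))) := by
  cases n with
  | zero =>
    have : e = 1 := Subsingleton.elim _ _
    rw [this, map_one]
    exact one_mem _
  | succ m =>
    suffices h : e ∈ (Submonoid.closure (Set.range (simpleRefl (n := m + 1)))).comap ofSign from h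
    rw [← Finset.univ_prod_mulSingle e]
    refine Submonoid.prod_mem _ fun k _ => ?_
    rcases Int.units_eq_one_or (e k) with hk | hk
    · rw [hk, Pi.mulSingle_one]
      exact one_mem _
    · rw [hk]
      have h0 : ofSign (Pi.mulSingle (0 : Fin (m + 1)) (-1)) ∈
          Submonoid.closure (Set.range (simpleRefl (n := m + 1))) :=
        Submonoid.subset_closure ⟨0, by simp [simpleRefl]⟩
      have h1 := ofPerm_mem (Equiv.swap (0 : Fin (m + 1)) k)
      have h2 : ofSign (Pi.mulSingle k (-1)) =
          ofPerm (Equiv.swap 0 k) * ofSign (Pi.mulSingle (0 : Fin (m + 1)) (-1)) *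
            ofPerm (Equiv.swap 0 k) := by
        refine SignedPerm.ext ?_ ?_
        · simp [ofSign, ofPerm]
        · funext i
          simp only [ofSign, ofPerm, MonoidHom.coe_mk, OneHom.coe_mk, sign_mul, one_mul, mul_one]
          simp only [Pi.mulSingle_apply, Equiv.swap_apply_eq_iff, Equiv.swap_apply_left]
      change ofSign (Pi.mulSingle k (-1)) ∈
        Submonoid.closure (Set.range (simpleRefl (n := m + 1)))
      rw [h2]
      exact mul_mem (mul_mem h1 h0) h1

theorem exists_word (w : SignedPerm n) : ∃ a : List (Fin n), wordProd a = w := by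
  have hw : w = ofPerm w.perm * ofSign w.sign := by
    refine SignedPerm.ext ?_ ?_
    · simp [ofSign, ofPerm]
    · funext i
      simp [ofSign, ofPerm]
  have h : w ∈ Submonoid.closure (Set.range (simpleRefl (n := n))) := by
    rw [hw]
    exact mul_mem (ofPerm_mem _) (ofSign_mem _)
  clear hw
  induction h using Submonoid.closure_induction with
  | mem x hx =>
    obtain ⟨i, rfl⟩ := hx
    exact ⟨[i], by simp [wordProd]⟩
  | one => exact ⟨[], rfl⟩
  | mul x y _ _ hx hy =>
    obtain ⟨a, ha⟩ := hx
    obtain ⟨b, hb⟩ := hy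
    exact ⟨a ++ b, by rw [wordProd, List.map_append, List.prod_append, ← ha, ← hb]; rfl⟩

/-- The length `ℓ(w)`: the least `r` such that `w` is a product of `r` simple reflections. -/
noncomputable def length (w : SignedPerm n) : ℕ :=
  sInf {r | ∃ a : List (Fin n), wordProd a = w ∧ a.length = r}

/-- The word `a_1 ⋯ a_r` is reduced for `w`: `w = s_{a_1} ⋯ s_{a_r}` with `r = ℓ(w)`. -/
def IsReducedWord (a : List (Fin n)) (w : SignedPerm n) : Prop :=
  wordProd a = w ∧ a.length = w.length

theorem exists_isReducedWord (w : SignedPerm n) : ∃ a, IsReducedWord a w :=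
  Nat.sInf_mem (s := {r | ∃ a : List (Fin n), wordProd a = w ∧ a.length = r})
    ((exists_word w).elim fun a ha => ⟨a.length, a, ha, rfl⟩)

/-- A reduced word of `w`. -/
noncomputable def reducedWord (w : SignedPerm n) : List (Fin n) :=
  (exists_isReducedWord w).choose

/-- The longest element `w_0 = (-1, -2, …, -n)` of `W_n`. -/
def w0 (n : ℕ) : SignedPerm n := ofSign fun _ => -1

/-! ### Action on polynomials, divided differences -/

/-- The action of `w ∈ W_n` on `A[x_1, …, x_n]`, with `x_i` sent to `± x_{|w(i)|}`, the sign being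
that of `w(i)`. -/
noncomputable def act (A : Type*) [CommRing A] (w : SignedPerm n) :
    MvPolynomial (Fin n) A →ₐ[A] MvPolynomial (Fin n) A :=
  aeval fun i => ((w.sign i : ℤ) : MvPolynomial (Fin n) A) * X (w.perm i)

end SignedPerm

/-- The denominators of the divided differences: `2 x_1` for `i = 0` and `x_i - x_{i+1}` for
`1 ≤ i ≤ n - 1`. -/
noncomputable def simpleRoot {n : ℕ} (A : Type*) [CommRing A] (i : Fin n) :
    MvPolynomial (Fin n) A :=
  if (i : ℕ) = 0 then 2 * X i
  else X ⟨i - 1, (Nat.sub_le _ _).trans_lt i.isLt⟩ - X i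

theorem simpleRoot_dvd {n : ℕ} (A : Type*) [CommRing A] (i : Fin n)
    (f : MvPolynomial (Fin n) A) :
    simpleRoot A i ∣ f - SignedPerm.act A (SignedPerm.simpleRefl i) f := by
  rw [← Ideal.mem_span_singleton, ← Ideal.Quotient.eq]
  let q := Ideal.Quotient.mkₐ A (Ideal.span {simpleRoot A i})
  suffices h : q = q.comp (SignedPerm.act A (SignedPerm.simpleRefl i)) from
    congrArg (fun g => g f) h
  refine MvPolynomial.algHom_ext fun j => ?_
  refine Ideal.Quotient.eq.2 (Ideal.mem_span_singleton.2 ?_)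
  simp only [SignedPerm.act, aeval_X, RingHom.coe_coe]
  by_cases hi : (i : ℕ) = 0
  · simp only [SignedPerm.simpleRefl, simpleRoot, hi, if_true, SignedPerm.ofSign,
      MonoidHom.coe_mk, OneHom.coe_mk, Equiv.Perm.one_apply]
    by_cases hj : j = i
    · subst hj
      simp only [Pi.mulSingle_eq_same]
      exact ⟨1, by push_cast; ring⟩
    · simp [Pi.mulSingle_eq_of_ne hj]
  · simp only [SignedPerm.simpleRefl, simpleRoot, hi, if_false, SignedPerm.ofPerm,
      MonoidHom.coe_mk, OneHom.coe_mk, Units.val_one, Int.cast_one, one_mul]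
    rw [Equiv.swap_apply_def]
    split_ifs with h1 h2
    · rw [h1]
    · rw [h2]
      exact ⟨-1, by ring⟩
    · simp

/-- The divided difference `∂_i(f) = (f - s_i f) / (2 x_1)` for `i = 0` and
`∂_i(f) = (f - s_i f) / (x_i - x_{i+1})` for `1 ≤ i ≤ n - 1`. (The quotient exists, and it is
unique when `2` is not a zero divisor in `A`.) -/
noncomputable def divDiff {n : ℕ} {A : Type*} [CommRing A] (i : Fin n)
    (f : MvPolynomial (Fin n) A) : MvPolynomial (Fin n) A :=
  (simpleRoot_dvd A i f).choose

theorem simpleRoot_mul_divDiff {n : ℕ} {A : Type*} [CommRing A] (i : Fin n)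
    (f : MvPolynomial (Fin n) A) :
    simpleRoot A i * divDiff i f = f - SignedPerm.act A (SignedPerm.simpleRefl i) f :=
  (simpleRoot_dvd A i f).choose_spec.symm

/-- The operators `∂'_0 = ∂_0` and `∂'_i = -∂_i` for `1 ≤ i ≤ n - 1`. -/
noncomputable def divDiff' {n : ℕ} {A : Type*} [CommRing A] (i : Fin n)
    (f : MvPolynomial (Fin n) A) : MvPolynomial (Fin n) A :=
  if (i : ℕ) = 0 then divDiff i f else -divDiff i f

/-- `∂_w = ∂_{a_1} ∘ ⋯ ∘ ∂_{a_r}` for a reduced decomposition `w = s_{a_1} ⋯ s_{a_r}`. -/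
noncomputable def divDiffW {n : ℕ} {A : Type*} [CommRing A] (w : SignedPerm n)
    (f : MvPolynomial (Fin n) A) : MvPolynomial (Fin n) A :=
  w.reducedWord.foldr divDiff f

/-- `∂'_w = ∂'_{a_1} ∘ ⋯ ∘ ∂'_{a_r}` for a reduced decomposition `w = s_{a_1} ⋯ s_{a_r}`. -/
noncomputable def divDiffW' {n : ℕ} {A : Type*} [CommRing A] (w : SignedPerm n)
    (f : MvPolynomial (Fin n) A) : MvPolynomial (Fin n) A :=
  w.reducedWord.foldr divDiff' f

/-- The ring of invariants `ℤ[X]^{W_n}`. -/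
noncomputable def weylInvariants (n : ℕ) : Subalgebra ℤ (MvPolynomial (Fin n) ℤ) where
  carrier := {f | ∀ w : SignedPerm n, SignedPerm.act ℤ w f = f}
  mul_mem' hf hg w := by rw [map_mul, hf w, hg w]
  add_mem' hf hg w := by rw [map_add, hf w, hg w]
  algebraMap_mem' r w := AlgHom.commutes _ r

/-- The scalar product `⟨f, g⟩ = ∂_{w_0}(f g)` on `ℤ[X]`. -/
noncomputable def scalarProd {n : ℕ} (f g : MvPolynomial (Fin n) ℤ) : MvPolynomial (Fin n) ℤ :=
  divDiffW (SignedPerm.w0 n) (f * g)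

/-! ### Strict partitions and the polynomials `Q̃_λ` -/

/-- The set `𝒟_n` of strict partitions contained in `(n, n - 1, …, 1)`, i.e. of strict partitions
with parts in `{1, …, n}`. A strict partition is given by the set of its parts, where `i : Fin n`
stands for the part `i + 1`; the dual partition `λ'`, whose parts complement those of `λ` in
`{1, …, n}`, is the complement `λᶜ`. -/
abbrev StrictPartition (n : ℕ) := Finset (Fin n)

/-- The `i`-th part `λ_{i+1}`, the parts being listed in decreasing order and followed by zeros. -/
def StrictPartition.part {n : ℕ} (lam : StrictPartition n) (i : ℕ) : ℕ :=
  ((lam.sort (· ≥ ·)).map fun k => (k : ℕ) + 1).getD i 0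

/-- The Pfaffian of the skew-symmetric matrix of size `2m` whose entries above the diagonal are
those of `M`, by expansion along the first row (entries on or below the diagonal are not used):
`Pf M = ∑_{j = 2}^{2m} (-1)^j M_{1 j} Pf M^{1 j}`, where `M^{1 j}` is `M` without the rows and
columns `1` and `j`. -/
def pfaffian {R : Type*} [CommRing R] : (m : ℕ) → Matrix (Fin (2 * m)) (Fin (2 * m)) R → R
  | 0, _ => 1
  | m + 1, M =>
    ∑ j : Fin (2 * m + 1), (-1) ^ (j : ℕ) * M 0 j.succ *
      pfaffian m (M.submatrix (fun k => (j.succAbove k).succ) (fun k => (j.succAbove k).succ))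

/-- `Q̃_{i,j} = Q̃_i Q̃_j + 2 ∑_{k=1}^{j} (-1)^k Q̃_{i+k} Q̃_{j-k}`, where `Q̃_i = e_i(X)` is the
`i`-th elementary symmetric polynomial (zero for `i > n`). -/
noncomputable def qPair (n i j : ℕ) : MvPolynomial (Fin n) ℤ :=
  esymm (Fin n) ℤ i * esymm (Fin n) ℤ j +
    2 * ∑ k ∈ Finset.Icc 1 j,
      (-1) ^ k * esymm (Fin n) ℤ (i + k) * esymm (Fin n) ℤ (j - k)

/-- `Q̃_λ(X)`, the Pfaffian of the matrix `Q̃_{λ_i, λ_j}(X)` of size `r`, where `r` is the number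
of parts of `λ` rounded up to an even number. -/
noncomputable def qTilde {n : ℕ} (lam : StrictPartition n) : MvPolynomial (Fin n) ℤ :=
  pfaffian ((lam.card + 1) / 2) (Matrix.of fun i j => qPair n (lam.part i) (lam.part j))

/-! ### Type C double Schubert polynomials

The ring `ℤ[X, Y]` is represented as `ℤ[Y][X]`. -/

/-- `Q̃(X, Y) = ∑_{λ ∈ 𝒟_n} Q̃_λ(X) Q̃_{λ'}(Y)`. -/
noncomputable def qKernel (n : ℕ) : MvPolynomial (Fin n) (MvPolynomial (Fin n) ℤ) :=
  ∑ lam : StrictPartition n, map C (qTilde lam) * C (qTilde lamᶜ)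

/-- `Δ(X, Y) = ∏_{i + j ≤ n} (x_i - y_j)`. -/
noncomputable def deltaKernel (n : ℕ) : MvPolynomial (Fin n) (MvPolynomial (Fin n) ℤ) :=
  ∏ p : Fin n × Fin n with ((p.1 : ℕ) + 1) + ((p.2 : ℕ) + 1) ≤ n, (X p.1 - C (X p.2))

/-- The type C double Schubert polynomial
`ℭ_w(X, Y) = (-1)^{n(n-1)/2} ∂'_{w⁻¹ w_0} (Δ(X, Y) Q̃(X, Y))`. -/
noncomputable def doubleSchubertC {n : ℕ} (w : SignedPerm n) :
    MvPolynomial (Fin n) (MvPolynomial (Fin n) ℤ) :=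
  (-1) ^ (n * (n - 1) / 2) *
    divDiffW' (w⁻¹ * SignedPerm.w0 n) (deltaKernel n * qKernel n)

/-- The single polynomial `ℭ_w(X) = ℭ_w(X, 0)`. -/
noncomputable def schubertC {n : ℕ} (w : SignedPerm n) : MvPolynomial (Fin n) ℤ :=
  map constantCoeff (doubleSchubertC w)

namespace StrictPartition

variable {n : ℕ}

/-- The list of indices `λ_1, …, λ_ℓ, λ'_k, …, λ'_1`. -/
def wordList (lam : StrictPartition n) : List (Fin n) :=
  lam.sort (· ≥ ·) ++ lamᶜ.sort (· ≤ ·)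

theorem wordList_nodup (lam : StrictPartition n) : lam.wordList.Nodup := by
  refine List.Nodup.append (Finset.sort_nodup _ _) (Finset.sort_nodup _ _) fun x hx hy => ?_
  rw [Finset.mem_sort] at hx hy
  exact Finset.mem_compl.1 hy hx

theorem mem_wordList (lam : StrictPartition n) (x : Fin n) : x ∈ lam.wordList := by
  rw [wordList, List.mem_append, Finset.mem_sort, Finset.mem_sort, Finset.mem_compl]
  exact em _

theorem wordList_length (lam : StrictPartition n) : lam.wordList.length = n := by
  rw [wordList, List.length_append, Finset.length_sort, Finset.length_sort,
    Finset.card_add_card_compl, Fintype.card_fin]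

/-- The maximal Grassmannian element
`w_λ = (-λ_1, …, -λ_ℓ, λ'_k, …, λ'_1)` of `W_n`, in one-line notation. -/
def maxGrass (lam : StrictPartition n) : SignedPerm n where
  perm := (finCongr lam.wordList_length.symm).trans
    (lam.wordList_nodup.getEquivOfForallMemList _ lam.mem_wordList)
  sign i := if (i : ℕ) < lam.card then -1 else 1

end StrictPartition

/-- `ℭ_ϖ(X)` for a permutation `ϖ ∈ S_n ⊂ W_n`. -/
noncomputable def schubertCPerm {n : ℕ} (u : Equiv.Perm (Fin n)) : MvPolynomial (Fin n) ℤ :=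
  schubertC (SignedPerm.ofPerm u)

/-- `ℭ_λ(X) = ℭ_{w_λ}(X)` for a strict partition `λ ∈ 𝒟_n`. -/
noncomputable def schubertCPart {n : ℕ} (lam : StrictPartition n) : MvPolynomial (Fin n) ℤ :=
  schubertC lam.maxGrass

/-- The substitution `f(X) ↦ f(-ϖ_0 X)`, i.e. `x_i ↦ -x_{n+1-i}`. -/
noncomputable def negRev {n : ℕ} :
    MvPolynomial (Fin n) ℤ →ₐ[ℤ] MvPolynomial (Fin n) ℤ :=
  aeval fun i => -X i.rev

/-! ### Signed permutations: words, length, determinant -/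

namespace SignedPerm

variable {n : ℕ}

/-! The longest element factors as `w_0 = (ϖ_0 w_0) ϖ_0` with lengths adding, and the signs relating
`∂` to `∂'` cancel for `w_0`. Hence `⟨f, g⟩ = T(π(f g))` with `π = ∂'_{ϖ_0}` (`piOp`) and `T =
∂'_{ϖ_0 w_0}` (`topOp`). The `ℭ_ϖ` are the type A Schubert polynomials, and the `ℭ_λ` are the
`Q̃_λ`, which are `S_n`-invariant and so pass through `π`. Everything reduces to the type A pairing
`π(ℭ_u g)` and to `T(Q̃_λ Q̃_μ) = δ_{μ,λ'}`.

That `∂'_w` is independent of the reduced word is obtained without braid relations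
(`tauW_eq_of_length_eq`). Commuting a word of operators past a linear form yields a sum over
single-letter deletions, and this sum, rewritten over all coroots, sees only the product of the
word. Operators of nonreduced words vanish, so a word is reduced as soon as its operator does not
kill some polynomial; this replaces a length formula for `W_n`.

The type A pairing rests on `π` being antisymmetric under `S_n` and making each `∂'_i`, `i ≥ 1`,
self-adjoint. One staircase monomial times a polynomial with complementary degree bounds then has
only its constant term surviving under `π`, by pigeonhole on exponents.

For the `Q̃_λ`, Pfaffians are read as the scalar part of `exp(A)` on an exterior algebra with
generators `ε_0, …, ε_n`. The reflection `s_0` changes the matrix `(Q̃_{p,q})` by a rank-two skew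
matrix, so `∂_0` acts on `Q̃` as a contraction (`tau_first_qForm`), and a word `a, …, 1, 0` acts as
a contraction with coefficients in the later variables. The key to orthogonality is `topOp_move`:
for parts `c < n` the generator `ε_c` can be moved from one factor of `T(Q̃ Q̃)` to the other at the
cost of a sign. This comes from a polynomial which is an eigenvector of `s_0`. Moving all generators
across leaves `T(Q̃_ν)`, which is `1` for the full staircase and `0` otherwise. The part `n` only
contributes a factor `e_n`.

Finally, over the fraction field `∂_{w_0}` is a combination of the `|W_n|` group elements, and the
dual families have exactly `|W_n|` members. A matrix inversion shows that the pairing against the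
dual family is nondegenerate (`eq_zero_of_pairing`). This gives the basis, and it also gives `ℭ_λ =
Q̃_λ`, since both sides have the same pairings. -/

theorem act_X (A : Type*) [CommRing A] (w : SignedPerm n) (i : Fin n) :
    act A w (X i) = ((w.sign i : ℤ) : MvPolynomial (Fin n) A) * X (w.perm i) := by
  simp [act]

theorem act_mul (v w : SignedPerm n) (f : MvPolynomial (Fin n) ℤ) :
    act ℤ (v * w) f = act ℤ v (act ℤ w f) := by
  suffices h : act ℤ (v * w) = (act ℤ v).comp (act ℤ w) from congrArg (fun g => g f) h
  refine MvPolynomial.algHom_ext fun i => ?_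
  simp only [AlgHom.comp_apply, act_X, map_mul, map_intCast, sign_mul, perm_mul,
    Equiv.Perm.mul_apply]
  push_cast
  ring

theorem act_one (f : MvPolynomial (Fin n) ℤ) : act ℤ (1 : SignedPerm n) f = f := by
  suffices h : act ℤ (1 : SignedPerm n) = AlgHom.id ℤ _ from congrArg (fun g => g f) h
  refine MvPolynomial.algHom_ext fun i => ?_
  simp [act_X]

/-- The index before `i` (and `i` itself if `i = 0`). -/
def prev (i : Fin n) : Fin n := ⟨i - 1, (Nat.sub_le _ _).trans_lt i.isLt⟩

@[simp] theorem val_prev (i : Fin n) : (prev i : ℕ) = i - 1 := rfl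

theorem prev_ne {i : Fin n} (hi : (i : ℕ) ≠ 0) : prev i ≠ i := by
  intro h
  have := congrArg Fin.val h
  simp at this
  omega

theorem simpleRefl_zero {i : Fin n} (hi : (i : ℕ) = 0) :
    simpleRefl i = ofSign (Pi.mulSingle i (-1)) := by simp [simpleRefl, hi]

theorem simpleRefl_pos {i : Fin n} (hi : (i : ℕ) ≠ 0) :
    simpleRefl i = ofPerm (Equiv.swap (prev i) i) := by simp [simpleRefl, hi, prev]

@[simp] theorem ofSign_perm (e : Fin n → ℤˣ) : (ofSign e).perm = 1 := rfl
@[simp] theorem ofSign_sign (e : Fin n → ℤˣ) : (ofSign e).sign = e := rfl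
@[simp] theorem ofPerm_perm (u : Equiv.Perm (Fin n)) : (ofPerm u).perm = u := rfl
@[simp] theorem ofPerm_sign (u : Equiv.Perm (Fin n)) (i : Fin n) : (ofPerm u).sign i = 1 := rfl

theorem ofPerm_injective : Function.Injective (ofPerm (n := n)) :=
  fun u v h => by simpa using congrArg perm h

theorem simpleRefl_mul_self (i : Fin n) : simpleRefl i * simpleRefl i = 1 := by
  by_cases hi : (i : ℕ) = 0
  · rw [simpleRefl_zero hi, ← map_mul]
    rw [← Pi.mulSingle_mul]
    simp
  · rw [simpleRefl_pos hi, ← map_mul]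
    simp

@[simp] theorem wordProd_nil : wordProd ([] : List (Fin n)) = 1 := rfl

@[simp] theorem wordProd_cons (i : Fin n) (a : List (Fin n)) :
    wordProd (i :: a) = simpleRefl i * wordProd a := by simp [wordProd]

@[simp] theorem wordProd_append (a b : List (Fin n)) :
    wordProd (a ++ b) = wordProd a * wordProd b := by simp [wordProd]

theorem wordProd_reverse (a : List (Fin n)) : wordProd a.reverse = (wordProd a)⁻¹ := by
  induction a with
  | nil => simp
  | cons i a ih =>
    rw [List.reverse_cons, wordProd_append, ih, wordProd_cons i a, mul_inv_rev, wordProd_cons,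
      wordProd_nil, mul_one]
    congr 1
    exact eq_inv_of_mul_eq_one_left (simpleRefl_mul_self i)

theorem length_le (a : List (Fin n)) : (wordProd a).length ≤ a.length :=
  Nat.sInf_le ⟨a, rfl, rfl⟩

theorem length_mul_le (v w : SignedPerm n) : (v * w).length ≤ v.length + w.length := by
  obtain ⟨a, ha, hal⟩ := exists_isReducedWord v
  obtain ⟨b, hb, hbl⟩ := exists_isReducedWord w
  rw [← hal, ← hbl, ← ha, ← hb, ← wordProd_append, ← List.length_append]
  exact length_le _

theorem length_inv_le (w : SignedPerm n) : w⁻¹.length ≤ w.length := by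
  obtain ⟨a, ha, hal⟩ := exists_isReducedWord w
  rw [← hal, ← ha, ← wordProd_reverse, ← List.length_reverse]
  exact length_le _

theorem length_inv (w : SignedPerm n) : w⁻¹.length = w.length :=
  le_antisymm (length_inv_le w) (by simpa using length_inv_le w⁻¹)

theorem reducedWord_spec (w : SignedPerm n) : IsReducedWord w.reducedWord w :=
  (exists_isReducedWord w).choose_spec

/-- The determinant of a signed permutation matrix. -/
def det : SignedPerm n →* ℤˣ where
  toFun w := Equiv.Perm.sign w.perm * ∏ i, w.sign i
  map_one' := by simp
  map_mul' v w := by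
    simp only [perm_mul, map_mul, sign_mul, Finset.prod_mul_distrib]
    rw [Equiv.prod_comp w.perm (fun i => v.sign i)]
    ac_rfl

theorem det_simpleRefl (i : Fin n) : det (simpleRefl i) = -1 := by
  by_cases hi : (i : ℕ) = 0
  · rw [simpleRefl_zero hi]
    simp [det]
  · rw [simpleRefl_pos hi]
    simp [det, Equiv.Perm.sign_swap (prev_ne hi)]

/-- The determinant fixes the parity of every word for a given element, so multiplying by a simple
reflection can never preserve the length. -/
theorem det_wordProd (a : List (Fin n)) : det (wordProd a) = (-1) ^ a.length := by
  induction a with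
  | nil => simp
  | cons i a ih => rw [wordProd_cons, map_mul, ih, det_simpleRefl, List.length_cons, pow_succ']

end SignedPerm

/-! ### Divided differences on integral polynomials -/

open SignedPerm

/-- The linear form by which the operator `∂'_i` divides. -/
noncomputable def dRoot {n : ℕ} (A : Type*) [CommRing A] (i : Fin n) : MvPolynomial (Fin n) A :=
  if (i : ℕ) = 0 then 2 * X i else X i - X (prev i)

section DivDiff

variable {n : ℕ} {A : Type*} [CommRing A]

theorem dRoot_zero {i : Fin n} (hi : (i : ℕ) = 0) : dRoot A i = 2 * X i := by simp [dRoot, hi]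

theorem dRoot_pos {i : Fin n} (hi : (i : ℕ) ≠ 0) : dRoot A i = X i - X (prev i) := by
  simp [dRoot, hi]

theorem dRoot_mul_divDiff' (i : Fin n) (f : MvPolynomial (Fin n) A) :
    dRoot A i * divDiff' i f = f - act A (simpleRefl i) f := by
  rw [← simpleRoot_mul_divDiff]
  by_cases hi : (i : ℕ) = 0
  · simp [dRoot, simpleRoot, divDiff', hi]
  · simp only [dRoot, simpleRoot, divDiff', hi, if_false, prev]
    ring

theorem dRoot_ne_zero [Nontrivial A] [CharZero A] (i : Fin n) : dRoot A i ≠ 0 := by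
  by_cases hi : (i : ℕ) = 0
  · rw [dRoot_zero hi]
    intro h
    have := congrArg (eval (fun _ => (1 : A))) h
    simp at this
  · rw [dRoot_pos hi, sub_ne_zero]
    exact fun h => prev_ne hi (X_injective h).symm

theorem divDiff'_eq_of [IsDomain A] [CharZero A] {i : Fin n} {f g : MvPolynomial (Fin n) A}
    (h : dRoot A i * g = f - act A (simpleRefl i) f) : divDiff' i f = g :=
  mul_left_cancel₀ (dRoot_ne_zero i) ((dRoot_mul_divDiff' i f).trans h.symm)

end DivDiff

section Tau

variable {n : ℕ}

/-- The reflection `s_i` as an algebra endomorphism of `ℤ[X]`. -/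
noncomputable abbrev sAct (i : Fin n) : MvPolynomial (Fin n) ℤ →ₐ[ℤ] MvPolynomial (Fin n) ℤ :=
  act ℤ (simpleRefl i)

theorem sAct_sAct (i : Fin n) (f : MvPolynomial (Fin n) ℤ) : sAct i (sAct i f) = f := by
  rw [sAct, ← act_mul, simpleRefl_mul_self, act_one]

/-- The operator `∂'_i` on `ℤ[X]` as a linear map. -/
noncomputable def tau (i : Fin n) : MvPolynomial (Fin n) ℤ →ₗ[ℤ] MvPolynomial (Fin n) ℤ :=
  AddMonoidHom.toIntLinearMap
    { toFun := divDiff' i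
      map_zero' := divDiff'_eq_of (by simp)
      map_add' := fun f g => divDiff'_eq_of (by
        rw [mul_add, dRoot_mul_divDiff', dRoot_mul_divDiff', map_add]
        ring) }

theorem tau_apply (i : Fin n) (f : MvPolynomial (Fin n) ℤ) : tau i f = divDiff' i f := rfl

theorem dRoot_mul_tau (i : Fin n) (f : MvPolynomial (Fin n) ℤ) :
    dRoot ℤ i * tau i f = f - sAct i f := dRoot_mul_divDiff' i f

theorem tau_eq_of {i : Fin n} {f g : MvPolynomial (Fin n) ℤ}
    (h : dRoot ℤ i * g = f - sAct i f) : tau i f = g := divDiff'_eq_of h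

theorem sAct_X_zero {i : Fin n} (hi : (i : ℕ) = 0) (j : Fin n) :
    sAct i (X j) = if j = i then -X j else X j := by
  rw [sAct, act_X, simpleRefl_zero hi]
  by_cases hj : j = i
  · subst hj; simp
  · simp [hj]

theorem sAct_X_pos {i : Fin n} (hi : (i : ℕ) ≠ 0) (j : Fin n) :
    sAct i (X j) = X (Equiv.swap (prev i) i j) := by
  rw [sAct, act_X, simpleRefl_pos hi]
  simp

theorem sAct_dRoot (i : Fin n) : sAct i (dRoot ℤ i) = -dRoot ℤ i := by
  by_cases hi : (i : ℕ) = 0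
  · rw [dRoot_zero hi, map_mul, sAct_X_zero hi, map_ofNat]
    simp
  · rw [dRoot_pos hi, map_sub, sAct_X_pos hi, sAct_X_pos hi]
    simp

theorem sAct_tau (i : Fin n) (f : MvPolynomial (Fin n) ℤ) : sAct i (tau i f) = tau i f := by
  have h := congrArg (sAct i) (dRoot_mul_tau i f)
  rw [map_mul, sAct_dRoot, map_sub, sAct_sAct] at h
  refine mul_left_cancel₀ (dRoot_ne_zero i) ?_
  rw [dRoot_mul_tau]
  linear_combination -h

theorem tau_of_sAct_eq {i : Fin n} {f : MvPolynomial (Fin n) ℤ} (h : sAct i f = f) :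
    tau i f = 0 := tau_eq_of (by rw [h]; simp)

theorem sAct_eq_of_tau {i : Fin n} {f : MvPolynomial (Fin n) ℤ} (h : tau i f = 0) :
    sAct i f = f := by
  have := dRoot_mul_tau i f
  rw [h, mul_zero] at this
  exact (sub_eq_zero.1 this.symm).symm

theorem tau_tau (i : Fin n) (f : MvPolynomial (Fin n) ℤ) : tau i (tau i f) = 0 :=
  tau_of_sAct_eq (sAct_tau i f)

theorem tau_sAct (i : Fin n) (f : MvPolynomial (Fin n) ℤ) : tau i (sAct i f) = -tau i f := by
  refine tau_eq_of ?_
  rw [mul_neg, dRoot_mul_tau, sAct_sAct]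
  ring

/-- The twisted Leibniz rule. -/
theorem tau_mul (i : Fin n) (f g : MvPolynomial (Fin n) ℤ) :
    tau i (f * g) = tau i f * g + sAct i f * tau i g := by
  refine tau_eq_of ?_
  rw [map_mul]
  linear_combination g * dRoot_mul_tau i f + sAct i f * dRoot_mul_tau i g

theorem tau_mul_left {i : Fin n} {f : MvPolynomial (Fin n) ℤ} (h : sAct i f = f)
    (g : MvPolynomial (Fin n) ℤ) : tau i (f * g) = f * tau i g := by
  rw [tau_mul, h, tau_of_sAct_eq h, zero_mul, zero_add]

theorem tau_mul_right {i : Fin n} {g : MvPolynomial (Fin n) ℤ} (h : sAct i g = g)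
    (f : MvPolynomial (Fin n) ℤ) : tau i (f * g) = tau i f * g := by
  rw [mul_comm, tau_mul_left h, mul_comm]

theorem tau_one (i : Fin n) : tau i 1 = 0 := tau_of_sAct_eq (map_one _)

/-- The composite `∂'_{a_1} ∘ ⋯ ∘ ∂'_{a_r}`. -/
noncomputable def tauW (a : List (Fin n)) : Module.End ℤ (MvPolynomial (Fin n) ℤ) :=
  (a.map tau).prod

@[simp] theorem tauW_nil : tauW ([] : List (Fin n)) = 1 := rfl

@[simp] theorem tauW_cons (i : Fin n) (a : List (Fin n)) : tauW (i :: a) = tau i * tauW a := by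
  simp [tauW]

@[simp] theorem tauW_append (a b : List (Fin n)) : tauW (a ++ b) = tauW a * tauW b := by
  simp [tauW]

theorem foldr_divDiff' (a : List (Fin n)) (f : MvPolynomial (Fin n) ℤ) :
    a.foldr divDiff' f = tauW a f := by
  induction a with
  | nil => rfl
  | cons i a ih => rw [List.foldr_cons, ih, tauW_cons]; rfl

end Tau

/-! ### Coroots, reflections and deletions of letters -/

namespace SignedPerm

variable {n : ℕ}

noncomputable instance : Fintype (SignedPerm n) :=
  Fintype.ofInjective (fun w => (w.perm, w.sign)) fun _ _ h =>
    SignedPerm.ext (congrArg Prod.fst h) (congrArg Prod.snd h)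

/-- The action of a signed permutation on vectors. -/
def vact (w : SignedPerm n) (v : Fin n → ℤ) : Fin n → ℤ :=
  fun j => (w.sign (w.perm⁻¹ j) : ℤ) * v (w.perm⁻¹ j)

theorem vact_apply_perm (w : SignedPerm n) (v : Fin n → ℤ) (i : Fin n) :
    vact w v (w.perm i) = (w.sign i : ℤ) * v i := by simp [vact]

theorem vact_mul (v w : SignedPerm n) (x : Fin n → ℤ) : vact (v * w) x = vact v (vact w x) := by
  funext j
  simp only [vact, perm_mul, sign_mul, mul_inv_rev, Equiv.Perm.mul_apply]
  simp only [← Equiv.Perm.mul_apply, mul_inv_cancel_left]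
  push_cast
  ring

@[simp] theorem vact_one (x : Fin n → ℤ) : vact 1 x = x := by funext j; simp [vact]

@[simp] theorem vact_inv_vact (w : SignedPerm n) (x : Fin n → ℤ) : vact w⁻¹ (vact w x) = x := by
  rw [← vact_mul, inv_mul_cancel, vact_one]

@[simp] theorem vact_vact_inv (w : SignedPerm n) (x : Fin n → ℤ) : vact w (vact w⁻¹ x) = x := by
  rw [← vact_mul, mul_inv_cancel, vact_one]

theorem vact_neg (w : SignedPerm n) (x : Fin n → ℤ) : vact w (-x) = -vact w x := by
  funext j; simp [vact]

theorem vact_sub (w : SignedPerm n) (x y : Fin n → ℤ) : vact w (x - y) = vact w x - vact w y := by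
  funext j; simp [vact, mul_sub]

theorem vact_smul (w : SignedPerm n) (c : ℤ) (x : Fin n → ℤ) : vact w (c • x) = c • vact w x := by
  funext j; simp [vact]; ring

theorem vact_dotProduct (w : SignedPerm n) (x y : Fin n → ℤ) :
    vact w x ⬝ᵥ vact w y = x ⬝ᵥ y := by
  simp only [dotProduct]
  rw [← Equiv.sum_comp w.perm]
  refine Finset.sum_congr rfl fun i _ => ?_
  rw [vact_apply_perm, vact_apply_perm]
  have : ((w.sign i : ℤ)) * (w.sign i : ℤ) = 1 := by
    rw [← Units.val_mul, Int.units_mul_self, Units.val_one]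
  linear_combination x i * y i * this

theorem vact_injective {v w : SignedPerm n} (h : ∀ x, vact v x = vact w x) : v = w := by
  have key : ∀ i, v.perm i = w.perm i ∧ v.sign i = w.sign i := by
    intro i
    have h1 := congrFun (h (Pi.single i 1)) (v.perm i)
    rw [vact_apply_perm, Pi.single_eq_same, mul_one] at h1
    have h2 : w.perm⁻¹ (v.perm i) = i := by
      by_contra hne
      rw [vact, Pi.single_eq_of_ne hne, mul_zero] at h1
      exact (v.sign i).ne_zero h1
    have h3 : v.perm i = w.perm i := by rw [← h2, ← Equiv.Perm.mul_apply w.perm, mul_inv_cancel, h2]; rfl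
    refine ⟨h3, ?_⟩
    rw [h3, vact_apply_perm, Pi.single_eq_same, mul_one] at h1
    exact Units.ext h1
  exact SignedPerm.ext (Equiv.ext fun i => (key i).1) (funext fun i => (key i).2)

/-- The simple coroots. -/
def simpleVec (i : Fin n) : Fin n → ℤ :=
  if (i : ℕ) = 0 then Pi.single i 1 else Pi.single i 1 - Pi.single (prev i) 1

/-- Twice the inverse of the squared length of a simple coroot. -/
def simpleScale (i : Fin n) : ℤ := if (i : ℕ) = 0 then 2 else 1

theorem simpleScale_mul (i : Fin n) : simpleScale i * (simpleVec i ⬝ᵥ simpleVec i) = 2 := by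
  by_cases hi : (i : ℕ) = 0
  · simp [simpleScale, simpleVec, hi]
  · simp [simpleScale, simpleVec, hi, prev_ne hi, (prev_ne hi).symm]

theorem vact_simpleRefl_zero {i : Fin n} (hi : (i : ℕ) = 0) (v : Fin n → ℤ) (j : Fin n) :
    vact (simpleRefl i) v j = if j = i then -v j else v j := by
  rw [vact, simpleRefl_zero hi]
  by_cases hj : j = i
  · subst hj; simp
  · simp [hj]

theorem vact_simpleRefl_pos {i : Fin n} (hi : (i : ℕ) ≠ 0) (v : Fin n → ℤ) (j : Fin n) :
    vact (simpleRefl i) v j = v (Equiv.swap (prev i) i j) := by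
  rw [vact, simpleRefl_pos hi]
  simp

theorem vact_simpleRefl (i : Fin n) (v : Fin n → ℤ) :
    vact (simpleRefl i) v = v - (simpleScale i * (v ⬝ᵥ simpleVec i)) • simpleVec i := by
  funext j
  by_cases hi : (i : ℕ) = 0
  · rw [vact_simpleRefl_zero hi]
    by_cases hj : j = i
    · subst hj; simp [simpleScale, simpleVec, hi]; ring
    · simp [simpleScale, simpleVec, hi, hj]
  · rw [vact_simpleRefl_pos hi, Equiv.swap_apply_def]
    have := prev_ne hi
    split_ifs with h1 h2
    · subst h1; simp [simpleScale, simpleVec, hi, this]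
    · subst h2; simp [simpleScale, simpleVec, hi, this.symm]
    · simp [simpleScale, simpleVec, hi, h1, h2]

theorem vact_simpleRefl_simpleVec (i : Fin n) :
    vact (simpleRefl i) (simpleVec i) = -simpleVec i := by
  rw [vact_simpleRefl, simpleScale_mul]
  funext j
  simp only [Pi.sub_apply, Pi.smul_apply, Pi.neg_apply, smul_eq_mul]
  ring

/-- A coroot: an image of a simple coroot. -/
def IsRoot (v : Fin n → ℤ) : Prop := ∃ (u : SignedPerm n) (i : Fin n), v = vact u (simpleVec i)

theorem IsRoot.vact {v : Fin n → ℤ} (h : IsRoot v) (w : SignedPerm n) : IsRoot (vact w v) := by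
  obtain ⟨u, i, rfl⟩ := h
  exact ⟨w * u, i, (vact_mul _ _ _).symm⟩

theorem IsRoot.neg {v : Fin n → ℤ} (h : IsRoot v) : IsRoot (-v) := by
  obtain ⟨u, i, rfl⟩ := h
  exact ⟨u * simpleRefl i, i, by rw [vact_mul, vact_simpleRefl_simpleVec, vact_neg]⟩

theorem isRoot_simpleVec (i : Fin n) : IsRoot (simpleVec i) := ⟨1, i, (vact_one _).symm⟩

theorem simpleVec_sq_le (i : Fin n) : simpleVec i ⬝ᵥ simpleVec i ≤ 2 := by
  have := simpleScale_mul i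
  unfold simpleScale at this
  split_ifs at this <;> omega

theorem IsRoot.sq_le {v : Fin n → ℤ} (h : IsRoot v) : v ⬝ᵥ v ≤ 2 := by
  obtain ⟨u, i, rfl⟩ := h
  rw [vact_dotProduct]
  exact simpleVec_sq_le i

theorem IsRoot.ne_zero {v : Fin n → ℤ} (h : IsRoot v) : v ≠ 0 := by
  obtain ⟨u, i, rfl⟩ := h
  intro h0
  have h1 := vact_dotProduct u (simpleVec i) (simpleVec i)
  rw [h0, zero_dotProduct] at h1
  have := simpleScale_mul i
  rw [← h1] at this
  simp at this

/-- The reflection in a coroot. -/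
noncomputable def reflection (v : Fin n → ℤ) : SignedPerm n :=
  open Classical in
  if h : IsRoot v then h.choose * simpleRefl h.choose_spec.choose * h.choose⁻¹ else 1

theorem vact_conj_simpleRefl (u : SignedPerm n) (i : Fin n) (x : Fin n → ℤ) :
    vact (u * simpleRefl i * u⁻¹) x =
      x - (simpleScale i * (x ⬝ᵥ vact u (simpleVec i))) • vact u (simpleVec i) := by
  rw [vact_mul, vact_mul, vact_simpleRefl, vact_sub, vact_vact_inv, vact_smul,
    ← vact_dotProduct u, vact_vact_inv]

/-- The conjugate acts by `x ↦ x - s (x·v) v` with `s |v|² = 2`. This depends on `v` only and is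
even in `v`, so neither the chosen presentation of `v` nor its sign matters. -/
theorem reflection_eq {v : Fin n → ℤ} {u : SignedPerm n} {i : Fin n}
    (h : v = vact u (simpleVec i) ∨ v = -vact u (simpleVec i)) :
    reflection v = u * simpleRefl i * u⁻¹ := by
  have hv : IsRoot v := by
    rcases h with rfl | rfl
    · exact ⟨u, i, rfl⟩
    · exact IsRoot.neg ⟨u, i, rfl⟩
  rw [reflection, dif_pos hv]
  have h3 := hv.choose_spec.choose_spec
  set u' := hv.choose
  set i' := hv.choose_spec.choose
  refine vact_injective fun x => ?_
  rw [vact_conj_simpleRefl, vact_conj_simpleRefl, ← h3]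
  have hs : simpleScale i' = simpleScale i := by
    have a := simpleScale_mul i
    have b := simpleScale_mul i'
    rw [← vact_dotProduct u', ← h3] at b
    rw [← vact_dotProduct u] at a
    have hd : vact u (simpleVec i) ⬝ᵥ vact u (simpleVec i) = v ⬝ᵥ v := by
      rcases h with rfl | rfl <;> simp
    rw [hd] at a
    have hne : v ⬝ᵥ v ≠ 0 := by intro h0; rw [h0] at a; simp at a
    exact mul_right_cancel₀ hne (b.trans a.symm)
  rw [hs]
  rcases h with rfl | rfl
  · rfl
  · simp

/-- The last nonzero coordinate is negative. -/
def IsNeg (v : Fin n → ℤ) : Prop := ∃ k, v k < 0 ∧ ∀ j, k < j → v j = 0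

theorem not_isNeg_and (v : Fin n → ℤ) : ¬(IsNeg v ∧ IsNeg (-v)) := by
  rintro ⟨⟨k, hk, hk'⟩, l, hl, hl'⟩
  simp only [Pi.neg_apply, neg_eq_zero] at hl hl'
  rcases lt_trichotomy k l with h | h | h
  · have := hk' l h; omega
  · subst h; omega
  · have := hl' k h; omega

theorem isNeg_simpleVec (i : Fin n) : IsNeg (-simpleVec i) := by
  refine ⟨i, ?_, fun j hj => ?_⟩
  · by_cases hi : (i : ℕ) = 0
    · simp [simpleVec, hi]
    · simp [simpleVec, hi, (prev_ne hi).symm]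
  · by_cases hi : (i : ℕ) = 0
    · simp [simpleVec, hi, hj.ne']
    · have : j ≠ prev i := by
        rintro rfl
        have := Fin.lt_def.1 hj
        simp at this
        omega
      simp [simpleVec, hi, hj.ne', this]

theorem sq_add_sq_le (v : Fin n → ℤ) {i j : Fin n} (h : i ≠ j) :
    v i * v i + v j * v j ≤ v ⬝ᵥ v := by
  rw [dotProduct, ← Finset.sum_pair (f := fun k => v k * v k) h]
  exact Finset.sum_le_sum_of_subset_of_nonneg (Finset.subset_univ _)
    fun k _ _ => mul_self_nonneg _

theorem sq_add_sq_add_sq_le (v : Fin n → ℤ) {i j k : Fin n} (h : i ≠ j) (hk : k ≠ i)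
    (hk' : k ≠ j) : v k * v k + (v i * v i + v j * v j) ≤ v ⬝ᵥ v := by
  rw [dotProduct, ← Finset.sum_pair (f := fun k => v k * v k) h,
    ← Finset.sum_insert (f := fun k => v k * v k) (by simp [hk, hk'])]
  exact Finset.sum_le_sum_of_subset_of_nonneg (Finset.subset_univ _)
    fun k _ _ => mul_self_nonneg _

/-- A simple reflection alters at most two adjacent coordinates, so it can change the sign of the
last nonzero one only in a very special position. There the bound `|v|² ≤ 2` pins down every
coordinate and forces `v = -α_i`; no list of the coroots is needed. -/
theorem IsNeg.simpleRefl {v : Fin n → ℤ} (hv : IsRoot v) (hneg : IsNeg v) {i : Fin n}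
    (hne : v ≠ -simpleVec i) : IsNeg (vact (simpleRefl i) v) := by
  obtain ⟨k, hk, hk'⟩ := hneg
  have hsq := hv.sq_le
  by_cases hi : (i : ℕ) = 0
  · by_cases hki : k = i
    · exfalso
      subst hki
      apply hne
      funext j
      by_cases hj : j = k
      · subst hj
        have h1 : v j * v j ≤ v ⬝ᵥ v :=
          Finset.single_le_sum (f := fun k => v k * v k) (fun k _ => mul_self_nonneg _)
            (Finset.mem_univ j)
        have : v j = -1 := by nlinarith
        simp [simpleVec, hi, this]
      · have : k < j := by
          rw [Fin.lt_def]
          have : (j : ℕ) ≠ k := fun h => hj (Fin.ext h)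
          omega
        simp [simpleVec, hi, hj, hk' j this]
    · refine ⟨k, ?_, fun j hj => ?_⟩
      · rw [vact_simpleRefl_zero hi, if_neg hki]; exact hk
      · rw [vact_simpleRefl_zero hi, hk' j hj]; simp
  · have hp := prev_ne hi
    have hlt : prev i < i := by rw [Fin.lt_def, val_prev]; omega
    by_cases hki : k = i
    · subst hki
      rcases lt_trichotomy (v (prev k)) 0 with h | h | h
      · refine ⟨k, ?_, fun j hj => ?_⟩
        · rw [vact_simpleRefl_pos hi, Equiv.swap_apply_right]; exact h
        · rw [vact_simpleRefl_pos hi,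
            Equiv.swap_apply_of_ne_of_ne (hlt.trans hj).ne' hj.ne', hk' j hj]
      · refine ⟨prev k, ?_, fun j hj => ?_⟩
        · rw [vact_simpleRefl_pos hi, Equiv.swap_apply_left]; exact hk
        · rw [vact_simpleRefl_pos hi]
          by_cases hjk : j = k
          · rw [hjk, Equiv.swap_apply_right, h]
          · rw [Equiv.swap_apply_of_ne_of_ne hj.ne' hjk]
            apply hk'
            rw [Fin.lt_def] at hj ⊢
            rw [val_prev] at hj
            have : (j : ℕ) ≠ k := fun h => hjk (Fin.ext h)
            omega
      · exfalso
        apply hne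
        have h2 := sq_add_sq_le v hp
        have h3 : v (prev k) = 1 := by nlinarith
        have h4 : v k = -1 := by nlinarith
        funext j
        by_cases hj : j = k
        · subst hj; simp [simpleVec, hi, h4, hp.symm]
        by_cases hj' : j = prev k
        · rw [hj', h3]; simp [simpleVec, hi, hp]
        have h5 := sq_add_sq_add_sq_le v hp hj' hj
        rw [h3, h4] at h5
        have h6 : v j = 0 := by nlinarith
        simp [simpleVec, hi, hj, hj', h6]
    · by_cases hkp : k = prev i
      · subst hkp
        refine ⟨i, ?_, fun j hj => ?_⟩
        · rw [vact_simpleRefl_pos hi, Equiv.swap_apply_right]; exact hk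
        · rw [vact_simpleRefl_pos hi,
            Equiv.swap_apply_of_ne_of_ne (hlt.trans hj).ne' hj.ne', hk' j (hlt.trans hj)]
      · refine ⟨k, ?_, fun j hj => ?_⟩
        · rw [vact_simpleRefl_pos hi, Equiv.swap_apply_of_ne_of_ne hkp hki]; exact hk
        · rw [vact_simpleRefl_pos hi]
          apply hk'
          rw [Equiv.swap_apply_def]
          have a1 : (k : ℕ) ≠ i := fun h => hki (Fin.ext h)
          have a2 : (k : ℕ) ≠ i - 1 := fun h => hkp (Fin.ext h)
          rw [Fin.lt_def] at hj
          split_ifs with h1 h2 <;> rw [Fin.lt_def]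
          · rw [h1, val_prev] at hj; omega
          · rw [h2] at hj; rw [val_prev]; omega
          · exact hj

theorem isNeg_simpleRefl_iff {v : Fin n → ℤ} (hv : IsRoot v) {i : Fin n}
    (h1 : v ≠ simpleVec i) (h2 : v ≠ -simpleVec i) :
    IsNeg (vact (simpleRefl i) v) ↔ IsNeg v := by
  refine ⟨fun h => ?_, fun h => h.simpleRefl hv h2⟩
  have h3 : vact (SignedPerm.simpleRefl i) v ≠ -simpleVec i := by
    intro h4
    apply h1
    have := congrArg (vact (SignedPerm.simpleRefl i)) h4
    rwa [← vact_mul, simpleRefl_mul_self, vact_one, vact_neg, vact_simpleRefl_simpleVec,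
      neg_neg] at this
  have := h.simpleRefl (hv.vact _) h3
  rwa [← vact_mul, simpleRefl_mul_self, vact_one] at this

open Classical in
/-- The finite set of all coroots. -/
noncomputable def roots (n : ℕ) : Finset (Fin n → ℤ) :=
  Finset.univ.image fun p : SignedPerm n × Fin n => vact p.1 (simpleVec p.2)

theorem mem_roots {v : Fin n → ℤ} : v ∈ roots n ↔ IsRoot v := by
  simp [roots, IsRoot, eq_comm]

open Classical in
/-- The indicator function of the negative vectors. -/
noncomputable def negInd (v : Fin n → ℤ) : ℤ := if IsNeg v then 1 else 0

/-- The deletions of single letters in a word, each with the coroot belonging to it. -/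
def deletions : List (Fin n) → List ((Fin n → ℤ) × List (Fin n))
  | [] => []
  | i :: b => (vact (wordProd b)⁻¹ (simpleVec i), b) ::
      (deletions b).map fun p => (p.1, i :: p.2)

/-- Dropping the letter `i` in front of a suffix `b` multiplies the product on the right by the
reflection in `b⁻¹α_i`, the coroot recorded with the deletion. -/
theorem deletions_spec {a : List (Fin n)} : ∀ p ∈ deletions a,
    p.2.length + 1 = a.length ∧ IsRoot p.1 ∧ wordProd p.2 = wordProd a * reflection p.1 := by
  induction a with
  | nil => simp [deletions]
  | cons i b ih =>
    intro p hp
    rw [deletions, List.mem_cons, List.mem_map] at hp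
    rcases hp with rfl | ⟨p, hp, rfl⟩
    · refine ⟨rfl, (isRoot_simpleVec i).vact _, ?_⟩
      rw [reflection_eq (Or.inl rfl), wordProd_cons]
      simp only [inv_inv]
      rw [mul_assoc (simpleRefl i), ← mul_assoc (wordProd b), ← mul_assoc (wordProd b),
        mul_inv_cancel, one_mul, ← mul_assoc, simpleRefl_mul_self, one_mul]
    · obtain ⟨h1, h2, h3⟩ := ih p hp
      exact ⟨by simp [h1], h2, by simp [h3, mul_assoc]⟩

/-- Prefixing `i` to `b` changes the negativity of the image of exactly two coroots, `±β` with `β =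
b⁻¹α_i`. By oddness they contribute `F(β) - F(-β) = 2 F(β)`, whence the factor `2`. The right side
depends on the word only through its product, even if the word is not reduced. -/
theorem two_mul_sum_deletions {M : Type*} [AddCommGroup M] (F : (Fin n → ℤ) → M)
    (hF : ∀ v, F (-v) = -F v) (a : List (Fin n)) :
    (2 : ℤ) • ((deletions a).map fun p => F p.1).sum =
      ∑ v ∈ roots n, (negInd (vact (wordProd a) v) - negInd v) • F v := by
  induction a with
  | nil => simp [deletions]
  | cons i b ih =>
    rw [deletions, List.map_cons, List.sum_cons, List.map_map]
    change (2 : ℤ) • (_ + ((deletions b).map fun p => F p.1).sum) = _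
    rw [smul_add, ih, ← eq_sub_iff_add_eq, ← Finset.sum_sub_distrib]
    set β := vact (wordProd b)⁻¹ (simpleVec i) with hβ
    have hβr : IsRoot β := (isRoot_simpleVec i).vact _
    have hbβ : vact (wordProd b) β = simpleVec i := vact_vact_inv _ _
    have hne : β ≠ -β := by
      intro h
      apply hβr.ne_zero
      funext j
      have := congrFun h j
      simp only [Pi.neg_apply, Pi.zero_apply] at this ⊢
      omega
    have hsub : ({β, -β} : Finset (Fin n → ℤ)) ⊆ roots n := by
      intro v hv
      simp only [Finset.mem_insert, Finset.mem_singleton] at hv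
      rcases hv with rfl | rfl
      · exact mem_roots.2 hβr
      · exact mem_roots.2 hβr.neg
    rw [← Finset.sum_subset hsub]
    · rw [Finset.sum_pair hne]
      have e1 : negInd (vact (wordProd (i :: b)) β) = 1 := by
        rw [wordProd_cons, vact_mul, hbβ, vact_simpleRefl_simpleVec, negInd,
          if_pos (isNeg_simpleVec i)]
      have e2 : negInd (vact (wordProd b) β) = 0 := by
        rw [hbβ, negInd, if_neg fun h => not_isNeg_and _ ⟨h, isNeg_simpleVec i⟩]
      have e3 : negInd (vact (wordProd (i :: b)) (-β)) = 0 := by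
        rw [wordProd_cons, vact_mul, vact_neg, hbβ, vact_neg, vact_simpleRefl_simpleVec, neg_neg,
          negInd, if_neg fun h => not_isNeg_and _ ⟨h, isNeg_simpleVec i⟩]
      have e4 : negInd (vact (wordProd b) (-β)) = 1 := by
        rw [vact_neg, hbβ, negInd, if_pos (isNeg_simpleVec i)]
      rw [e1, e2, e3, e4, hF]
      module
    · intro v hv hv'
      rw [mem_roots] at hv
      simp only [Finset.mem_insert, Finset.mem_singleton, not_or] at hv'
      have : negInd (vact (wordProd (i :: b)) v) = negInd (vact (wordProd b) v) := by
        rw [wordProd_cons, vact_mul, negInd, negInd]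
        have := isNeg_simpleRefl_iff (hv.vact (wordProd b)) (i := i)
          (fun h => hv'.1 (by rw [hβ, ← h, vact_inv_vact]))
          (fun h => hv'.2 (by rw [hβ, ← vact_neg, ← h, vact_inv_vact]))
        classical exact if_congr this rfl rfl
      rw [this]
      module

end SignedPerm

open SignedPerm

/-! ### Independence of the word, and vanishing on nonreduced words -/

section Independence

variable {n : ℕ}

/-- The linear form with given coefficients. -/
noncomputable def linForm (v : Fin n → ℤ) : MvPolynomial (Fin n) ℤ := ∑ j, C (v j) * X j

theorem act_linForm (w : SignedPerm n) (v : Fin n → ℤ) :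
    act ℤ w (linForm v) = linForm (vact w v) := by
  rw [linForm, linForm, map_sum, ← Equiv.sum_comp w.perm fun j => C (vact w v j) * X j]
  refine Finset.sum_congr rfl fun j _ => ?_
  rw [map_mul, act_X, vact_apply_perm]
  have : act ℤ w (C (v j)) = C (v j) := AlgHom.commutes _ _
  rw [this, C_mul]
  simp only [eq_intCast]
  ring

theorem linForm_single (i : Fin n) : linForm (Pi.single i 1) = X i := by
  rw [linForm, Finset.sum_eq_single i]
  · simp
  · intro j _ hj; simp [hj]
  · simp

theorem linForm_sub (v w : Fin n → ℤ) : linForm (v - w) = linForm v - linForm w := by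
  simp [linForm, sub_mul]

theorem linForm_smul (c : ℤ) (v : Fin n → ℤ) : linForm (c • v) = C c * linForm v := by
  simp [linForm, Finset.mul_sum, mul_assoc]

theorem dRoot_eq_linForm (i : Fin n) : dRoot ℤ i = C (simpleScale i) * linForm (simpleVec i) := by
  by_cases hi : (i : ℕ) = 0
  · simp [dRoot, simpleScale, simpleVec, hi, linForm_single]
  · simp [dRoot, simpleScale, simpleVec, hi, linForm_single, linForm_sub]

theorem tau_linForm (i : Fin n) (v : Fin n → ℤ) :
    tau i (linForm v) = C (v ⬝ᵥ simpleVec i) := by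
  refine tau_eq_of ?_
  rw [sAct, act_linForm, vact_simpleRefl, linForm_sub, linForm_smul, dRoot_eq_linForm, C_mul]
  ring

/-- Iterated Leibniz rule: a divided difference of a linear form is a scalar, so each extra term
arises from one letter being spent on the linear form. -/
theorem tauW_linForm_mul (a : List (Fin n)) (v : Fin n → ℤ) (f : MvPolynomial (Fin n) ℤ) :
    tauW a (linForm v * f) = linForm (vact (wordProd a) v) * tauW a f +
      ((deletions a).map fun p => C (v ⬝ᵥ p.1) * tauW p.2 f).sum := by
  induction a with
  | nil => simp [deletions]
  | cons i b ih =>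
    rw [tauW_cons, Module.End.mul_apply, ih, map_add, tau_mul, tau_linForm, sAct, act_linForm,
      ← vact_mul, ← wordProd_cons, deletions, List.map_cons, List.sum_cons, List.map_map,
      map_list_sum, List.map_map]
    have h1 : (tau i ∘ fun p : (Fin n → ℤ) × List (Fin n) => C (v ⬝ᵥ p.1) * tauW p.2 f) =
        (fun p => C (v ⬝ᵥ p.1) * tauW p.2 f) ∘
          fun p : (Fin n → ℤ) × List (Fin n) => (p.1, i :: p.2) := by
      funext p
      simp only [Function.comp_apply, tauW_cons, Module.End.mul_apply]
      exact tau_mul_left (AlgHom.commutes _ _) _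
    rw [h1]
    have h2 : vact (wordProd b) v ⬝ᵥ simpleVec i = v ⬝ᵥ vact (wordProd b)⁻¹ (simpleVec i) := by
      rw [← vact_dotProduct (wordProd b)⁻¹, vact_inv_vact]
    rw [h2, Module.End.mul_apply]
    ring

theorem tauW_one {a : List (Fin n)} (ha : a ≠ []) : tauW a 1 = 0 := by
  induction a with
  | nil => exact absurd rfl ha
  | cons i b ih =>
    rw [tauW_cons, Module.End.mul_apply]
    by_cases hb : b = []
    · subst hb; exact tau_one i
    · rw [ih hb, map_zero]

/-- The operators `∂'_a` of words of the same length depend only on the product of the word. -/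
theorem tauW_eq_of_length_eq (r : ℕ) : ∀ a b : List (Fin n), a.length = r → b.length = r →
    wordProd a = wordProd b → tauW a = tauW b := by
  classical
  induction r with
  | zero =>
    intro a b ha hb _
    rw [List.length_eq_zero_iff.1 ha, List.length_eq_zero_iff.1 hb]
  | succ r ih =>
    intro a b ha hb hab
    -- By the induction hypothesis, operators of words of length `r` factor through the group. `Θ`
    -- is the induced function, set to zero on elements having no word of length `r`.
    let Θ : SignedPerm n → Module.End ℤ (MvPolynomial (Fin n) ℤ) := fun g =>
      if h : ∃ c : List (Fin n), c.length = r ∧ wordProd c = g then tauW h.choose else 0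
    have hΘ : ∀ c : List (Fin n), c.length = r → tauW c = Θ (wordProd c) := by
      intro c hc
      have h : ∃ d : List (Fin n), d.length = r ∧ wordProd d = wordProd c := ⟨c, hc, rfl⟩
      simp only [Θ, dif_pos h]
      exact ih _ _ hc h.choose_spec.1 h.choose_spec.2.symm
    have key : ∀ (v : Fin n → ℤ) (f : MvPolynomial (Fin n) ℤ),
        ((deletions a).map fun p => C (v ⬝ᵥ p.1) * tauW p.2 f).sum =
          ((deletions b).map fun p => C (v ⬝ᵥ p.1) * tauW p.2 f).sum := by
      intro v f
      -- The summand as a function of the coroot alone: the scalar is odd and the reflection even,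
      -- so `F` is odd and its sum over deletions is determined by the product of the word.
      let F : (Fin n → ℤ) → MvPolynomial (Fin n) ℤ := fun x =>
        C (v ⬝ᵥ x) * Θ (wordProd a * reflection x) f
      have hF : ∀ x, F (-x) = -F x := by
        intro x
        by_cases hx : IsRoot x
        · obtain ⟨u, i, rfl⟩ := hx
          simp only [F]
          rw [reflection_eq (Or.inr rfl), reflection_eq (Or.inl rfl)]
          simp
        · have : ¬IsRoot (-x) := fun h => hx (by simpa using h.neg)
          simp [F, reflection, hx, this]
      have hsum : ∀ c : List (Fin n), c.length = r + 1 → wordProd c = wordProd a →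
          ((deletions c).map fun p => C (v ⬝ᵥ p.1) * tauW p.2 f).sum =
            ((deletions c).map fun p => F p.1).sum := by
        intro c hc hca
        refine congrArg List.sum (List.map_congr_left fun p hp => ?_)
        obtain ⟨h1, _, h3⟩ := deletions_spec p hp
        rw [hΘ p.2 (by omega), h3, hca]
      rw [hsum a ha rfl, hsum b hb hab.symm]
      have h2 : (2 : ℤ) • ((deletions a).map fun p => F p.1).sum =
          (2 : ℤ) • ((deletions b).map fun p => F p.1).sum := by
        rw [two_mul_sum_deletions F hF, two_mul_sum_deletions F hF, hab]
      exact smul_right_injective _ two_ne_zero h2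
    refine LinearMap.ext fun f => ?_
    -- Constants are killed because both words are nonempty. Multiplication by a variable is the
    -- linear form case, where the deletion sums agree by `key`.
    induction f using MvPolynomial.induction_on with
    | C c =>
      have h1 : (C c : MvPolynomial (Fin n) ℤ) = c • 1 := by simp [Algebra.smul_def]
      rw [h1, map_smul, map_smul, tauW_one, tauW_one]
      · rintro rfl; simp at hb
      · rintro rfl; simp at ha
    | add p q hp hq => rw [map_add, map_add, hp, hq]
    | mul_X p i hp =>
      rw [mul_comm, ← linForm_single, tauW_linForm_mul, tauW_linForm_mul, hp, key, hab]

theorem length_simpleRefl_mul (i : Fin n) (w : SignedPerm n) :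
    (simpleRefl i * w).length = w.length + 1 ∨ (simpleRefl i * w).length + 1 = w.length := by
  have h1 : (simpleRefl i * w).length ≤ w.length + 1 := by
    obtain ⟨a, ha, hal⟩ := exists_isReducedWord w
    have := length_le (i :: a)
    rwa [wordProd_cons, ha, List.length_cons, hal] at this
  have h2 : w.length ≤ (simpleRefl i * w).length + 1 := by
    obtain ⟨a, ha, hal⟩ := exists_isReducedWord (simpleRefl i * w)
    have := length_le (i :: a)
    rwa [wordProd_cons, ha, ← mul_assoc, simpleRefl_mul_self, one_mul, List.length_cons,
      hal] at this
  have h3 : (simpleRefl i * w).length ≠ w.length := by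
    intro h
    obtain ⟨a, ha, hal⟩ := exists_isReducedWord w
    obtain ⟨b, hb, hbl⟩ := exists_isReducedWord (simpleRefl i * w)
    have e1 := det_wordProd a
    have e2 := det_wordProd b
    rw [ha, hal] at e1
    rw [hb, hbl, h, map_mul, det_simpleRefl, e1] at e2
    have h4 := mul_right_cancel (b := (-1 : ℤˣ) ^ w.length) (e2.trans (one_mul _).symm)
    exact absurd h4 (by decide)
  omega

/-- At the first suffix where reducedness fails, prefixing `i` drops the length by one. The reduced
suffix `b` can then be traded for a word of equal length starting with `i`, and `∂'_i ∂'_i = 0`. -/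
theorem tauW_eq_zero {a : List (Fin n)} (ha : (wordProd a).length ≠ a.length) : tauW a = 0 := by
  induction a with
  | nil =>
    exact absurd (Nat.le_zero.1 (length_le [])) ha
  | cons i b ih =>
    rw [tauW_cons]
    by_cases hb : (wordProd b).length = b.length
    · rw [wordProd_cons, List.length_cons] at ha
      rcases length_simpleRefl_mul i (wordProd b) with h | h
      · omega
      · obtain ⟨c, hc, hcl⟩ := exists_isReducedWord (simpleRefl i * wordProd b)
        have h1 : tauW b = tauW (i :: c) :=
          tauW_eq_of_length_eq b.length b (i :: c) rfl (by rw [List.length_cons]; omega) (by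
            rw [wordProd_cons, hc, ← mul_assoc, simpleRefl_mul_self, one_mul])
        rw [h1, tauW_cons]
        exact LinearMap.ext fun f => tau_tau i _
    · rw [ih hb, mul_zero]

/-- The reducedness test used throughout: exhibiting one polynomial that is not annihilated replaces
any count of inversions in `W_n`. -/
theorem isReducedWord_of_tauW_ne_zero {a : List (Fin n)} {f : MvPolynomial (Fin n) ℤ}
    (h : tauW a f ≠ 0) : IsReducedWord a (wordProd a) := by
  refine ⟨rfl, ?_⟩
  by_contra hne
  exact h (by rw [tauW_eq_zero (Ne.symm hne)]; rfl)

theorem tauW_congr {a b : List (Fin n)} {w : SignedPerm n} (ha : IsReducedWord a w)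
    (hb : IsReducedWord b w) : tauW a = tauW b :=
  tauW_eq_of_length_eq w.length a b ha.2 hb.2 (ha.1.trans hb.1.symm)

theorem divDiffW'_eq {a : List (Fin n)} {w : SignedPerm n} (ha : IsReducedWord a w)
    (f : MvPolynomial (Fin n) ℤ) : divDiffW' w f = tauW a f := by
  rw [divDiffW', foldr_divDiff', tauW_congr w.reducedWord_spec ha]

/-- Every letter `i ≥ 1` contributes one sign and one transposition. For `w_0` the underlying
permutation is trivial, so `∂_{w_0} = ∂'_{w_0}`. -/
theorem foldr_divDiff (a : List (Fin n)) (f : MvPolynomial (Fin n) ℤ) :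
    a.foldr divDiff f = (Equiv.Perm.sign (wordProd a).perm : ℤ) • tauW a f := by
  induction a with
  | nil => simp
  | cons i b ih =>
    rw [List.foldr_cons, ih, tauW_cons, wordProd_cons, perm_mul, Equiv.Perm.sign_mul,
      Module.End.mul_apply]
    have h : ∀ g : MvPolynomial (Fin n) ℤ,
        divDiff i g = (Equiv.Perm.sign (simpleRefl i).perm : ℤ) • tau i g := by
      intro g
      rw [tau_apply, divDiff']
      by_cases hi : (i : ℕ) = 0
      · simp [hi, simpleRefl_zero]
      · simp [hi, simpleRefl_pos, Equiv.Perm.sign_swap (prev_ne hi)]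
    rw [h, map_smul, smul_smul, Units.val_mul]

theorem scalarProd_eq {a : List (Fin n)} (ha : IsReducedWord a (w0 n))
    (f g : MvPolynomial (Fin n) ℤ) : scalarProd f g = tauW a (f * g) := by
  rw [scalarProd, divDiffW, foldr_divDiff, tauW_congr (w0 n).reducedWord_spec ha,
    ((w0 n).reducedWord_spec).1]
  simp [w0]

end Independence

/-! ### Elementary symmetric polynomials in the last variables -/

section EsymmFrom

variable {n : ℕ}

/-- The `k`-th elementary symmetric polynomial in the variables of index at least `m`. -/
noncomputable def esymmFrom (n m k : ℕ) : MvPolynomial (Fin n) ℤ :=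
  ∑ s ∈ (Finset.univ.filter fun j : Fin n => m ≤ j).powersetCard k, ∏ j ∈ s, X j

@[simp] theorem esymmFrom_zero_right (m : ℕ) : esymmFrom n m 0 = 1 := by simp [esymmFrom]

theorem esymmFrom_zero_left (k : ℕ) : esymmFrom n 0 k = esymm (Fin n) ℤ k := by
  simp [esymmFrom, esymm]

theorem esymmFrom_eq_zero {m k : ℕ} (h : n - m < k) : esymmFrom n m k = 0 := by
  rw [esymmFrom, Finset.powersetCard_eq_empty.2, Finset.sum_empty]
  refine lt_of_le_of_lt ?_ h
  have h1 : (Finset.univ.filter fun j : Fin n => m ≤ j).map Fin.valEmbedding ⊆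
      Finset.Ico m n := by
    intro x hx
    simp only [Finset.mem_map, Finset.mem_filter, Finset.mem_univ, true_and] at hx
    obtain ⟨j, hj, rfl⟩ := hx
    exact Finset.mem_Ico.2 ⟨hj, j.isLt⟩
  simpa using Finset.card_le_card h1

theorem esymmFrom_succ (m : Fin n) (k : ℕ) :
    esymmFrom n m (k + 1) = esymmFrom n (m + 1) (k + 1) + X m * esymmFrom n (m + 1) k := by
  have h : (Finset.univ.filter fun j : Fin n => (m : ℕ) ≤ j) =
      insert m (Finset.univ.filter fun j : Fin n => (m : ℕ) + 1 ≤ j) := by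
    ext j
    simp only [Finset.mem_filter, Finset.mem_univ, true_and, Finset.mem_insert, Fin.ext_iff]
    omega
  have hm : m ∉ Finset.univ.filter fun j : Fin n => (m : ℕ) + 1 ≤ j := by simp
  rw [esymmFrom, h, Finset.powersetCard_succ_insert hm, Finset.sum_union, esymmFrom, esymmFrom,
    Finset.sum_image]
  · congr 1
    rw [Finset.mul_sum]
    refine Finset.sum_congr rfl fun s hs => ?_
    rw [Finset.prod_insert fun h => hm ((Finset.mem_powersetCard.1 hs).1 h)]
  · intro s hs t ht hst
    rw [Finset.mem_coe, Finset.mem_powersetCard] at hs ht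
    have h1 : m ∉ s := fun h => hm (hs.1 h)
    have h2 : m ∉ t := fun h => hm (ht.1 h)
    rw [← Finset.erase_insert h1, ← Finset.erase_insert h2]
    exact congrArg (fun u => u.erase m) hst
  · rw [Finset.disjoint_left]
    intro s hs hs'
    rw [Finset.mem_image] at hs'
    obtain ⟨t, _, rfl⟩ := hs'
    exact hm ((Finset.mem_powersetCard.1 hs).1 (Finset.mem_insert_self _ _))

theorem sAct_esymmFrom {i : Fin n} {m : ℕ} (h : (i : ℕ) ≠ m) (k : ℕ) :
    sAct i (esymmFrom n m k) = esymmFrom n m k := by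
  rw [esymmFrom, map_sum]
  by_cases hi : (i : ℕ) = 0
  · refine Finset.sum_congr rfl fun s hs => ?_
    rw [map_prod]
    refine Finset.prod_congr rfl fun j hj => ?_
    rw [sAct_X_zero hi, if_neg]
    rintro rfl
    have := (Finset.mem_filter.1 ((Finset.mem_powersetCard.1 hs).1 hj)).2
    omega
  · set T := Finset.univ.filter fun j : Fin n => m ≤ j with hT
    have hmap : T.map (Equiv.swap (prev i) i).toEmbedding = T := by
      ext j
      rw [Finset.mem_map_equiv, Equiv.symm_swap, hT, Finset.mem_filter, Finset.mem_filter,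
        Equiv.swap_apply_def]
      have : ((prev i : Fin n) : ℕ) = i - 1 := rfl
      split_ifs with h1 h2
      · subst h1; simp only [Finset.mem_univ, true_and]; omega
      · subst h2; simp only [Finset.mem_univ, true_and]; omega
      · rfl
    conv_rhs => rw [← hmap, Finset.powersetCard_map, Finset.sum_map]
    refine Finset.sum_congr rfl fun s _ => ?_
    rw [map_prod]
    simp only [sAct_X_pos hi]
    simp [Finset.prod_map]

theorem tau_X_self (i : Fin n) : tau i (X i) = 1 := by
  refine tau_eq_of ?_
  by_cases hi : (i : ℕ) = 0
  · rw [dRoot_zero hi, sAct_X_zero hi, if_pos rfl]; ring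
  · rw [dRoot_pos hi, sAct_X_pos hi]; simp

theorem tau_X_prev {i : Fin n} (hi : (i : ℕ) ≠ 0) : tau i (X (prev i)) = -1 := by
  refine tau_eq_of ?_
  rw [dRoot_pos hi, sAct_X_pos hi]; simp

theorem tau_esymmFrom_succ (m : Fin n) (k : ℕ) :
    tau m (esymmFrom n m (k + 1)) = esymmFrom n (m + 1) k := by
  rw [esymmFrom_succ, map_add, tau_of_sAct_eq (sAct_esymmFrom (by simp) _),
    tau_mul_right (sAct_esymmFrom (by simp) _), tau_X_self]
  ring

theorem tau_X_prev_mul_esymmFrom {m : Fin n} (hm : (m : ℕ) ≠ 0) (k : ℕ) :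
    tau m (X (prev m) * esymmFrom n m k) = -esymmFrom n (m + 1) k := by
  cases k with
  | zero => simp [tau_X_prev hm]
  | succ k =>
    rw [esymmFrom_succ, mul_add, map_add, tau_mul_right (sAct_esymmFrom (by simp) _),
      tau_X_prev hm, ← mul_assoc, tau_mul_right (sAct_esymmFrom (by simp) _)]
    rw [tau_of_sAct_eq (f := X (prev m) * X m)]
    · ring
    · rw [map_mul, sAct_X_pos hm, sAct_X_pos hm]
      simp [mul_comm]

end EsymmFrom

/-! ### Explicit words for the longest and the Grassmannian elements -/

section Words

variable {n : ℕ}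

/-- The word `a, a - 1, …, 1`. -/
def descWord : (a : ℕ) → a < n → List (Fin n)
  | 0, _ => []
  | a + 1, h => ⟨a + 1, h⟩ :: descWord a (Nat.lt_of_succ_lt h)

/-- The word `a, a - 1, …, 1, 0`. -/
def descWordZero (a : Fin n) : List (Fin n) :=
  descWord a a.isLt ++ [⟨0, a.pos⟩]

/-- A word for the longest permutation of the first `m` indices. -/
def longWord : (m : ℕ) → m ≤ n → List (Fin n)
  | 0, _ => []
  | m + 1, h => longWord m (Nat.le_of_succ_le h) ++ descWord m h

/-- The concatenation of the words `a, …, 0`, the last letter of the list coming first. -/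
def grassWord : List (Fin n) → List (Fin n)
  | [] => []
  | a :: l => grassWord l ++ descWordZero a

theorem mem_descWord {a : ℕ} {h : a < n} {i : Fin n} (hi : i ∈ descWord a h) :
    (i : ℕ) ≠ 0 ∧ (i : ℕ) ≤ a := by
  induction a with
  | zero => simp [descWord] at hi
  | succ a ih =>
    rw [descWord, List.mem_cons] at hi
    rcases hi with rfl | hi
    · simp
    · have := ih hi; omega

theorem mem_descWordZero {a i : Fin n} (hi : i ∈ descWordZero a) : i ≤ a := by
  rw [descWordZero, List.mem_append, List.mem_singleton] at hi
  rcases hi with hi | rfl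
  · exact (mem_descWord hi).2
  · exact Nat.zero_le _

theorem mem_longWord {m : ℕ} {h : m ≤ n} {i : Fin n} (hi : i ∈ longWord m h) : (i : ℕ) ≠ 0 := by
  induction m with
  | zero => simp [longWord] at hi
  | succ m ih =>
    rw [longWord, List.mem_append] at hi
    rcases hi with hi | hi
    · exact ih hi
    · exact (mem_descWord hi).1

theorem length_descWord {a : ℕ} (h : a < n) : (descWord a h).length = a := by
  induction a with
  | zero => rfl
  | succ a ih => rw [descWord, List.length_cons, ih]

theorem length_longWord {m : ℕ} (h : m ≤ n) : (longWord m h).length = m * (m - 1) / 2 := by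
  rw [← Finset.sum_range_id]
  induction m with
  | zero => rfl
  | succ m ih => rw [longWord, List.length_append, ih, length_descWord, Finset.sum_range_succ]

theorem wordProd_mem_perm {a : List (Fin n)} (ha : ∀ i ∈ a, (i : ℕ) ≠ 0) :
    wordProd a = ofPerm (wordProd a).perm := by
  induction a with
  | nil => rfl
  | cons i a ih =>
    rw [wordProd_cons, simpleRefl_pos (ha i (by simp)),
      ih fun j hj => ha j (List.mem_cons_of_mem _ hj), ← map_mul]
    rfl

theorem perm_descWord {a : ℕ} (h : a < n) (j : Fin n) :
    ((wordProd (descWord a h)).perm j : ℕ) =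
      if (j : ℕ) = 0 then a else if (j : ℕ) ≤ a then j - 1 else j := by
  induction a with
  | zero => simp only [descWord, wordProd_nil, perm_one, Equiv.Perm.one_apply]; split_ifs <;> omega
  | succ a ih =>
    rw [descWord, wordProd_cons, simpleRefl_pos (by simp), perm_mul, Equiv.Perm.mul_apply,
      ofPerm_perm, Equiv.swap_apply_def]
    have ih' := ih (Nat.lt_of_succ_lt h)
    simp only [Fin.ext_iff, val_prev, ih']
    rcases Nat.eq_zero_or_pos (j : ℕ) with h0 | h0
    · simp [h0]
    · rcases Nat.lt_or_ge a j with h1 | h1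
      · rcases Nat.eq_or_lt_of_le (Nat.succ_le_of_lt h1) with h2 | h2
        · simp [← h2]
        · rw [if_neg (by split_ifs <;> omega), if_neg (by split_ifs <;> omega), ih']
          split_ifs <;> omega
      · rw [if_neg (by split_ifs <;> omega), if_neg (by split_ifs <;> omega), ih']
        split_ifs <;> omega

theorem perm_longWord {m : ℕ} (h : m ≤ n) (j : Fin n) :
    ((wordProd (longWord m h)).perm j : ℕ) = if (j : ℕ) < m then m - 1 - j else j := by
  induction m generalizing j with
  | zero => simp [longWord]
  | succ m ih =>
    rw [longWord, wordProd_append, perm_mul, Equiv.Perm.mul_apply, ih, perm_descWord]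
    split_ifs <;> omega

theorem wordProd_longWord : wordProd (longWord n le_rfl) = ofPerm Fin.revPerm := by
  rw [wordProd_mem_perm fun i hi => mem_longWord hi]
  congr 1
  ext j
  rw [perm_longWord, if_pos j.isLt, Fin.revPerm_apply, Fin.val_rev]
  omega

end Words

/-! ### Staircase monomials -/

section Monomials

variable {n : ℕ}

/-- The monomial with given exponents. -/
noncomputable def xpow (g : Fin n → ℕ) : MvPolynomial (Fin n) ℤ := ∏ i, X i ^ g i

theorem act_ofPerm_xpow (u : Equiv.Perm (Fin n)) (g : Fin n → ℕ) :
    act ℤ (ofPerm u) (xpow (g ∘ u)) = xpow g := by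
  rw [xpow, map_prod, xpow, ← Equiv.prod_comp u (fun i => (X i : MvPolynomial (Fin n) ℤ) ^ g i)]
  refine Finset.prod_congr rfl fun i _ => ?_
  rw [map_pow, act_X]
  simp

theorem sAct_xpow {i : Fin n} (hi : (i : ℕ) ≠ 0) {g : Fin n → ℕ} (h : g (prev i) = g i) :
    sAct i (xpow g) = xpow g := by
  conv_rhs => rw [← act_ofPerm_xpow (Equiv.swap (prev i) i) g]
  rw [sAct, simpleRefl_pos hi]
  congr 2
  funext j
  rw [Function.comp_apply, Equiv.swap_apply_def]
  split_ifs with h1 h2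
  · rw [h1, h]
  · rw [h2, h]
  · rfl

theorem xpow_add (g h : Fin n → ℕ) : xpow (g + h) = xpow g * xpow h := by
  simp [xpow, pow_add, Finset.prod_mul_distrib]

theorem xpow_single (i : Fin n) (k : ℕ) : xpow (Pi.single i k) = X i ^ k := by
  rw [xpow, Finset.prod_eq_single i]
  · simp
  · intro j _ hj; simp [hj]
  · simp

/-- The staircase monomial `x_0^{m-1} x_1^{m-2} ⋯ x_{m-2}`. -/
noncomputable def stair (n m : ℕ) : MvPolynomial (Fin n) ℤ := xpow fun i => m - 1 - i

theorem tauW_descWord {a : ℕ} (h : a < n) (k : ℕ) :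
    tauW (descWord a h) (stair n (a + 1) * esymmFrom n 1 k) =
      (-1) ^ a * (stair n a * esymmFrom n (a + 1) k) := by
  -- The exponents left after the letters `1, …, j`: the first `j` of them have dropped by one.
  -- Those at indices `j - 1` and `j` then agree, so apart from one factor `x_{j-1}` the monomial
  -- before letter `j` is fixed by that reflection.
  let F : ℕ → Fin n → ℕ := fun j i => if (i : ℕ) < j then a - 1 - i else a - i
  have key : ∀ j (hj : j ≤ a), tauW (descWord j (hj.trans_lt h))
      (stair n (a + 1) * esymmFrom n 1 k) = (-1) ^ j * (xpow (F j) * esymmFrom n (j + 1) k) := by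
    intro j
    induction j with
    | zero =>
      intro _
      simp [descWord, stair, F]
    | succ j ih =>
      intro hj
      rw [descWord, tauW_cons, Module.End.mul_apply, ih (Nat.le_of_succ_le hj)]
      set i : Fin n := ⟨j + 1, hj.trans_lt h⟩ with hi
      have hi0 : (i : ℕ) ≠ 0 := by simp [hi]
      have hF : F j = Pi.single (prev i) 1 + F (j + 1) := by
        funext l
        simp only [F, Pi.add_apply, Pi.single_apply, Fin.ext_iff, val_prev, hi]
        split_ifs <;> omega
      rw [hF, xpow_add, xpow_single, pow_one]
      have hs : sAct i (xpow (F (j + 1))) = xpow (F (j + 1)) := by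
        refine sAct_xpow hi0 ?_
        have h1 : (i : ℕ) = j + 1 := rfl
        simp only [F, val_prev, h1]
        split_ifs <;> omega
      have e : ((-1) ^ j * (X (prev i) * xpow (F (j + 1)) * esymmFrom n (j + 1) k) :
          MvPolynomial (Fin n) ℤ) =
          ((-1) ^ j * xpow (F (j + 1))) * (X (prev i) * esymmFrom n i k) := by
        simp only [hi]; ring
      rw [e, tau_mul_left (by rw [map_mul, hs, map_pow, map_neg, map_one]),
        tau_X_prev_mul_esymmFrom hi0]
      simp only [hi]
      ring
  have h1 := key a le_rfl
  rw [h1]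
  congr 2
  rw [stair]
  congr 1
  funext i
  simp only [F]
  split_ifs <;> omega

theorem tauW_longWord {m : ℕ} (h : m ≤ n) :
    tauW (longWord m h) (stair n m) = (-1) ^ (m * (m - 1) / 2) := by
  rw [← Finset.sum_range_id]
  induction m with
  | zero => simp [longWord, stair, xpow]
  | succ m ih =>
    have h1 := tauW_descWord h 0
    rw [esymmFrom_zero_right, mul_one, esymmFrom_zero_right, mul_one] at h1
    rw [longWord, tauW_append, Module.End.mul_apply, h1]
    have h2 : ((-1) ^ m * stair n m : MvPolynomial (Fin n) ℤ) = ((-1) ^ m : ℤ) • stair n m := by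
      simp [Algebra.smul_def]
    rw [h2, map_smul, ih, Finset.sum_range_succ, pow_add, Algebra.smul_def, mul_comm]
    simp

end Monomials

/-! ### The operators attached to group elements -/

section DivOp

variable {n : ℕ}

/-- The operator `∂'_w` on `ℤ[X]`. -/
noncomputable def divOp (w : SignedPerm n) : Module.End ℤ (MvPolynomial (Fin n) ℤ) :=
  tauW w.reducedWord

theorem tauW_eq_divOp {a : List (Fin n)} {w : SignedPerm n} (ha : IsReducedWord a w) :
    tauW a = divOp w := tauW_congr ha (reducedWord_spec w)

theorem IsReducedWord.append {a b : List (Fin n)} {v w : SignedPerm n} (ha : IsReducedWord a v)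
    (hb : IsReducedWord b w) (h : (v * w).length = v.length + w.length) :
    IsReducedWord (a ++ b) (v * w) :=
  ⟨by rw [wordProd_append, ha.1, hb.1], by rw [List.length_append, ha.2, hb.2, h]⟩

theorem divOp_mul_of_eq {v w : SignedPerm n} (h : (v * w).length = v.length + w.length) :
    divOp v * divOp w = divOp (v * w) := by
  rw [← tauW_eq_divOp (IsReducedWord.append (reducedWord_spec v) (reducedWord_spec w) h),
    tauW_append, divOp, divOp]

theorem divOp_mul_of_ne {v w : SignedPerm n} (h : (v * w).length ≠ v.length + w.length) :
    divOp v * divOp w = 0 := by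
  rw [divOp, divOp, ← tauW_append]
  refine tauW_eq_zero ?_
  rw [wordProd_append, List.length_append, (reducedWord_spec v).1, (reducedWord_spec v).2,
    (reducedWord_spec w).1, (reducedWord_spec w).2]
  exact h

theorem SignedPerm.IsReducedWord.reverse {a : List (Fin n)} {w : SignedPerm n}
    (ha : IsReducedWord a w) : IsReducedWord a.reverse w⁻¹ :=
  ⟨by rw [wordProd_reverse, ha.1], by rw [List.length_reverse, ha.2, length_inv]⟩

theorem eq_one_of_length {w : SignedPerm n} (h : w.length = 0) : w = 1 := by
  obtain ⟨a, ha, hl⟩ := exists_isReducedWord w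
  rw [h, List.length_eq_zero_iff] at hl
  rw [← ha, hl, wordProd_nil]

end DivOp

/-! ### Length on the symmetric group -/

section Inversions

variable {n : ℕ}

/-- The inversions of a permutation. -/
def inversions (u : Equiv.Perm (Fin n)) : Finset (Fin n × Fin n) :=
  Finset.univ.filter fun p => p.1 < p.2 ∧ u p.2 < u p.1

theorem exists_descent {u : Equiv.Perm (Fin n)} (hu : u ≠ 1) :
    ∃ i : Fin n, (i : ℕ) ≠ 0 ∧ u i < u (prev i) := by
  by_contra! h
  apply hu
  cases n with
  | zero => exact Subsingleton.elim _ _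
  | succ m =>
    have hm : StrictMono u := by
      refine Fin.strictMono_iff_lt_succ.2 fun i => ?_
      refine lt_of_le_of_ne (h i.succ (by simp)) ?_
      intro e
      have := u.injective e
      simp [Fin.ext_iff] at this
    have : (u : Fin (m + 1) → Fin (m + 1)) = id := by
      refine (StrictMono.range_inj hm strictMono_id).1 ?_
      rw [u.surjective.range_eq]
      simp
    ext x
    rw [this]; rfl

/-- Applying the transposition to both entries of a pair embeds the new inversions into the old
ones, and the pair at the descent itself is missed. -/
theorem card_inversions_mul_swap {u : Equiv.Perm (Fin n)} {i : Fin n} (hi : (i : ℕ) ≠ 0)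
    (h : u i < u (prev i)) :
    (inversions (u * Equiv.swap (prev i) i)).card < (inversions u).card := by
  set s := Equiv.swap (prev i) i with hs
  have hp : (prev i, i) ∈ inversions u := by
    refine Finset.mem_filter.2 ⟨Finset.mem_univ _, ?_, h⟩
    exact Fin.lt_def.2 (show (prev i : ℕ) < i by rw [val_prev]; omega)
  rw [← Finset.card_map (s.prodCongr s).toEmbedding]
  refine Finset.card_lt_card ((Finset.ssubset_iff_of_subset ?_).2 ⟨_, hp, ?_⟩)
  · intro p hp
    rw [Finset.mem_map_equiv] at hp
    obtain ⟨-, h1, h2⟩ := Finset.mem_filter.1 hp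
    simp only [Equiv.prodCongr_symm, Equiv.prodCongr_apply, Prod.map_fst, Prod.map_snd, hs,
      Equiv.symm_swap, Equiv.Perm.mul_apply, Equiv.swap_apply_self] at h1 h2
    refine Finset.mem_filter.2 ⟨Finset.mem_univ _, ?_, h2⟩
    obtain ⟨a, b⟩ := p
    dsimp only at h1 h2 ⊢
    rw [Equiv.swap_apply_def, Equiv.swap_apply_def] at h1
    have h4 : ¬(a = i ∧ b = prev i) := by
      rintro ⟨rfl, rfl⟩
      exact absurd h2 (not_lt.2 h.le)
    have h5 : ¬a = b := fun e => by rw [e] at h2; exact lt_irrefl _ h2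
    clear h2
    simp only [Fin.lt_def, Fin.ext_iff, val_prev] at h1 h4 h5 ⊢
    split_ifs at h1 <;> (try simp only [val_prev] at h1) <;> omega
  · rw [Finset.mem_map_equiv]
    intro hp
    obtain ⟨-, h1, -⟩ := Finset.mem_filter.1 hp
    simp [hs, Fin.lt_def] at h1
    omega

theorem exists_word_perm (u : Equiv.Perm (Fin n)) : ∃ a : List (Fin n),
    (∀ i ∈ a, (i : ℕ) ≠ 0) ∧ wordProd a = ofPerm u ∧ a.length ≤ (inversions u).card := by
  induction h : (inversions u).card using Nat.strong_induction_on generalizing u with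
  | _ k ih =>
    by_cases hu : u = 1
    · exact ⟨[], by simp, by rw [hu, map_one, wordProd_nil], Nat.zero_le _⟩
    · obtain ⟨i, hi, hd⟩ := exists_descent hu
      have hlt := card_inversions_mul_swap hi hd
      obtain ⟨a, ha, hau, hal⟩ := ih _ (h ▸ hlt) _ rfl
      refine ⟨a ++ [i], ?_, ?_, ?_⟩
      · intro j hj
        rw [List.mem_append, List.mem_singleton] at hj
        rcases hj with hj | rfl
        · exact ha j hj
        · exact hi
      · rw [wordProd_append, hau, wordProd_cons, wordProd_nil, mul_one, simpleRefl_pos hi,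
          ← map_mul, mul_assoc, Equiv.swap_mul_self, mul_one]
      · rw [List.length_append, List.length_singleton]
        omega

theorem card_pairs : (Finset.univ.filter fun p : Fin n × Fin n => p.1 < p.2).card =
    n * (n - 1) / 2 := by
  rw [Finset.card_filter, Fintype.sum_prod_type_right, ← Finset.sum_range_id,
    ← Fin.sum_univ_eq_sum_range (fun i => i)]
  refine Finset.sum_congr rfl fun j _ => ?_
  rw [← Finset.card_filter, ← Fin.card_Iio]
  congr 1
  ext i
  simp

theorem card_inversions_add (u : Equiv.Perm (Fin n)) :
    (inversions u).card + (inversions (Fin.revPerm * u)).card = n * (n - 1) / 2 := by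
  rw [← card_pairs, ← Finset.card_union_of_disjoint]
  · congr 1
    ext p
    simp only [inversions, Finset.mem_union, Finset.mem_filter, Finset.mem_univ, true_and,
      Equiv.Perm.mul_apply, Fin.revPerm_apply, Fin.rev_lt_rev, ← and_or_left]
    refine and_iff_left_of_imp fun h => ?_
    exact lt_or_gt_of_ne fun e => h.ne (u.injective e).symm
  · rw [Finset.disjoint_left]
    intro p h1 h2
    have h1 := (Finset.mem_filter.1 h1).2.2
    have h2 := (Finset.mem_filter.1 h2).2.2
    simp only [Equiv.Perm.mul_apply, Fin.revPerm_apply, Fin.rev_lt_rev] at h2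
    exact lt_asymm h1 h2

/-- Its operator sends the staircase monomial to a sign, hence is nonzero. -/
theorem isReducedWord_longWord : IsReducedWord (longWord n le_rfl) (ofPerm Fin.revPerm) := by
  rw [← wordProd_longWord]
  refine isReducedWord_of_tauW_ne_zero (f := stair n n) ?_
  rw [tauW_longWord]
  exact pow_ne_zero _ (by simp)

theorem length_revPerm : (ofPerm (n := n) Fin.revPerm).length = n * (n - 1) / 2 := by
  rw [← isReducedWord_longWord.2, length_longWord]

theorem length_ofPerm_le (u : Equiv.Perm (Fin n)) :
    (ofPerm u).length ≤ (inversions u).card := by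
  obtain ⟨a, -, h1, h2⟩ := exists_word_perm u
  exact h1 ▸ (length_le a).trans h2

/-- The inversion counts of `u` and `ϖ_0 u` add up to the number of pairs and bound the lengths from
above. Subadditivity with the known length of `ϖ_0` bounds them from below. So length equals
inversion number, and reduced words avoiding `s_0` exist even though length is taken in `W_n`. -/
theorem length_ofPerm_add (u : Equiv.Perm (Fin n)) :
    (ofPerm u).length + (ofPerm (Fin.revPerm * u)).length = n * (n - 1) / 2 := by
  refine le_antisymm ?_ ?_
  · rw [← card_inversions_add u]
    exact add_le_add (length_ofPerm_le _) (length_ofPerm_le _)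
  · have h := length_mul_le (ofPerm (Fin.revPerm * u)) (ofPerm u)⁻¹
    rw [map_mul, mul_assoc, mul_inv_cancel, mul_one, length_revPerm, length_inv] at h
    rw [map_mul]
    omega

theorem exists_isReducedWord_perm (u : Equiv.Perm (Fin n)) :
    ∃ a : List (Fin n), (∀ i ∈ a, (i : ℕ) ≠ 0) ∧ IsReducedWord a (ofPerm u) := by
  obtain ⟨a, h0, h1, h2⟩ := exists_word_perm u
  refine ⟨a, h0, h1, ?_⟩
  have h3 := h1 ▸ length_le a
  have h4 := length_ofPerm_add u
  have h5 := card_inversions_add u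
  have h6 := length_ofPerm_le (Fin.revPerm * u)
  omega

theorem revPerm_mul_self : (Fin.revPerm * Fin.revPerm : Equiv.Perm (Fin n)) = 1 := by
  ext i; simp

theorem revPerm_inv : (Fin.revPerm⁻¹ : Equiv.Perm (Fin n)) = Fin.revPerm :=
  inv_eq_of_mul_eq_one_left revPerm_mul_self

theorem length_mul_revPerm (u : Equiv.Perm (Fin n)) :
    (ofPerm u).length + (ofPerm (u * Fin.revPerm)).length = n * (n - 1) / 2 := by
  rw [← length_inv, ← length_inv (ofPerm (u * _)), ← map_inv, ← map_inv, mul_inv_rev,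
    revPerm_inv, length_ofPerm_add]

theorem length_rev_conj (u : Equiv.Perm (Fin n)) :
    (ofPerm (Fin.revPerm * u * Fin.revPerm)).length = (ofPerm u).length := by
  have h1 := length_ofPerm_add u
  have h2 := length_mul_revPerm (Fin.revPerm * u)
  omega

end Inversions

/-! ### The operator `∂'_{ϖ_0}`: antisymmetry and evaluation on staircases -/

section LongestPerm

variable {n : ℕ}

/-- Apply `φ ∘ ∂'_i = 0` to `s_i(f) g`: the Leibniz rule turns this into self-adjointness of `∂'_i`
under `φ`. -/
theorem map_tau_mul {φ : Module.End ℤ (MvPolynomial (Fin n) ℤ)} {i : Fin n} (h : φ * tau i = 0)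
    (f g : MvPolynomial (Fin n) ℤ) : φ (tau i f * g) = φ (f * tau i g) := by
  have h1 := LinearMap.congr_fun h (sAct i f * g)
  rw [Module.End.mul_apply, tau_mul, tau_sAct, sAct_sAct, map_add, neg_mul, map_neg,
    LinearMap.zero_apply] at h1
  linear_combination -h1

theorem map_tauW_mul {φ : Module.End ℤ (MvPolynomial (Fin n) ℤ)} {a : List (Fin n)}
    (h : ∀ i ∈ a, φ * tau i = 0) (f g : MvPolynomial (Fin n) ℤ) :
    φ (tauW a f * g) = φ (f * tauW a.reverse g) := by
  induction a generalizing g with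
  | nil => rfl
  | cons i a ih =>
    rw [tauW_cons, Module.End.mul_apply, map_tau_mul (h i (by simp)),
      ih (fun j hj => h j (List.mem_cons_of_mem _ hj)), List.reverse_cons, tauW_append]
    simp

theorem map_eq_zero_of_sAct {φ : Module.End ℤ (MvPolynomial (Fin n) ℤ)} {i : Fin n}
    (h : φ * tau i = 0) {f : MvPolynomial (Fin n) ℤ} (hf : sAct i f = f) : φ f = 0 := by
  have h1 := LinearMap.congr_fun h (X i * f)
  rwa [Module.End.mul_apply, tau_mul_right hf, tau_X_self, one_mul] at h1

theorem map_sAct {φ : Module.End ℤ (MvPolynomial (Fin n) ℤ)} {i : Fin n}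
    (h : φ * tau i = 0) (f : MvPolynomial (Fin n) ℤ) : φ (sAct i f) = -φ f := by
  have h1 := map_eq_zero_of_sAct h (f := f + sAct i f) (by rw [map_add, sAct_sAct, add_comm])
  rw [map_add] at h1
  linear_combination h1

theorem tauW_mul_left {a : List (Fin n)} {f : MvPolynomial (Fin n) ℤ}
    (h : ∀ i ∈ a, sAct i f = f) (g : MvPolynomial (Fin n) ℤ) :
    tauW a (f * g) = f * tauW a g := by
  induction a with
  | nil => rfl
  | cons i a ih =>
    rw [tauW_cons, Module.End.mul_apply, ih fun j hj => h j (List.mem_cons_of_mem _ hj),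
      tau_mul_left (h i (by simp)), Module.End.mul_apply]

theorem tauW_mul_right {a : List (Fin n)} {g : MvPolynomial (Fin n) ℤ}
    (h : ∀ i ∈ a, sAct i g = g) (f : MvPolynomial (Fin n) ℤ) :
    tauW a (f * g) = tauW a f * g := by
  rw [mul_comm, tauW_mul_left h, mul_comm]

/-- The operator `∂'_{ϖ_0}`. -/
noncomputable def piOp (n : ℕ) : Module.End ℤ (MvPolynomial (Fin n) ℤ) := tauW (longWord n le_rfl)

theorem piOp_eq : piOp n = divOp (ofPerm Fin.revPerm) := tauW_eq_divOp isReducedWord_longWord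

theorem piOp_mul_tau {i : Fin n} (hi : (i : ℕ) ≠ 0) : piOp n * tau i = 0 := by
  have h : tauW (longWord n le_rfl ++ [i]) = 0 := by
    refine tauW_eq_zero ?_
    rw [wordProd_append, wordProd_longWord, wordProd_cons, wordProd_nil, mul_one,
      simpleRefl_pos hi, ← map_mul, List.length_append, length_longWord, List.length_singleton]
    have := length_ofPerm_add (Equiv.swap (prev i) i)
    omega
  rw [tauW_append] at h
  simpa [piOp] using h

theorem tau_mul_piOp {i : Fin n} (hi : (i : ℕ) ≠ 0) : tau i * piOp n = 0 := by
  have h : tauW (i :: longWord n le_rfl) = 0 := by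
    refine tauW_eq_zero ?_
    rw [wordProd_cons, wordProd_longWord,
      simpleRefl_pos hi, ← map_mul, List.length_cons, length_longWord]
    have := length_mul_revPerm (Equiv.swap (prev i) i)
    omega
  rwa [tauW_cons] at h

theorem sAct_piOp {i : Fin n} (hi : (i : ℕ) ≠ 0) (f : MvPolynomial (Fin n) ℤ) :
    sAct i (piOp n f) = piOp n f :=
  sAct_eq_of_tau (LinearMap.congr_fun (tau_mul_piOp hi) f)

theorem piOp_mul_left {f : MvPolynomial (Fin n) ℤ} (h : ∀ i : Fin n, (i : ℕ) ≠ 0 → sAct i f = f)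
    (g : MvPolynomial (Fin n) ℤ) : piOp n (f * g) = f * piOp n g :=
  tauW_mul_left (fun i hi => h i (mem_longWord hi)) g

theorem piOp_mul_right {g : MvPolynomial (Fin n) ℤ} (h : ∀ i : Fin n, (i : ℕ) ≠ 0 → sAct i g = g)
    (f : MvPolynomial (Fin n) ℤ) : piOp n (f * g) = piOp n f * g :=
  tauW_mul_right (fun i hi => h i (mem_longWord hi)) f

theorem piOp_act (u : Equiv.Perm (Fin n)) (f : MvPolynomial (Fin n) ℤ) :
    piOp n (act ℤ (ofPerm u) f) = (Equiv.Perm.sign u : ℤ) • piOp n f := by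
  obtain ⟨a, ha, hau, -⟩ := exists_isReducedWord_perm u
  have hs : Equiv.Perm.sign u = (-1) ^ a.length := by
    rw [← det_wordProd, hau]; simp [det]
  rw [hs, ← hau]
  clear hs hau
  induction a with
  | nil => simp [act_one]
  | cons i a ih =>
    rw [wordProd_cons, act_mul, map_sAct (piOp_mul_tau (ha i (by simp))),
      ih fun j hj => ha j (List.mem_cons_of_mem _ hj), List.length_cons, pow_succ]
    simp

theorem piOp_divOp_mul (u : Equiv.Perm (Fin n)) (f g : MvPolynomial (Fin n) ℤ) :
    piOp n (divOp (ofPerm u) f * g) = piOp n (f * divOp (ofPerm u⁻¹) g) := by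
  obtain ⟨a, ha, har⟩ := exists_isReducedWord_perm u
  rw [map_inv, ← tauW_eq_divOp har, ← tauW_eq_divOp har.reverse,
    map_tauW_mul fun i hi => piOp_mul_tau (ha i hi)]

/-- The monomial is fixed by a transposition, so antisymmetry makes its image equal to its own
negative. -/
theorem piOp_xpow_eq_zero {g : Fin n → ℕ} {i j : Fin n} (hij : i ≠ j) (h : g i = g j) :
    piOp n (xpow g) = 0 := by
  have h1 := act_ofPerm_xpow (Equiv.swap i j) g
  have h2 : g ∘ Equiv.swap i j = g := by
    funext k
    rw [Function.comp_apply, Equiv.swap_apply_def]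
    split_ifs with h1 h2
    · rw [h1, h]
    · rw [h2, h]
    · rfl
  rw [h2] at h1
  have h3 := piOp_act (Equiv.swap i j) (xpow g)
  rw [h1, Equiv.Perm.sign_swap hij] at h3
  simpa [eq_neg_iff_add_eq_zero, ← two_mul] using h3

/-- The staircase monomial `x_1 x_2^2 ⋯`. -/
noncomputable def stairRev (n : ℕ) : MvPolynomial (Fin n) ℤ := xpow fun i => i

theorem piOp_stair : piOp n (stair n n) = (-1) ^ (n * (n - 1) / 2) := tauW_longWord le_rfl

theorem sign_revPerm : Equiv.Perm.sign (Fin.revPerm (n := n)) = (-1) ^ (n * (n - 1) / 2) := by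
  rw [← length_longWord le_rfl, ← det_wordProd, wordProd_longWord]
  simp [det]

theorem piOp_stairRev : piOp n (stairRev n) = 1 := by
  have h1 := act_ofPerm_xpow (Fin.revPerm (n := n)) (fun i => i)
  have h2 : (fun i : Fin n => (i : ℕ)) ∘ Fin.revPerm = fun i : Fin n => n - 1 - (i : ℕ) := by
    funext i
    simp only [Function.comp_apply, Fin.revPerm_apply, Fin.val_rev]
    omega
  rw [h2] at h1
  rw [stairRev, ← h1, piOp_act, ← stair, piOp_stair, sign_revPerm]
  simp [Algebra.smul_def, ← mul_pow]

/-- Distinct values below `n` would be a permutation of `0, …, n - 1`, with the same sum as the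
identity, contradicting the strict inequality at `k`. -/
theorem exists_eq_of_sum_lt {g : Fin n → ℕ} (h : ∀ i : Fin n, (i : ℕ) ≤ g i) (hg : ∀ i, g i < n)
    {k : Fin n} (hk : (k : ℕ) < g k) : ∃ i j, i ≠ j ∧ g i = g j := by
  by_contra! hne
  let G : Fin n → Fin n := fun i => ⟨g i, hg i⟩
  have hG : Function.Injective G := by
    intro i j hij
    by_contra hn
    exact hne i j hn (congrArg Fin.val hij)
  have h1 := Equiv.sum_comp (Equiv.ofBijective G (Finite.injective_iff_bijective.1 hG))
    (fun i => (i : ℕ))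
  have h2 : ∑ i : Fin n, (i : ℕ) < ∑ i, g i :=
    Finset.sum_lt_sum (fun i _ => h i) ⟨k, Finset.mem_univ _, hk⟩
  exact h2.ne h1.symm

/-- The degree bounds keep all exponents of `x^{(0,1,…,n-1)} · x^m` below `n`. If `m ≠ 0`, two of
them coincide and the monomial dies, so only the constant term remains. -/
theorem piOp_stairRev_mul {f : MvPolynomial (Fin n) ℤ} (h : ∀ i : Fin n, degreeOf i f ≤ n - 1 - i) :
    piOp n (stairRev n * f) = C (constantCoeff f) := by
  have hm : ∀ m ∈ f.support, piOp n (stairRev n * monomial m (coeff m f)) =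
      if m = 0 then C (constantCoeff f) else 0 := by
    intro m hm
    have e : (stairRev n * monomial m (coeff m f) : MvPolynomial (Fin n) ℤ) =
        coeff m f • xpow ((fun i : Fin n => (i : ℕ)) + ⇑m) := by
      rw [xpow_add, monomial_eq, Finsupp.prod_fintype _ _ (by simp), stairRev, xpow, xpow,
        smul_eq_C_mul]
      ring
    rw [e, map_smul]
    split_ifs with h0
    · subst h0
      rw [Finsupp.coe_zero, add_zero, ← stairRev, piOp_stairRev, smul_eq_C_mul, mul_one,
        constantCoeff_eq]
    · obtain ⟨k, hk⟩ := Finsupp.ne_iff.1 h0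
      rw [Finsupp.coe_zero, Pi.zero_apply] at hk
      obtain ⟨i, j, hij, he⟩ := exists_eq_of_sum_lt
        (g := (fun i : Fin n => (i : ℕ)) + ⇑m) (k := k)
        (fun i => by simp) (fun i => by
          have h1 := monomial_le_degreeOf i hm
          have h2 := h i
          have h3 := i.isLt
          simp only [Pi.add_apply]
          omega) (by simp only [Pi.add_apply]; omega)
      rw [piOp_xpow_eq_zero hij he, smul_zero]
  conv_lhs => rw [← support_sum_monomial_coeff f, Finset.mul_sum, map_sum]
  rw [Finset.sum_congr rfl hm, Finset.sum_ite_eq']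
  split_ifs with h0
  · rfl
  · rw [mem_support_iff, not_not] at h0
    rw [constantCoeff_eq, h0, C_0]

theorem degreeOf_sAct {i : Fin n} (hi : (i : ℕ) ≠ 0) (j : Fin n) (f : MvPolynomial (Fin n) ℤ) :
    degreeOf j (sAct i f) = degreeOf (Equiv.swap (prev i) i j) f := by
  have h : sAct i f = rename (Equiv.swap (prev i) i) f := by
    refine DFunLike.congr_fun (MvPolynomial.algHom_ext (f := sAct i) fun k => ?_) f
    rw [sAct_X_pos hi, rename_X]
  rw [h]
  conv_lhs => rw [← Equiv.swap_apply_self (prev i) i j]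
  exact degreeOf_rename_of_injective (Equiv.injective _) _

/-- The reflection `s_i` worsens the bound only in `x_i`, by one, and division by `x_i - x_{i-1}`
recovers that one degree. -/
theorem degreeOf_tau_le {i : Fin n} (hi : (i : ℕ) ≠ 0) {f : MvPolynomial (Fin n) ℤ}
    (h : ∀ j : Fin n, degreeOf j f ≤ n - 1 - j) (j : Fin n) :
    degreeOf j (tau i f) ≤ n - 1 - j := by
  by_cases h0 : tau i f = 0
  · simp [h0]
  have hp : ((prev i : Fin n) : ℕ) = i - 1 := rfl
  have key := dRoot_mul_tau i f
  have h1 : degreeOf j (dRoot ℤ i * tau i f) ≤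
      max (degreeOf j f) (degreeOf (Equiv.swap (prev i) i j) f) := by
    rw [key, ← degreeOf_sAct hi]
    exact degreeOf_sub_le _ _ _
  rw [degreeOf_mul_eq (dRoot_ne_zero i) h0] at h1
  have h2 := h j
  have h3 := h (Equiv.swap (prev i) i j)
  have hi' := i.isLt
  rw [Equiv.swap_apply_def] at h1 h3
  split_ifs at h1 h3 with h4 h5
  · subst h4
    omega
  · subst h5
    have h6 : 1 ≤ degreeOf j (dRoot ℤ j : MvPolynomial (Fin n) ℤ) := by
      by_contra hlt
      have h7 : degreeOf j (X j : MvPolynomial (Fin n) ℤ) ≤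
          max (degreeOf j (dRoot ℤ j)) (degreeOf j (X (prev j) : MvPolynomial (Fin n) ℤ)) := by
        have : (X j : MvPolynomial (Fin n) ℤ) = dRoot ℤ j + X (prev j) := by
          rw [dRoot_pos hi]; ring
        conv_lhs => rw [this]
        exact degreeOf_add_le _ _ _
      rw [degreeOf_X_self, degreeOf_X_of_ne (prev_ne hi).symm] at h7
      omega
    omega
  · omega

/-- The ideal of polynomials without constant term. -/
noncomputable def irrIdeal (n : ℕ) : Ideal (MvPolynomial (Fin n) ℤ) :=
  RingHom.ker (constantCoeff (R := ℤ) (σ := Fin n))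

theorem constantCoeff_sAct (i : Fin n) (f : MvPolynomial (Fin n) ℤ) :
    constantCoeff (sAct i f) = constantCoeff f := by
  refine DFunLike.congr_fun (MvPolynomial.ringHom_ext (f := constantCoeff.comp (sAct i).toRingHom)
    (g := constantCoeff) ?_ ?_) f
  · intro r
    simp
  · intro k
    by_cases hi : (i : ℕ) = 0
    · simp only [RingHom.comp_apply, AlgHom.toRingHom_eq_coe, RingHom.coe_coe, sAct_X_zero hi]
      split_ifs <;> simp
    · simp [sAct_X_pos hi]

theorem sAct_mem_irrIdeal_pow {i : Fin n} {d : ℕ} {f : MvPolynomial (Fin n) ℤ}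
    (hf : f ∈ irrIdeal n ^ d) : sAct i f ∈ irrIdeal n ^ d := by
  have h1 : (irrIdeal n).map (sAct i) ≤ irrIdeal n := by
    refine Ideal.map_le_iff_le_comap.2 fun g hg => ?_
    rw [Ideal.mem_comap, irrIdeal, RingHom.mem_ker, constantCoeff_sAct]
    exact hg
  have h2 := Ideal.mem_map_of_mem (sAct i) hf
  rw [Ideal.map_pow] at h2
  exact Ideal.pow_right_mono h1 d h2

/-- Powers of this ideal stand in for homogeneous degree: a divided difference loses at most one. -/
theorem tau_mem_irrIdeal_pow {i : Fin n} {d : ℕ} {f : MvPolynomial (Fin n) ℤ}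
    (hf : f ∈ irrIdeal n ^ (d + 1)) : tau i f ∈ irrIdeal n ^ d := by
  induction d generalizing f with
  | zero => simp
  | succ d ih =>
    rw [pow_succ] at hf
    refine Submodule.mul_induction_on hf ?_ ?_
    · intro g hg h hh
      rw [tau_mul]
      refine add_mem ?_ ?_
      · rw [pow_succ]
        exact Ideal.mul_mem_mul (ih hg) hh
      · exact Ideal.mul_mem_right _ _ (sAct_mem_irrIdeal_pow hg)
    · intro g h hg hh
      rw [map_add]
      exact add_mem hg hh

theorem tauW_mem_irrIdeal_pow {a : List (Fin n)} {d : ℕ} {f : MvPolynomial (Fin n) ℤ}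
    (hf : f ∈ irrIdeal n ^ (d + a.length)) : tauW a f ∈ irrIdeal n ^ d := by
  induction a generalizing d with
  | nil => simpa using hf
  | cons i a ih =>
    rw [tauW_cons, Module.End.mul_apply]
    refine tau_mem_irrIdeal_pow (ih ?_)
    rwa [List.length_cons, ← add_assoc, add_right_comm] at hf

theorem xpow_mem_irrIdeal (g : Fin n → ℕ) : xpow g ∈ irrIdeal n ^ (∑ i, g i) := by
  rw [← Finset.prod_pow_eq_pow_sum, xpow]
  exact Ideal.prod_mem_prod fun i _ => Ideal.pow_mem_pow (by simp [irrIdeal]) _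

theorem sum_stair : ∑ i : Fin n, (n - 1 - i : ℕ) = n * (n - 1) / 2 := by
  rw [← Finset.sum_range_id, ← Fin.sum_univ_eq_sum_range (fun i => i),
    ← Equiv.sum_comp Fin.revPerm]
  refine Finset.sum_congr rfl fun i _ => ?_
  rw [Fin.revPerm_apply, Fin.val_rev]
  omega

/-- A permutation other than `ϖ_0` has too few letters to bring the staircase monomial down to a
constant. The result has no constant term yet keeps the staircase degree bounds, so
`piOp_stairRev_mul` gives zero. -/
theorem piOp_stairRev_mul_divOp {u : Equiv.Perm (Fin n)} (hu : u ≠ Fin.revPerm) :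
    piOp n (stairRev n * divOp (ofPerm u) (stair n n)) = 0 := by
  obtain ⟨a, ha, har⟩ := exists_isReducedWord_perm u
  rw [← tauW_eq_divOp har, piOp_stairRev_mul]
  · have h0 : a.length < n * (n - 1) / 2 := by
      rw [har.2]
      have h1 := length_ofPerm_add u
      rcases Nat.eq_zero_or_pos (ofPerm (Fin.revPerm * u)).length with h2 | h2
      · have h3 := eq_one_of_length h2
        rw [← map_one ofPerm] at h3
        have h4 := ofPerm_injective h3
        exact absurd (by rw [← one_mul u, ← revPerm_mul_self, mul_assoc, h4, mul_one]) hu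
      · omega
    have h1 : tauW a (stair n n) ∈ irrIdeal n ^ (n * (n - 1) / 2 - a.length) := by
      refine tauW_mem_irrIdeal_pow ?_
      rw [Nat.sub_add_cancel h0.le, ← sum_stair]
      exact xpow_mem_irrIdeal _
    have h2 := Ideal.pow_le_self (by omega) h1
    rw [irrIdeal, RingHom.mem_ker] at h2
    rw [h2, C_0]
  · clear har
    induction a with
    | nil =>
      intro i
      rw [tauW_nil, Module.End.one_apply, stair, xpow]
      refine (degreeOf_prod_le _ _ _).trans ?_
      rw [Finset.sum_eq_single i]
      · rw [degreeOf_X_self_pow]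
      · intro j _ hj
        exact degreeOf_X_pow_of_ne _ hj.symm
      · simp
    | cons i a ih =>
      rw [tauW_cons, Module.End.mul_apply]
      exact degreeOf_tau_le (ha i (by simp)) (ih fun j hj => ha j (List.mem_cons_of_mem _ hj))

end LongestPerm

/-! ### Type A Schubert polynomials and their orthogonality -/

section SchubertPerm

variable {n : ℕ}

/-- The polynomials `∂'_{u⁻¹ϖ_0}(x_1 x_2^2 ⋯)` of type `A`. -/
noncomputable def schubPerm (u : Equiv.Perm (Fin n)) : MvPolynomial (Fin n) ℤ :=
  divOp (ofPerm (u⁻¹ * Fin.revPerm)) (stairRev n)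

theorem negRev_X (i : Fin n) : negRev (X i) = -X i.rev := by simp [negRev]

theorem val_rev_prev {i : Fin n} (hi : (i : ℕ) ≠ 0) : ((prev i).rev : ℕ) = n - i := by
  rw [Fin.val_rev, val_prev]; omega

theorem prev_rev_prev {i : Fin n} (hi : (i : ℕ) ≠ 0) : prev (prev i).rev = i.rev := by
  ext
  rw [val_prev, val_rev_prev hi, Fin.val_rev]; omega

theorem negRev_sAct {i : Fin n} (hi : (i : ℕ) ≠ 0) (f : MvPolynomial (Fin n) ℤ) :
    negRev (sAct i f) = sAct (prev i).rev (negRev f) := by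
  have h0 : ((prev i).rev : ℕ) ≠ 0 := by rw [val_rev_prev hi]; omega
  refine DFunLike.congr_fun (MvPolynomial.algHom_ext (f := negRev.comp (sAct i))
    (g := (sAct (prev i).rev).comp negRev) fun k => ?_) f
  rw [AlgHom.comp_apply, AlgHom.comp_apply, sAct_X_pos hi, negRev_X, negRev_X, map_neg,
    sAct_X_pos h0, prev_rev_prev hi]
  congr 2
  rw [Equiv.swap_comm, Equiv.swap_apply_def, Equiv.swap_apply_def]
  simp only [Fin.rev_inj]
  split_ifs <;> simp_all

/-- Reversing the variables interchanges the two terms of `x_i - x_{i-1}` and the negation undoes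
the sign, so `∂'_i` becomes the operator of the mirrored index with no sign. -/
theorem negRev_tau {i : Fin n} (hi : (i : ℕ) ≠ 0) (f : MvPolynomial (Fin n) ℤ) :
    negRev (tau i f) = tau (prev i).rev (negRev f) := by
  have h0 : ((prev i).rev : ℕ) ≠ 0 := by rw [val_rev_prev hi]; omega
  refine (tau_eq_of ?_).symm
  rw [← negRev_sAct hi, ← map_sub, ← dRoot_mul_tau, map_mul, dRoot_pos hi, dRoot_pos h0,
    prev_rev_prev hi, map_sub, negRev_X, negRev_X]
  ring

theorem negRev_tauW {a : List (Fin n)} (ha : ∀ i ∈ a, (i : ℕ) ≠ 0) (f : MvPolynomial (Fin n) ℤ) :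
    negRev (tauW a f) = tauW (a.map fun i => (prev i).rev) (negRev f) := by
  induction a with
  | nil => rfl
  | cons i a ih =>
    rw [List.map_cons, tauW_cons, tauW_cons, Module.End.mul_apply, Module.End.mul_apply,
      negRev_tau (ha i (by simp)), ih fun j hj => ha j (List.mem_cons_of_mem _ hj)]

theorem wordProd_map_rev {a : List (Fin n)} (ha : ∀ i ∈ a, (i : ℕ) ≠ 0) :
    wordProd (a.map fun i => (prev i).rev) =
      ofPerm Fin.revPerm * wordProd a * ofPerm Fin.revPerm := by
  have hr : (ofPerm Fin.revPerm * ofPerm Fin.revPerm : SignedPerm n) = 1 := by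
    rw [← map_mul, revPerm_mul_self, map_one]
  induction a with
  | nil => simp [hr]
  | cons i a ih =>
    have hi := ha i (by simp)
    have h0 : ((prev i).rev : ℕ) ≠ 0 := by rw [val_rev_prev hi]; omega
    have h1 : simpleRefl (prev i).rev =
        ofPerm Fin.revPerm * simpleRefl i * ofPerm Fin.revPerm := by
      rw [simpleRefl_pos hi, simpleRefl_pos h0, prev_rev_prev hi, ← map_mul, ← map_mul]
      congr 1
      have := Equiv.swap_apply_apply (Fin.revPerm (n := n)) (prev i) i
      rw [revPerm_inv] at this
      rw [← this, Equiv.swap_comm]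
      rfl
    rw [List.map_cons, wordProd_cons, ih fun j hj => ha j (List.mem_cons_of_mem _ hj), h1,
      wordProd_cons]
    calc _ = ofPerm Fin.revPerm * simpleRefl i * (ofPerm Fin.revPerm * ofPerm Fin.revPerm) *
          wordProd a * ofPerm Fin.revPerm := by simp only [mul_assoc]
      _ = _ := by rw [hr, mul_one]; simp only [mul_assoc]

theorem negRev_divOp (u : Equiv.Perm (Fin n)) (f : MvPolynomial (Fin n) ℤ) :
    negRev (divOp (ofPerm u) f) =
      divOp (ofPerm (Fin.revPerm * u * Fin.revPerm)) (negRev f) := by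
  obtain ⟨a, ha, har⟩ := exists_isReducedWord_perm u
  rw [← tauW_eq_divOp har, negRev_tauW ha, ← tauW_eq_divOp (a := a.map fun i => (prev i).rev)]
  refine ⟨?_, ?_⟩
  · rw [wordProd_map_rev ha, har.1, map_mul, map_mul]
  · rw [List.length_map, har.2, length_rev_conj]

theorem negRev_stairRev : negRev (stairRev n) = (-1) ^ (n * (n - 1) / 2) * stair n n := by
  rw [stairRev, xpow, map_prod]
  simp only [map_pow, negRev_X]
  rw [← Equiv.prod_comp Fin.revPerm]
  simp only [Fin.revPerm_apply, Fin.rev_rev]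
  rw [← sum_stair, stair, xpow, ← Finset.prod_pow_eq_pow_sum, ← Finset.prod_mul_distrib]
  refine Finset.prod_congr rfl fun i _ => ?_
  rw [Fin.val_rev, neg_pow, Nat.sub_sub, add_comm 1]

theorem negRev_schubPerm (v : Equiv.Perm (Fin n)) :
    negRev (schubPerm (v * Fin.revPerm)) =
      (-1) ^ (n * (n - 1) / 2) * divOp (ofPerm v⁻¹) (stair n n) := by
  rw [schubPerm, negRev_divOp, negRev_stairRev]
  have h1 : (Fin.revPerm * ((v * Fin.revPerm)⁻¹ * Fin.revPerm) * Fin.revPerm : Equiv.Perm (Fin n)) =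
      v⁻¹ := by
    rw [mul_inv_rev, revPerm_inv, mul_assoc, mul_assoc, revPerm_mul_self, mul_one, ← mul_assoc,
      revPerm_mul_self, one_mul]
  have h2 : ((-1) ^ (n * (n - 1) / 2) * stair n n : MvPolynomial (Fin n) ℤ) =
      ((-1) ^ (n * (n - 1) / 2) : ℤ) • stair n n := by
    simp [Algebra.smul_def]
  rw [h1, h2, map_smul]
  simp [Algebra.smul_def]

theorem divOp_comp (v w : SignedPerm n) (f : MvPolynomial (Fin n) ℤ) :
    divOp v (divOp w f) = if (v * w).length = v.length + w.length then divOp (v * w) f else 0 := by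
  split_ifs with h
  · rw [← divOp_mul_of_eq h, Module.End.mul_apply]
  · rw [← Module.End.mul_apply, divOp_mul_of_ne h, LinearMap.zero_apply]

/-- Orthogonality of the polynomials of type `A`. -/
theorem piOp_schubPerm_negRev (u v : Equiv.Perm (Fin n)) :
    piOp n (schubPerm u * negRev (schubPerm (v * Fin.revPerm))) = if u = v then 1 else 0 := by
  have hη : ((-1) ^ (n * (n - 1) / 2) * (-1) ^ (n * (n - 1) / 2) : MvPolynomial (Fin n) ℤ) = 1 := by
    rw [← mul_pow]; simp
  have hc : ∀ f g : MvPolynomial (Fin n) ℤ, piOp n (f * ((-1) ^ (n * (n - 1) / 2) * g)) =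
      (-1) ^ (n * (n - 1) / 2) * piOp n (f * g) := by
    intro f g
    rw [mul_left_comm, piOp_mul_left]
    intro i _
    rw [map_pow, map_neg, map_one]
  -- By adjointness everything moves onto the staircase as `∂'_{ϖ_0 u} ∂'_{v⁻¹}`. This is zero or
  -- `∂'_{ϖ_0 u v⁻¹}`, which pairs nontrivially with the other staircase only when `u = v`.
  rw [negRev_schubPerm, hc, schubPerm, piOp_divOp_mul, mul_inv_rev, inv_inv, revPerm_inv,
    divOp_comp, ← map_mul]
  by_cases huv : u = v
  · subst huv
    have h := length_ofPerm_add u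
    rw [if_pos rfl, mul_inv_cancel_right, if_pos, ← piOp_eq, piOp_stair, ← one_mul (stairRev n),
      one_mul (stairRev n), mul_comm (stairRev n), piOp_mul_left, piOp_stairRev, mul_one, hη]
    · intro i _
      rw [map_pow, map_neg, map_one]
    · rw [length_revPerm, map_inv, length_inv]
      omega
  · rw [if_neg huv]
    split_ifs
    · rw [piOp_stairRev_mul_divOp, mul_zero]
      intro h
      apply huv
      rw [mul_assoc, mul_eq_left, mul_inv_eq_one] at h
      exact h
    · rw [mul_zero, map_zero, mul_zero]

/-- Adjointness gives the composite `∂'_{ϖ_0 u} ∂'_{v⁻¹ϖ_0}`, whose lengths add up to that of `ϖ_0`.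
It is nonzero only if the product has full length, that is, equals `ϖ_0`. -/
theorem piOp_schubPerm_mul (u v : Equiv.Perm (Fin n))
    (h : (ofPerm u).length + (ofPerm v).length = n * (n - 1) / 2) :
    piOp n (schubPerm u * schubPerm v) = if v = Fin.revPerm * u then 1 else 0 := by
  rw [schubPerm, schubPerm, piOp_divOp_mul, mul_inv_rev, inv_inv, revPerm_inv, divOp_comp,
    ← map_mul]
  have h1 := length_ofPerm_add u
  have h2 := length_mul_revPerm v⁻¹
  rw [map_inv, length_inv] at h2
  have h3 : (ofPerm (Fin.revPerm * u)).length + (ofPerm (v⁻¹ * Fin.revPerm)).length =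
      n * (n - 1) / 2 := by omega
  rw [h3]
  by_cases hv : v = Fin.revPerm * u
  · have e : Fin.revPerm * u * (v⁻¹ * Fin.revPerm) = Fin.revPerm := by
      rw [hv, ← mul_assoc, mul_inv_cancel, one_mul]
    rw [if_pos hv, e, if_pos length_revPerm, ← piOp_eq, piOp_stairRev, mul_one, piOp_stairRev]
  · rw [if_neg hv, if_neg, mul_zero, map_zero]
    intro h4
    have h5 := length_mul_revPerm (Fin.revPerm * u * (v⁻¹ * Fin.revPerm))
    have h6 := eq_one_of_length (w := ofPerm (Fin.revPerm * u * (v⁻¹ * Fin.revPerm) * Fin.revPerm))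
      (by omega)
    rw [← map_one ofPerm] at h6
    have h7 := ofPerm_injective h6
    rw [mul_assoc, mul_assoc v⁻¹, revPerm_mul_self, mul_one, mul_inv_eq_one] at h7
    exact hv h7.symm

end SchubertPerm

/-! ### Pfaffians through the exterior algebra -/

section PfaffianForm

open CliffordAlgebra

variable {S : Type*} [CommRing S] {N : ℕ}

/-- The exterior algebra of the free module with basis `ε_0, …, ε_{N-1}`. -/
abbrev Wedge (S : Type*) [CommRing S] (N : ℕ) := ExteriorAlgebra S (Fin N → S)

/-- The generator `ε_p`. -/
noncomputable def eps (S : Type*) [CommRing S] {N : ℕ} (p : Fin N) : Wedge S N :=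
  ExteriorAlgebra.ι S (Pi.single p 1)

/-- Contraction by the functional with values `d p` on the basis. -/
noncomputable def contr (d : Fin N → S) : Wedge S N →ₗ[S] Wedge S N :=
  contractLeft (Fintype.linearCombination S d)

theorem contr_one (d : Fin N → S) : contr d 1 = 0 := contractLeft_one _ _

theorem linearCombination_single (d : Fin N → S) (p : Fin N) :
    Fintype.linearCombination S d (Pi.single p 1) = d p := by
  simp [Fintype.linearCombination_apply_single]

theorem contr_eps_mul (d : Fin N → S) (p : Fin N) (x : Wedge S N) :
    contr d (eps S p * x) = d p • x - eps S p * contr d x := by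
  rw [contr, eps, ← linearCombination_single d p]
  exact contractLeft_ι_mul _ _ _

theorem contr_contr_self (d : Fin N → S) (x : Wedge S N) : contr d (contr d x) = 0 :=
  contractLeft_contractLeft _ _

theorem contr_comm (d d' : Fin N → S) (x : Wedge S N) :
    contr d (contr d' x) = -contr d' (contr d x) := contractLeft_comm _ _ _

theorem contr_add (d d' : Fin N → S) (x : Wedge S N) :
    contr (d + d') x = contr d x + contr d' x := by
  have : Fintype.linearCombination S (d + d') =
      Fintype.linearCombination S d + Fintype.linearCombination S d' := by
    refine LinearMap.ext fun v => ?_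
    simp [Fintype.linearCombination_apply, mul_add, Finset.sum_add_distrib]
  rw [contr, this, map_add]; rfl

theorem contr_smul (c : S) (d : Fin N → S) (x : Wedge S N) :
    contr (c • d) x = c • contr d x := by
  have : Fintype.linearCombination S (c • d) = c • Fintype.linearCombination S d := by
    refine LinearMap.ext fun v => ?_
    simp [Fintype.linearCombination_apply, Finset.mul_sum, mul_left_comm]
  rw [contr, this, map_smul]; rfl

theorem contr_sub (d d' : Fin N → S) (x : Wedge S N) :
    contr (d - d') x = contr d x - contr d' x := by
  rw [eq_sub_iff_add_eq, ← contr_add, sub_add_cancel]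

/-- Contraction by the dual basis vector `ε_p*`. -/
noncomputable def contrBasis (p : Fin N) : Wedge S N →ₗ[S] Wedge S N := contr (Pi.single p 1)

theorem contrBasis_eps_mul (p q : Fin N) (x : Wedge S N) :
    contrBasis p (eps S q * x) = (if q = p then x else 0) - eps S q * contrBasis p x := by
  rw [contrBasis, contr_eps_mul, Pi.single_apply]
  split_ifs <;> simp

theorem contr_eq_sum (d : Fin N → S) (x : Wedge S N) :
    contr d x = ∑ p, d p • contrBasis p x := by
  have h : d = ∑ p, d p • (Pi.single p 1 : Fin N → S) := by
    funext q
    simp [Finset.sum_apply, Pi.single_apply]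
  have hs : ∀ s : Finset (Fin N), contr (∑ p ∈ s, d p • (Pi.single p 1 : Fin N → S)) x =
      ∑ p ∈ s, d p • contrBasis p x := by
    intro s
    induction s using Finset.induction_on with
    | empty =>
      rw [Finset.sum_empty, Finset.sum_empty, ← zero_smul S (0 : Fin N → S), contr_smul, zero_smul]
    | insert a s ha ih => rw [Finset.sum_insert ha, Finset.sum_insert ha, contr_add, ih, contr_smul,
        contrBasis]
  rw [← hs, ← h]

theorem wedge_induction {P : Wedge S N → Prop} (h1 : P 1) (hadd : ∀ x y, P x → P y → P (x + y))
    (hsmul : ∀ (c : S) x, P x → P (c • x)) (hmul : ∀ p x, P x → P (eps S p * x)) (x) : P x := by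
  induction x using CliffordAlgebra.left_induction with
  | algebraMap r => rw [Algebra.algebraMap_eq_smul_one]; exact hsmul _ _ h1
  | add x y hx hy => exact hadd _ _ hx hy
  | ι_mul x m hx =>
    have h2 : CliffordAlgebra.ι 0 m = ∑ p, m p • eps S p := by
      simp only [eps, ← map_smul, ← map_sum]
      congr 1
      funext q
      simp [Finset.sum_apply, Pi.single_apply]
    rw [h2, Finset.sum_mul]
    have h0 : P 0 := by simpa using hsmul 0 _ h1
    refine Finset.sum_induction _ P hadd h0 fun p _ => ?_
    rw [smul_mul_assoc]
    exact hsmul _ _ (hmul _ _ hx)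

variable [IsDomain S] [CharZero S]

/-- A skew matrix has zero quadratic form, so the Clifford change of form stays inside the exterior
algebra; it serves as `exp(A)`. -/
theorem skew_form_proof {A : Fin N → Fin N → S} (hA : ∀ p q, A p q = -A q p) :
    (-Matrix.toBilin' (Matrix.of A)).toQuadraticMap =
      (0 : QuadraticForm S (Fin N → S)) - 0 := by
  ext v
  rw [LinearMap.BilinMap.toQuadraticMap_apply, sub_zero, zero_apply,
    LinearMap.neg_apply, LinearMap.neg_apply, neg_eq_zero, Matrix.toBilin'_apply]
  have h : ∑ i, ∑ j, v i * Matrix.of A i j * v j = -∑ i, ∑ j, v i * Matrix.of A i j * v j := by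
    conv_lhs => rw [Finset.sum_comm]
    rw [← Finset.sum_neg_distrib]
    refine Finset.sum_congr rfl fun i _ => ?_
    rw [← Finset.sum_neg_distrib]
    refine Finset.sum_congr rfl fun j _ => ?_
    rw [Matrix.of_apply, Matrix.of_apply, hA]
    ring
  rwa [eq_neg_iff_add_eq_zero, ← two_mul, mul_eq_zero, or_iff_right two_ne_zero] at h

/-- The transformation `exp(A)` of the exterior algebra attached to a skew-symmetric matrix. -/
noncomputable def skewExp {A : Fin N → Fin N → S} (hA : ∀ p q, A p q = -A q p) :
    Wedge S N →ₗ[S] Wedge S N := changeForm (skew_form_proof hA)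

theorem skewExp_one {A : Fin N → Fin N → S} (hA : ∀ p q, A p q = -A q p) : skewExp hA 1 = 1 :=
  changeForm_one _

theorem skewExp_eps_mul {A : Fin N → Fin N → S} (hA : ∀ p q, A p q = -A q p) (p : Fin N)
    (x : Wedge S N) :
    skewExp hA (eps S p * x) = eps S p * skewExp hA x + contr (A p) (skewExp hA x) := by
  have h1 : (-Matrix.toBilin' (Matrix.of A)) (Pi.single p 1) =
      -Fintype.linearCombination S (A p) := by
    refine LinearMap.pi_ext' fun q => LinearMap.ext_ring ?_
    simp [Fintype.linearCombination_apply_single, Matrix.toBilin'_single]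
  have h2 := changeForm_ι_mul (skew_form_proof hA) (Pi.single p 1) x
  rw [h1, map_neg, LinearMap.neg_apply, sub_neg_eq_add] at h2
  exact h2

theorem skewExp_contr {A : Fin N → Fin N → S} (hA : ∀ p q, A p q = -A q p) (d : Fin N → S)
    (x : Wedge S N) : skewExp hA (contr d x) = contr d (skewExp hA x) :=
  changeForm_contractLeft _ _ _

/-- The Pfaffian functional on the exterior algebra. -/
noncomputable def pfForm {A : Fin N → Fin N → S} (hA : ∀ p q, A p q = -A q p) :
    Wedge S N →ₗ[S] S :=
  (ExteriorAlgebra.algebraMapInv (M := Fin N → S)).toLinearMap ∘ₗ skewExp hA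

theorem pfForm_one {A : Fin N → Fin N → S} (hA : ∀ p q, A p q = -A q p) : pfForm hA 1 = 1 := by
  simp [pfForm, skewExp_one]

/-- Expansion along a row: a product starting with a generator has no scalar part, so only the
contraction survives. -/
theorem pfForm_eps_mul {A : Fin N → Fin N → S} (hA : ∀ p q, A p q = -A q p) (p : Fin N)
    (x : Wedge S N) : pfForm hA (eps S p * x) = pfForm hA (contr (A p) x) := by
  simp only [pfForm, LinearMap.comp_apply, skewExp_contr, skewExp_eps_mul, map_add,
    AlgHom.toLinearMap_apply, map_mul]
  simp [eps, ExteriorAlgebra.algebraMapInv]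

/-- Adding `a ∧ b` to the matrix multiplies `exp(A)` by the exponential of a product of two
contractions. These anticommute and square to zero, so the series stops after its linear term. -/
theorem skewExp_add {A A' : Fin N → Fin N → S} (hA : ∀ p q, A p q = -A q p)
    (hA' : ∀ p q, A' p q = -A' q p) (a b : Fin N → S)
    (h : ∀ p q, A' p q = A p q + (a p * b q - b p * a q)) (x : Wedge S N) :
    skewExp hA' x = skewExp hA x + contr b (contr a (skewExp hA x)) := by
  induction x using wedge_induction with
  | h1 => rw [skewExp_one, skewExp_one, contr_one, map_zero, add_zero]
  | hadd x y hx hy => simp only [map_add, hx, hy]; abel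
  | hsmul c x hx => simp only [map_smul, hx, smul_add]
  | hmul p x hx =>
    have e : A' p = A p + (a p • b - b p • a) := by
      funext q; simp [h]
    have e1 : contr b (contr a (contr (A p) (skewExp hA x))) =
        contr (A p) (contr b (contr a (skewExp hA x))) := by
      rw [contr_comm a, map_neg, contr_comm b (A p), neg_neg]
    simp only [skewExp_eps_mul, hx, e, contr_add, contr_sub, contr_smul, map_add, e1,
      contr_eps_mul, map_sub, map_smul, contr_contr_self, mul_add]
    rw [contr_comm a b, contr_contr_self]
    simp only [neg_zero, map_zero, smul_zero]
    abel

theorem pfForm_add {A A' : Fin N → Fin N → S} (hA : ∀ p q, A p q = -A q p)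
    (hA' : ∀ p q, A' p q = -A' q p) (a b : Fin N → S)
    (h : ∀ p q, A' p q = A p q + (a p * b q - b p * a q)) (x : Wedge S N) :
    pfForm hA' x = pfForm hA x + pfForm hA (contr b (contr a x)) := by
  simp only [pfForm, LinearMap.comp_apply, skewExp_add hA hA' a b h, map_add, skewExp_contr]

end PfaffianForm

/-! ### Integral combinations of wedge products -/

section WedgeSpan

variable {S : Type*} [CommRing S] {N : ℕ}

/-- The product `ε_{l_1} ε_{l_2} ⋯`. -/
noncomputable def wedge (S : Type*) [CommRing S] {N : ℕ} (l : List (Fin N)) : Wedge S N :=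
  (l.map (eps S)).prod

@[simp] theorem wedge_nil : wedge S ([] : List (Fin N)) = 1 := rfl

@[simp] theorem wedge_cons (p : Fin N) (l : List (Fin N)) :
    wedge S (p :: l) = eps S p * wedge S l := by simp [wedge]

/-- The additive group generated by the products of length `r`. -/
noncomputable def wedgeSpan (S : Type*) [CommRing S] (N r : ℕ) : AddSubgroup (Wedge S N) :=
  AddSubgroup.closure {x | ∃ l : List (Fin N), l.length = r ∧ wedge S l = x}

theorem wedge_mem (l : List (Fin N)) : wedge S l ∈ wedgeSpan S N l.length :=
  AddSubgroup.subset_closure ⟨l, rfl, rfl⟩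

theorem eps_mul_mem {r : ℕ} {x : Wedge S N} (hx : x ∈ wedgeSpan S N r) (p : Fin N) :
    eps S p * x ∈ wedgeSpan S N (r + 1) := by
  induction hx using AddSubgroup.closure_induction with
  | mem x hx =>
    obtain ⟨l, rfl, rfl⟩ := hx
    rw [← wedge_cons]
    exact wedge_mem (p :: l)
  | zero => rw [mul_zero]; exact zero_mem _
  | add x y _ _ hx hy => rw [mul_add]; exact add_mem hx hy
  | neg x _ hx => rw [mul_neg]; exact neg_mem hx

theorem contrBasis_mem {r : ℕ} {x : Wedge S N} (hx : x ∈ wedgeSpan S N r) (p : Fin N) :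
    contrBasis p x ∈ wedgeSpan S N (r - 1) := by
  induction hx using AddSubgroup.closure_induction with
  | mem x hx =>
    obtain ⟨l, rfl, rfl⟩ := hx
    induction l with
    | nil => rw [wedge_nil, contrBasis, contr_one]; exact zero_mem _
    | cons q l ih =>
      rw [wedge_cons, contrBasis_eps_mul, List.length_cons, Nat.add_sub_cancel]
      refine sub_mem ?_ ?_
      · split_ifs
        · exact wedge_mem l
        · exact zero_mem _
      · cases l with
        | nil => rw [wedge_nil, contrBasis, contr_one, mul_zero]; exact zero_mem _
        | cons q' l =>
          rw [List.length_cons, Nat.add_sub_cancel] at ih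
          exact eps_mul_mem ih q
  | zero => rw [map_zero]; exact zero_mem _
  | add x y _ _ hx hy => rw [map_add]; exact add_mem hx hy
  | neg x _ hx => rw [map_neg]; exact neg_mem hx

theorem contrBasis_wedge_of_notMem {p : Fin N} {l : List (Fin N)} (h : p ∉ l) :
    contrBasis p (wedge S l) = 0 := by
  induction l with
  | nil => exact contr_one _
  | cons q l ih =>
    rw [List.mem_cons, not_or] at h
    rw [wedge_cons, contrBasis_eps_mul, if_neg (Ne.symm h.1), ih h.2, mul_zero, sub_zero]

/-- Contraction of a product over a sequence. -/
theorem contr_wedge_ofFn (d : Fin N → S) (r : ℕ) (k : Fin (r + 1) → Fin N) :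
    contr d (wedge S (List.ofFn k)) =
      ∑ j : Fin (r + 1), ((-1) ^ (j : ℕ) * d (k j)) • wedge S (List.ofFn (k ∘ j.succAbove)) := by
  induction r with
  | zero => rw [List.ofFn_succ, wedge_cons, contr_eps_mul]; simp [contr_one]
  | succ r ih =>
    rw [List.ofFn_succ, wedge_cons, contr_eps_mul, ih]
    conv_rhs => rw [Fin.sum_univ_succ]
    rw [sub_eq_add_neg]
    congr 1
    · simp [Function.comp_def]
    · rw [Finset.mul_sum, ← Finset.sum_neg_distrib]
      refine Finset.sum_congr rfl fun j _ => ?_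
      rw [mul_smul_comm, ← neg_smul]
      congr 1
      · rw [Fin.val_succ, pow_succ]; ring
      · rw [← wedge_cons, List.ofFn_succ]
        simp [Function.comp_def]

variable [IsDomain S] [CharZero S]

/-- A ring endomorphism such as `s_i` is not linear over the coefficient ring, so the identity is
only available on combinations of wedge products with integer coefficients. -/
theorem map_pfForm {A A' : Fin N → Fin N → S} (hA : ∀ p q, A p q = -A q p)
    (hA' : ∀ p q, A' p q = -A' q p) (φ : S →+* S) (h : ∀ p q, φ (A p q) = A' p q) {r : ℕ}
    {x : Wedge S N} (hx : x ∈ wedgeSpan S N r) : φ (pfForm hA x) = pfForm hA' x := by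
  induction r using Nat.strong_induction_on generalizing x with
  | _ r ih =>
    induction hx using AddSubgroup.closure_induction with
    | mem x hx =>
      obtain ⟨l, rfl, rfl⟩ := hx
      cases l with
      | nil => rw [wedge_nil, pfForm_one, pfForm_one, map_one]
      | cons p l =>
        rw [wedge_cons, pfForm_eps_mul, pfForm_eps_mul, contr_eq_sum, contr_eq_sum, map_sum,
          map_sum, map_sum]
        refine Finset.sum_congr rfl fun q _ => ?_
        rw [LinearMap.map_smul, LinearMap.map_smul, smul_eq_mul, smul_eq_mul, map_mul, h,
          ih (l.length - 1) (by simp) (contrBasis_mem (wedge_mem l) q)]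
    | zero => simp
    | add x y _ _ hx hy => simp only [map_add, hx, hy]
    | neg x _ hx => simp only [map_neg, hx]

theorem pfForm_odd {A : Fin N → Fin N → S} (hA : ∀ p q, A p q = -A q p) {r : ℕ} (hr : Odd r)
    {x : Wedge S N} (hx : x ∈ wedgeSpan S N r) : pfForm hA x = 0 := by
  induction r using Nat.strong_induction_on generalizing x with
  | _ r ih =>
    induction hx using AddSubgroup.closure_induction with
    | mem x hx =>
      obtain ⟨l, rfl, rfl⟩ := hx
      cases l with
      | nil => simp at hr
      | cons p l =>
        rw [wedge_cons, pfForm_eps_mul, contr_eq_sum, map_sum]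
        refine Finset.sum_eq_zero fun q _ => ?_
        rw [map_smul]
        cases l with
        | nil => rw [wedge_nil, contrBasis, contr_one, map_zero, smul_zero]
        | cons p' l =>
          rw [ih l.length (by simp) (by
            simp only [List.length_cons] at hr
            rw [Nat.odd_iff] at hr ⊢; omega) (contrBasis_mem (wedge_mem (p' :: l)) q), smul_zero]
    | zero => simp
    | add x y _ _ hx hy => simp only [map_add, hx, hy, add_zero]
    | neg x _ hx => simp only [map_neg, hx, neg_zero]

/-- Contracting a wedge product omits one factor at a time with alternating signs, which is the
recursive expansion defining the Pfaffian. -/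
theorem pfaffian_eq_pfForm {A : Fin N → Fin N → S} (hA : ∀ p q, A p q = -A q p) (m : ℕ)
    (k : Fin (2 * m) → Fin N) (M : Matrix (Fin (2 * m)) (Fin (2 * m)) S)
    (hM : ∀ i j, i < j → M i j = A (k i) (k j)) :
    pfaffian m M = pfForm hA (wedge S (List.ofFn k)) := by
  induction m with
  | zero => simp [pfaffian, pfForm_one]
  | succ m ih =>
    have e : wedge S (List.ofFn k) = eps S (k 0) * wedge S (List.ofFn (k ∘ Fin.succ)) := by
      rw [← wedge_cons]
      congr 1
      exact List.ofFn_succ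
    rw [pfaffian, e, pfForm_eps_mul, contr_wedge_ofFn, map_sum]
    refine Finset.sum_congr rfl fun j _ => ?_
    rw [map_smul, smul_eq_mul, hM 0 j.succ (Fin.succ_pos j), Function.comp_apply,
      ih (fun i => k ((j.succAbove i).succ))]
    · rfl
    · intro i i' hi
      rw [Matrix.submatrix_apply, hM]
      rw [Fin.succ_lt_succ_iff]
      exact Fin.strictMono_succAbove j hi

end WedgeSpan

/-! ### The polynomials `Q̃` as a functional, and the action of `s_0` -/

section QForm

variable {n : ℕ}

theorem esymm_eq_zero {k : ℕ} (h : n < k) : esymm (Fin n) ℤ k = 0 := by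
  rw [← esymmFrom_zero_left, esymmFrom_eq_zero (by omega)]

theorem sAct_esymm {i : Fin n} (hi : (i : ℕ) ≠ 0) (k : ℕ) :
    sAct i (esymm (Fin n) ℤ k) = esymm (Fin n) ℤ k := by
  rw [← esymmFrom_zero_left, sAct_esymmFrom hi]

theorem qPair_zero (p : ℕ) : qPair n p 0 = esymm (Fin n) ℤ p := by simp [qPair]

theorem sAct_qPair {i : Fin n} (hi : (i : ℕ) ≠ 0) (p q : ℕ) :
    sAct i (qPair n p q) = qPair n p q := by
  have h2 : sAct i 2 = 2 := map_ofNat _ 2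
  simp [qPair, sAct_esymm hi, h2]

/-- The skew-symmetric matrix with entries `Q̃_{p,q}` for `p > q`. -/
noncomputable def partMat (n p q : ℕ) : MvPolynomial (Fin n) ℤ :=
  if q < p then qPair n p q else if p < q then -qPair n q p else 0

theorem partMat_of_lt {p q : ℕ} (h : q < p) : partMat n p q = qPair n p q := if_pos h

theorem partMat_neg (p q : ℕ) : partMat n p q = -partMat n q p := by
  rcases lt_trichotomy p q with h | rfl | h
  · simp [partMat, h, h.not_gt]
  · simp [partMat]
  · simp [partMat, h, h.not_gt]

theorem sAct_partMat {i : Fin n} (hi : (i : ℕ) ≠ 0) (p q : ℕ) :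
    sAct i (partMat n p q) = partMat n p q := by
  unfold partMat
  split_ifs <;> simp [sAct_qPair hi]

/-- The exterior algebra on generators indexed by the possible parts `0, …, n`. -/
abbrev PartWedge (n : ℕ) := Wedge (MvPolynomial (Fin n) ℤ) (n + 1)

/-- The Pfaffian functional of the matrix of the `Q̃_{p,q}`. -/
noncomputable def partPf (n : ℕ) : PartWedge n →ₗ[MvPolynomial (Fin n) ℤ] MvPolynomial (Fin n) ℤ :=
  pfForm (A := fun p q : Fin (n + 1) => partMat n p q) fun p q => partMat_neg p q

/-- The functional `ε_p ↦ e_p`. -/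
noncomputable def eVec (n : ℕ) (p : Fin (n + 1)) : MvPolynomial (Fin n) ℤ := esymm (Fin n) ℤ p

/-- The functional sending a product of generators to the corresponding `Q̃`. -/
noncomputable def qForm (n : ℕ) : PartWedge n →ₗ[MvPolynomial (Fin n) ℤ] MvPolynomial (Fin n) ℤ :=
  partPf n + partPf n ∘ₗ contr (eVec n)

theorem qForm_apply (x : PartWedge n) : qForm n x = partPf n x + partPf n (contr (eVec n) x) := rfl

theorem qForm_one : qForm n 1 = 1 := by
  rw [qForm_apply, contr_one, map_zero, add_zero]
  exact pfForm_one _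

theorem qForm_contr_eVec (x : PartWedge n) :
    qForm n (contr (eVec n) x) = partPf n (contr (eVec n) x) := by
  rw [qForm_apply, contr_contr_self, map_zero, add_zero]

theorem qForm_eps_mul (p : Fin (n + 1)) (x : PartWedge n) :
    qForm n (eps _ p * x) =
      eVec n p * partPf n x + qForm n (contr (fun q : Fin (n + 1) => partMat n p q) x) := by
  have h : ∀ y : PartWedge n, partPf n (eps _ p * y) =
      partPf n (contr (fun q : Fin (n + 1) => partMat n p q) y) := fun y => pfForm_eps_mul _ _ _
  rw [qForm_apply, contr_eps_mul, map_sub, h, h, qForm_apply, contr_comm (eVec n), map_smul,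
    map_neg, smul_eq_mul]
  ring

theorem sAct_partPf {i : Fin n} (hi : (i : ℕ) ≠ 0) {r : ℕ} {x : PartWedge n}
    (hx : x ∈ wedgeSpan _ (n + 1) r) : sAct i (partPf n x) = partPf n x :=
  map_pfForm _ _ (sAct i).toRingHom (fun p q => sAct_partMat hi p q) hx

theorem sAct_qForm {i : Fin n} (hi : (i : ℕ) ≠ 0) {r : ℕ} {x : PartWedge n}
    (hx : x ∈ wedgeSpan _ (n + 1) r) : sAct i (qForm n x) = qForm n x := by
  rw [qForm_apply, map_add, sAct_partPf hi hx, contr_eq_sum, map_sum, map_sum]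
  congr 1
  refine Finset.sum_congr rfl fun p _ => ?_
  rw [LinearMap.map_smul, smul_eq_mul, map_mul, sAct_partPf hi (contrBasis_mem hx p), eVec,
    sAct_esymm hi]

/-- The sequence `0, E_0, E_1, …` of elementary symmetric polynomials without the first variable. -/
noncomputable def shiftE (n : ℕ) : ℕ → MvPolynomial (Fin n) ℤ
  | 0 => 0
  | k + 1 => esymmFrom n 1 k

section First

variable {z : Fin n} (hz : (z : ℕ) = 0)
include hz

theorem esymm_eq_add (p : ℕ) :
    esymm (Fin n) ℤ p = esymmFrom n 1 p + X z * shiftE n p := by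
  cases p with
  | zero => simp [shiftE]
  | succ k =>
    have h := esymmFrom_succ z k
    rw [hz, esymmFrom_zero_left] at h
    rw [h, shiftE]

theorem sAct_first_esymmFrom (k : ℕ) : sAct z (esymmFrom n 1 k) = esymmFrom n 1 k :=
  sAct_esymmFrom (by omega) k

theorem sAct_first_shiftE (k : ℕ) : sAct z (shiftE n k) = shiftE n k := by
  cases k with
  | zero => exact map_zero _
  | succ k => exact sAct_first_esymmFrom hz k

theorem sAct_first_X : sAct z (X z) = -X z := by rw [sAct_X_zero hz, if_pos rfl]

theorem sAct_first_esymm (p : ℕ) :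
    sAct z (esymm (Fin n) ℤ p) = esymmFrom n 1 p - X z * shiftE n p := by
  rw [esymm_eq_add hz, map_add, map_mul, sAct_first_X hz, sAct_first_shiftE hz,
    sAct_first_esymmFrom hz]
  ring

omit hz in
-- Consecutive terms cancel: with `E` the elementary polynomials without the first variable, the
-- second product at `k + 1` is the first product at `k` with opposite sign.
theorem sum_shiftE (p q : ℕ) (j : ℕ) (hj : j ≤ q) :
    ∑ k ∈ Finset.Icc 1 j, (-1) ^ k * (esymmFrom n 1 (p + k) * shiftE n (q - k) +
      shiftE n (p + k) * esymmFrom n 1 (q - k)) =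
      (-1) ^ j * (esymmFrom n 1 (p + j) * shiftE n (q - j)) - esymmFrom n 1 p * shiftE n q := by
  induction j with
  | zero => simp
  | succ j ih =>
    rw [Finset.sum_Icc_succ_top (by omega), ih (by omega)]
    have h1 : q - j = (q - (j + 1)) + 1 := by omega
    rw [h1, ← add_assoc]
    simp only [shiftE]
    ring

/-- With `e_p = E_p + x_1 E_{p-1}`, the reflection changes only the sign of `x_1`, and the part of
the sum that is linear in `x_1` telescopes. What remains is a rank-two skew correction by `s_0(e)`
and `e`. -/
theorem sAct_first_qPair (p q : ℕ) : sAct z (qPair n p q) = qPair n p q +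
    (sAct z (esymm (Fin n) ℤ p) * esymm (Fin n) ℤ q -
      esymm (Fin n) ℤ p * sAct z (esymm (Fin n) ℤ q)) := by
  have h1 := sum_shiftE (n := n) p q q le_rfl
  rw [Nat.sub_self, shiftE, mul_zero, mul_zero, zero_sub] at h1
  have h2 : ∑ k ∈ Finset.Icc 1 q, (-1) ^ k * sAct z (esymm (Fin n) ℤ (p + k)) *
      sAct z (esymm (Fin n) ℤ (q - k)) = ∑ k ∈ Finset.Icc 1 q, (-1) ^ k *
        esymm (Fin n) ℤ (p + k) * esymm (Fin n) ℤ (q - k) + 2 * X z *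
          (esymmFrom n 1 p * shiftE n q) := by
    rw [eq_neg_iff_add_eq_zero.1 h1 |> eq_neg_of_add_eq_zero_right, mul_neg, Finset.mul_sum, ← sub_eq_add_neg,
      ← Finset.sum_sub_distrib]
    refine Finset.sum_congr rfl fun k _ => ?_
    rw [sAct_first_esymm hz, sAct_first_esymm hz, esymm_eq_add hz, esymm_eq_add hz (q - k)]
    ring
  have h3 : sAct z (qPair n p q) = sAct z (esymm (Fin n) ℤ p) * sAct z (esymm (Fin n) ℤ q) +
      2 * ∑ k ∈ Finset.Icc 1 q, (-1) ^ k * sAct z (esymm (Fin n) ℤ (p + k)) *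
        sAct z (esymm (Fin n) ℤ (q - k)) := by
    have h2 : sAct z 2 = 2 := map_ofNat _ 2
    simp [qPair, h2]
  rw [h3, h2, qPair, sAct_first_esymm hz, sAct_first_esymm hz, esymm_eq_add hz p,
    esymm_eq_add hz q]
  ring

theorem sAct_first_partMat (p q : ℕ) : sAct z (partMat n p q) = partMat n p q +
    (sAct z (esymm (Fin n) ℤ p) * esymm (Fin n) ℤ q -
      esymm (Fin n) ℤ p * sAct z (esymm (Fin n) ℤ q)) := by
  unfold partMat
  split_ifs with h1 h2
  · exact sAct_first_qPair hz p q
  · rw [map_neg, sAct_first_qPair hz]; ring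
  · obtain rfl : p = q := by omega
    rw [map_zero]; ring

/-- The matrix changes by a rank-two skew term, so `pfForm_add` yields a single correction by a
double contraction. -/
theorem sAct_first_partPf {r : ℕ} {x : PartWedge n} (hx : x ∈ wedgeSpan _ (n + 1) r) :
    sAct z (partPf n x) =
      partPf n x + partPf n (contr (eVec n) (contr (fun p => sAct z (eVec n p)) x)) := by
  have hA' : ∀ p q : Fin (n + 1), (fun p q : Fin (n + 1) => sAct z (partMat n p q)) p q =
      -(fun p q : Fin (n + 1) => sAct z (partMat n p q)) q p := by
    intro p q
    dsimp only
    rw [partMat_neg, map_neg]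
  rw [partPf, ← pfForm_add _ hA' (fun p => sAct z (eVec n p)) (eVec n)
    fun p q => sAct_first_partMat hz p q]
  exact map_pfForm _ hA' (sAct z).toRingHom (fun p q => rfl) hx

theorem sAct_first_qForm {r : ℕ} {x : PartWedge n} (hx : x ∈ wedgeSpan _ (n + 1) r) :
    sAct z (qForm n x) = partPf n x + qForm n (contr (fun p => sAct z (eVec n p)) x) := by
  have h1 : sAct z (partPf n (contr (eVec n) x)) =
      partPf n (contr (fun p => sAct z (eVec n p)) x) := by
    -- The correction term of `sAct_first_partPf` contracts twice by `s_0(e)`, hence vanishes; it is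
    -- inserted so that both sides match termwise.
    have h2 : partPf n (contr (fun p => sAct z (eVec n p)) x) =
        partPf n (contr (fun p => sAct z (eVec n p)) x) +
        partPf n (contr (eVec n) (contr (fun p => sAct z (eVec n p))
          (contr (fun p => sAct z (eVec n p)) x))) := by
      rw [contr_contr_self, map_zero, map_zero, add_zero]
    rw [h2]
    conv_rhs => rw [contr_eq_sum (fun p => sAct z (eVec n p)) x]
    rw [contr_eq_sum]
    simp only [map_sum, LinearMap.map_smul, smul_eq_mul, map_mul]
    rw [← Finset.sum_add_distrib]
    refine Finset.sum_congr rfl fun p _ => ?_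
    rw [sAct_first_partPf hz (contrBasis_mem hx p), mul_add]
  rw [qForm_apply, map_add, h1, sAct_first_partPf hz hx, qForm_apply]
  ring

/-- Both `Q̃` and `s_0 Q̃` share the term `partPf`; the difference is the contraction by `e - s_0(e)
= 2 x_1 · E_{p-1}`, exactly divisible by `2 x_1`. -/
theorem tau_first_qForm {r : ℕ} {x : PartWedge n} (hx : x ∈ wedgeSpan _ (n + 1) r) :
    tau z (qForm n x) = qForm n (contr (fun p : Fin (n + 1) => shiftE n p) x) := by
  refine tau_eq_of ?_
  have h : (eVec n : Fin (n + 1) → _) = (fun p => sAct z (eVec n p)) +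
      (2 * X z : MvPolynomial (Fin n) ℤ) • fun p : Fin (n + 1) => shiftE n p := by
    funext p
    simp only [Pi.add_apply, Pi.smul_apply, smul_eq_mul]
    rw [eVec, sAct_first_esymm hz, esymm_eq_add hz]
    ring
  have h1 : contr (eVec n) x = contr (fun p => sAct z (eVec n p)) x +
      (2 * X z : MvPolynomial (Fin n) ℤ) • contr (fun p : Fin (n + 1) => shiftE n p) x := by
    conv_lhs => rw [h]
    rw [contr_add, contr_smul]
  have h2 := qForm_contr_eVec x
  rw [h1, map_add, LinearMap.map_smul, smul_eq_mul] at h2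
  rw [dRoot_zero hz, sAct_first_qForm hz hx, qForm_apply x, h1]
  linear_combination h2

end First

/-- The functional `ε_p ↦ e_{p-1-a}(x_{a+1}, …)`. -/
noncomputable def tailE (n a p : ℕ) : MvPolynomial (Fin n) ℤ :=
  if a < p then esymmFrom n (a + 1) (p - 1 - a) else 0

theorem tau_tailE {a : ℕ} (h : a + 1 < n) (p : ℕ) :
    tau ⟨a + 1, h⟩ (tailE n a p) = tailE n (a + 1) p := by
  unfold tailE
  split_ifs with h1 h2 h2
  · have e : p - 1 - a = (p - 1 - (a + 1)) + 1 := by omega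
    rw [e]
    exact tau_esymmFrom_succ ⟨a + 1, h⟩ _
  · have e : p - 1 - a = 0 := by omega
    rw [e, esymmFrom_zero_right, tau_one]
  · omega
  · exact map_zero _

/-- After `∂_0` has contracted, the letters `1, …, a` fix the `S_n`-invariant factors and act on the
coefficients alone, stripping one variable at a time. -/
theorem tauW_descWordZero_qForm (a : Fin n) {r : ℕ} {x : PartWedge n}
    (hx : x ∈ wedgeSpan _ (n + 1) r) :
    tauW (descWordZero a) (qForm n x) =
      ∑ p : Fin (n + 1), tailE n a p * qForm n (contrBasis p x) := by
  obtain ⟨a, ha⟩ := a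
  rw [descWordZero, tauW_append, Module.End.mul_apply, tauW_cons, tauW_nil, mul_one,
    tau_first_qForm rfl hx, contr_eq_sum, map_sum]
  dsimp only
  induction a with
  | zero =>
    rw [descWord, tauW_nil, Module.End.one_apply]
    refine Finset.sum_congr rfl fun p _ => ?_
    rw [LinearMap.map_smul, smul_eq_mul]
    congr 1
    obtain ⟨p, hp⟩ := p
    cases p with
    | zero => simp [shiftE, tailE]
    | succ p => simp [shiftE, tailE]
  | succ a ih =>
    rw [descWord, tauW_cons, Module.End.mul_apply, ih (Nat.lt_of_succ_lt ha), map_sum]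
    refine Finset.sum_congr rfl fun p _ => ?_
    rw [tau_mul_right (sAct_qForm (by simp) (contrBasis_mem hx p)), tau_tailE ha]

/-- Successive contractions by `ε_{a+1}*` for `a` in the list. -/
noncomputable def contrList : List (Fin n) → PartWedge n → PartWedge n
  | [], x => x
  | a :: l, x => contrList l (contrBasis a.succ x)

theorem contrList_zero (l : List (Fin n)) : contrList l (0 : PartWedge n) = 0 := by
  induction l with
  | nil => rfl
  | cons a l ih => rw [contrList, map_zero, ih]

end QForm

/-! ### Degrees and constant terms of the contraction coefficients -/

section EsymmFromDegree

variable {n : ℕ}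

theorem degreeOf_esymmFrom_le (m k : ℕ) (j : Fin n) :
    degreeOf j (esymmFrom n m k) ≤ if m ≤ j then 1 else 0 := by
  refine (degreeOf_sum_le _ _ _).trans (Finset.sup_le fun s hs => ?_)
  refine (degreeOf_prod_le _ _ _).trans ?_
  rw [Finset.mem_powersetCard] at hs
  rw [Finset.sum_congr rfl fun i _ => degreeOf_X j i, Finset.sum_ite_eq]
  split_ifs with h1 h2 h2
  · exact le_rfl
  · exact absurd (Finset.mem_filter.1 (hs.1 h1)).2 h2
  · exact Nat.zero_le _
  · exact le_rfl

theorem constantCoeff_esymmFrom (m k : ℕ) :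
    constantCoeff (esymmFrom n m k) = if k = 0 then 1 else 0 := by
  split_ifs with hk
  · rw [hk, esymmFrom_zero_right, map_one]
  · rw [esymmFrom, map_sum]
    refine Finset.sum_eq_zero fun s hs => ?_
    rw [map_prod]
    simp only [constantCoeff_X]
    obtain ⟨j, hj⟩ := Finset.card_pos.1 (by
      rw [(Finset.mem_powersetCard.1 hs).2]; exact Nat.pos_of_ne_zero hk)
    exact Finset.prod_eq_zero hj rfl

theorem esymmFrom_top (m : ℕ) : esymmFrom n m (n - m) =
    ∏ j ∈ Finset.univ.filter fun j : Fin n => m ≤ j, X j := by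
  have h : (Finset.univ.filter fun j : Fin n => m ≤ j).card = n - m := by
    have h1 : (Finset.univ.filter fun j : Fin n => m ≤ j).map Fin.valEmbedding =
        Finset.Ico m n := by
      ext x
      simp only [Finset.mem_map, Finset.mem_filter, Finset.mem_univ, true_and, Finset.mem_Ico,
        Fin.valEmbedding_apply]
      constructor
      · rintro ⟨j, hj, rfl⟩
        exact ⟨hj, j.isLt⟩
      · rintro ⟨h1, h2⟩
        exact ⟨⟨x, h2⟩, h1, rfl⟩
    rw [← Finset.card_map Fin.valEmbedding, h1, Nat.card_Ico]
  rw [esymmFrom, ← h, Finset.powersetCard_self, Finset.sum_singleton]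

theorem prod_esymmFrom_top :
    ∏ j ∈ Finset.range n, esymmFrom n (j + 1) (n - (j + 1)) = stairRev n := by
  simp only [esymmFrom_top, Finset.prod_filter]
  rw [Finset.prod_comm, stairRev, xpow]
  refine Finset.prod_congr rfl fun i _ => ?_
  rw [← Finset.prod_filter, Finset.prod_const]
  congr 1
  have h : (Finset.range n).filter (fun j => j + 1 ≤ (i : ℕ)) = Finset.range i := by
    ext j
    have := i.isLt
    simp only [Finset.mem_filter, Finset.mem_range]
    omega
  rw [h, Finset.card_range]

theorem constantCoeff_tailE (a p : ℕ) :
    constantCoeff (tailE n a p) = if p = a + 1 then 1 else 0 := by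
  unfold tailE
  split_ifs with h1 h2 h2
  · rw [constantCoeff_esymmFrom, if_pos (by omega)]
  · rw [constantCoeff_esymmFrom, if_neg (by omega)]
  · omega
  · exact map_zero _

theorem degreeOf_tailE_le (a p : ℕ) (j : Fin n) :
    degreeOf j (tailE n a p) ≤ if a < j then 1 else 0 := by
  unfold tailE
  split_ifs with h1 h2 h2
  · exact (degreeOf_esymmFrom_le _ _ _).trans (by split_ifs <;> omega)
  · exact (degreeOf_esymmFrom_le _ _ _).trans (by split_ifs <;> omega)
  · rw [degreeOf_zero]; omega
  · rw [degreeOf_zero]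

theorem sAct_tailE {i : Fin n} {a : ℕ} (h : (i : ℕ) ≤ a) (p : ℕ) :
    sAct i (tailE n a p) = tailE n a p := by
  unfold tailE
  split_ifs
  · exact sAct_esymmFrom (by omega) _
  · exact map_zero _

/-- The mirror image of `piOp_stairRev_mul` under `ϖ_0`; antisymmetry of `π` supplies the sign. -/
theorem piOp_stair_mul {f : MvPolynomial (Fin n) ℤ} (h : ∀ i : Fin n, degreeOf i f ≤ i) :
    piOp n (stair n n * f) = (-1) ^ (n * (n - 1) / 2) * C (constantCoeff f) := by
  have h1 : act ℤ (ofPerm Fin.revPerm) (stair n n * f) =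
      stairRev n * rename Fin.revPerm f := by
    rw [map_mul]
    congr 1
    · have h1 := act_ofPerm_xpow (Fin.revPerm (n := n)) (fun i => i)
      rw [stairRev, ← h1, stair]
      congr 2
      funext i
      simp only [Function.comp_apply, Fin.revPerm_apply, Fin.val_rev]
      omega
    · refine DFunLike.congr_fun (MvPolynomial.algHom_ext (f := act ℤ (ofPerm Fin.revPerm))
        fun k => ?_) f
      rw [act_X, rename_X]
      simp
  have h2 := piOp_act (Fin.revPerm (n := n)) (stair n n * f)
  rw [h1, sign_revPerm, piOp_stairRev_mul, constantCoeff_rename] at h2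
  · rw [h2, smul_eq_C_mul, ← mul_assoc]
    simp [← mul_pow]
  · intro i
    conv_lhs => rw [← Fin.rev_rev i]
    refine (degreeOf_rename_of_injective Fin.revPerm.injective i.rev).le.trans ((h _).trans ?_)
    rw [Fin.val_rev]
    omega

end EsymmFromDegree

/-! ### Wedge products of sets of parts and the Pfaffian `Q̃_λ` -/

section PartSets

variable {n : ℕ}

/-- The product of the generators indexed by a set of parts, in decreasing order. -/
noncomputable def wset (s : Finset (Fin n)) : PartWedge n :=
  wedge _ ((s.sort (· ≥ ·)).map Fin.succ)

theorem wset_empty : wset (∅ : Finset (Fin n)) = 1 := by simp [wset]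

theorem wset_mem (s : Finset (Fin n)) : wset s ∈ wedgeSpan _ (n + 1) s.card := by
  have := wedge_mem (S := MvPolynomial (Fin n) ℤ) ((s.sort (· ≥ ·)).map Fin.succ)
  rwa [List.length_map, Finset.length_sort] at this

theorem wset_insert_max {a : Fin n} {s : Finset (Fin n)} (h : ∀ b ∈ s, b < a) :
    wset (insert a s) = eps _ a.succ * wset s := by
  rw [wset, Finset.sort_insert _ (fun b hb => (h b hb).le) fun ha => lt_irrefl _ (h a ha)]
  rw [List.map_cons, wedge_cons, wset]

theorem eps_mul_self {S : Type*} [CommRing S] {N : ℕ} (p : Fin N) (x : Wedge S N) :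
    eps S p * (eps S p * x) = 0 := by
  rw [← mul_assoc, eps, ExteriorAlgebra.ι_sq_zero, zero_mul]

theorem eps_mul_comm {S : Type*} [CommRing S] {N : ℕ} (p q : Fin N) (x : Wedge S N) :
    eps S p * (eps S q * x) = -(eps S q * (eps S p * x)) := by
  rw [← mul_assoc, ← mul_assoc, eq_neg_iff_add_eq_zero, ← add_mul, eps, eps,
    ExteriorAlgebra.ι_add_mul_swap, zero_mul]

theorem eps_mul_wset (b : Fin n) (s : Finset (Fin n)) : eps _ b.succ * wset s =
    if b ∈ s then 0 else (-1) ^ (s.filter fun c => b < c).card * wset (insert b s) := by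
  induction s using Finset.induction_on_max with
  | empty =>
    rw [if_neg (Finset.notMem_empty _), Finset.filter_empty, Finset.card_empty, pow_zero, one_mul]
    exact (wset_insert_max (by simp)).symm
  | insert a s has ih =>
    have ha : a ∉ s := fun h => lt_irrefl _ (has a h)
    rcases lt_trichotomy b a with h | rfl | h
    · rw [wset_insert_max has, eps_mul_comm, ih]
      by_cases hb : b ∈ s
      · rw [if_pos hb, if_pos (Finset.mem_insert_of_mem hb), mul_zero, neg_zero]
      · rw [if_neg hb, if_neg (by simp [h.ne, hb]), Finset.insert_comm,
          wset_insert_max (a := a) (s := insert b s), Finset.filter_insert, if_pos h,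
          Finset.card_insert_of_notMem (by simp [ha]), pow_succ]
        · rw [← mul_assoc, ((Commute.neg_one_left (eps _ a.succ)).pow_left _).symm.eq]
          simp [mul_assoc]
        · intro c hc
          rcases Finset.mem_insert.1 hc with rfl | hc
          · exact h
          · exact has c hc
    · rw [if_pos (Finset.mem_insert_self _ _), wset_insert_max has, eps_mul_self]
    · have hb : ∀ c ∈ insert a s, c < b := by
        intro c hc
        rcases Finset.mem_insert.1 hc with rfl | hc
        · exact h
        · exact (has c hc).trans h
      rw [if_neg fun hm => lt_irrefl _ (hb b hm), wset_insert_max hb,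
        Finset.filter_false_of_mem fun c hc => (hb c hc).not_gt, Finset.card_empty, pow_zero,
        one_mul]

theorem contrBasis_wset_of_notMem {b : Fin n} {s : Finset (Fin n)} (h : b ∉ s) :
    contrBasis b.succ (wset s) = 0 := by
  refine contrBasis_wedge_of_notMem ?_
  simpa using h

theorem contrBasis_zero_wset (s : Finset (Fin n)) : contrBasis 0 (wset s) = 0 := by
  refine contrBasis_wedge_of_notMem ?_
  simp [Fin.succ_ne_zero]

theorem contrBasis_wset_insert {b : Fin n} {s : Finset (Fin n)} (h : b ∉ s) :
    contrBasis b.succ (wset (insert b s)) = (-1) ^ (s.filter fun c => b < c).card * wset s := by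
  have h1 := eps_mul_wset b s
  rw [if_neg h] at h1
  have h2 : ∀ (k : ℕ) (y : PartWedge n), contrBasis b.succ ((-1) ^ k * y) =
      (-1) ^ k * contrBasis b.succ y := by
    intro k y
    rcases neg_one_pow_eq_or (PartWedge n) k with h | h <;> simp [h]
  have h3 : wset (insert b s) =
      (-1) ^ (s.filter fun c => b < c).card * (eps _ b.succ * wset s) := by
    rw [h1, ← mul_assoc, ← pow_add, Even.neg_one_pow ⟨_, rfl⟩, one_mul]
  rw [h3, h2, contrBasis_eps_mul, if_pos rfl, contrBasis_wset_of_notMem h, mul_zero, sub_zero]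

/-- Contracting from the largest index down always removes the leading factor, so no sign appears.
-/
theorem contrList_sort_wset {t s : Finset (Fin n)} (h : s ⊆ t) :
    contrList (t.sort (· ≥ ·)) (wset s) = if s = t then 1 else 0 := by
  induction t using Finset.induction_on_max generalizing s with
  | empty =>
    obtain rfl := Finset.subset_empty.1 h
    simp [contrList, wset_empty]
  | insert a t hat ih =>
    have hat' : a ∉ t := fun h => lt_irrefl _ (hat a h)
    rw [Finset.sort_insert _ (fun b hb => (hat b hb).le) hat', contrList]
    by_cases ha : a ∈ s
    · have h1 : s.erase a ⊆ t := by
        rw [← Finset.erase_insert hat']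
        exact Finset.erase_subset_erase _ h
      have h2 : ∀ b ∈ s.erase a, b < a := fun b hb => hat b (h1 hb)
      have h3 : contrBasis a.succ (wset s) = wset (s.erase a) := by
        conv_lhs => rw [← Finset.insert_erase ha, wset_insert_max h2]
        rw [contrBasis_eps_mul, if_pos rfl,
          contrBasis_wset_of_notMem (Finset.notMem_erase _ _), mul_zero, sub_zero]
      rw [h3, ih h1]
      have h4 : s.erase a = t ↔ s = insert a t := by
        constructor
        · rintro rfl; rw [Finset.insert_erase ha]
        · rintro rfl; rw [Finset.erase_insert hat']
      simp only [h4]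
    · rw [contrBasis_wset_of_notMem ha, contrList_zero, if_neg]
      rintro rfl
      exact ha (Finset.mem_insert_self _ _)

theorem contrList_neg_one_pow_mul (l : List (Fin n)) (k : ℕ) (y : PartWedge n) :
    contrList l ((-1) ^ k * y) = (-1) ^ k * contrList l y := by
  induction l generalizing y with
  | nil => rfl
  | cons a l ih =>
    rw [contrList, contrList, ← ih]
    rcases neg_one_pow_eq_or (PartWedge n) k with h | h <;> simp [h]

/-- The sign is left unspecified: it is only used where the surviving term pairs to zero. -/
theorem contrList_wset {l : List (Fin n)} (hl : l.Nodup) (s : Finset (Fin n)) :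
    contrList l (wset s) = 0 ∨
      l.toFinset ⊆ s ∧ ∃ k : ℕ, contrList l (wset s) = (-1) ^ k * wset (s \ l.toFinset) := by
  induction l generalizing s with
  | nil => exact Or.inr ⟨by simp, 0, by simp [contrList]⟩
  | cons a l ih =>
    rw [List.nodup_cons] at hl
    rw [contrList]
    by_cases ha : a ∈ s
    · have h1 := contrBasis_wset_insert (Finset.notMem_erase a s)
      rw [Finset.insert_erase ha] at h1
      rw [h1, contrList_neg_one_pow_mul]
      rcases ih hl.2 (s.erase a) with h2 | ⟨h2, k, h3⟩
      · left; rw [h2, mul_zero]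
      · right
        refine ⟨?_, ((s.erase a).filter fun c => a < c).card + k, ?_⟩
        · rw [List.toFinset_cons]
          exact Finset.insert_subset ha (h2.trans (Finset.erase_subset _ _))
        · rw [h3, ← mul_assoc, ← pow_add, List.toFinset_cons, Finset.erase_sdiff_comm,
            Finset.sdiff_insert]
    · left
      rw [contrBasis_wset_of_notMem ha, contrList_zero]

/-- The polynomial `Q̃_λ` in terms of the exterior algebra. -/
theorem qTilde_eq_qForm (lam : StrictPartition n) : qTilde lam = qForm n (wset lam) := by
  have hlen : (lam.sort (· ≥ ·)).length = lam.card := Finset.length_sort _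
  set k : Fin (2 * ((lam.card + 1) / 2)) → Fin (n + 1) :=
    fun i => ((lam.sort (· ≥ ·)).map Fin.succ).getD i 0 with hk
  have hpart : ∀ i : Fin (2 * ((lam.card + 1) / 2)), lam.part i = k i := by
    intro i
    have hf : ∀ l : List (Fin n), List.flatMap (fun a : Fin n => [(a : ℕ)]) l = l.map Fin.val := by
      intro l
      induction l with
      | nil => rfl
      | cons a l ih => simp [ih]
    rw [StrictPartition.part, hk]
    simp only [List.bind_eq_flatMap, List.pure_def, hf, List.map_map]
    rw [List.getD_eq_getElem?_getD, List.getD_eq_getElem?_getD, List.getElem?_map,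
      List.getElem?_map]
    cases (lam.sort (· ≥ ·))[(i : ℕ)]? <;> simp
  have hlt : ∀ i j, i < j → k j < k i := by
    intro i j hij
    have hi : (i : ℕ) < ((lam.sort (· ≥ ·)).map Fin.succ).length := by
      rw [List.length_map, hlen]
      have := j.isLt
      have : (i : ℕ) < j := hij
      omega
    have hs : ((lam.sort (· ≥ ·)).map Fin.succ).Pairwise (· > ·) := by
      rw [List.pairwise_map]
      exact (Finset.sortedGT_sort lam).pairwise.imp fun h => Fin.succ_lt_succ_iff.2 h
    simp only [hk]
    rw [List.getD_eq_getElem _ _ hi]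
    by_cases hj : (j : ℕ) < ((lam.sort (· ≥ ·)).map Fin.succ).length
    · rw [List.getD_eq_getElem _ _ hj]
      exact List.pairwise_iff_getElem.1 hs _ _ hi hj hij
    · rw [List.getD_eq_default _ _ (not_lt.1 hj), List.getElem_map]
      exact Fin.succ_pos _
  have h1 : qTilde lam = partPf n (wedge _ (List.ofFn k)) := by
    rw [qTilde, partPf]
    refine pfaffian_eq_pfForm _ _ k _ fun i j hij => ?_
    rw [Matrix.of_apply, hpart, hpart, partMat_of_lt (Fin.lt_def.1 (hlt i j hij))]
  rw [h1, qForm_apply]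
  -- By parity exactly one summand of `qForm` survives. For an odd number of parts the padding part
  -- `0` becomes the contraction by `e`, since `Q̃_{p,0} = e_p`.
  rcases Nat.even_or_odd' lam.card with ⟨m, hm | hm⟩
  · have h2 : List.ofFn k = (lam.sort (· ≥ ·)).map Fin.succ := by
      refine List.ext_getElem (by simp; omega) fun i hi hi' => ?_
      rw [List.getElem_ofFn]
      simp only [hk]
      rw [List.getD_eq_getElem _ _ hi']
    have h3 : partPf n (contr (eVec n) (wset lam)) = 0 := by
      rw [contr_eq_sum, map_sum]
      refine Finset.sum_eq_zero fun p _ => ?_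
      rw [LinearMap.map_smul]
      rcases Nat.eq_zero_or_pos m with rfl | hm0
      · obtain rfl := Finset.card_eq_zero.1 hm
        rw [wset_empty, contrBasis, contr_one, map_zero, smul_zero]
      · rw [partPf, pfForm_odd _ _ (contrBasis_mem (wset_mem lam) p), smul_zero]
        rw [Nat.odd_iff]; omega
    rw [h2, h3, add_zero]
    rfl
  · have h2 : List.ofFn k = (lam.sort (· ≥ ·)).map Fin.succ ++ [0] := by
      refine List.ext_getElem (by simp; omega) fun i hi hi' => ?_
      rw [List.getElem_ofFn]
      simp only [hk]
      rw [List.getElem_append]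
      split_ifs with h
      · rw [List.getD_eq_getElem _ _ h]
      · rw [List.getD_eq_default _ _ (not_lt.1 h)]
        simp
    have h3 : ∀ l : List (Fin (n + 1)), wedge (MvPolynomial (Fin n) ℤ) (l ++ [0]) =
        (-1) ^ l.length * (eps _ 0 * wedge _ l) := by
      intro l
      induction l with
      | nil => simp
      | cons p l ih =>
        rw [List.cons_append, wedge_cons, ih, wedge_cons, List.length_cons, pow_succ,
          eps_mul_comm 0 p, ← mul_assoc,
          ← ((Commute.neg_one_left (eps _ p)).pow_left l.length).eq]
        simp [mul_assoc]
    have h4 : partPf n (wset lam) = 0 := by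
      refine pfForm_odd _ ?_ (wset_mem lam)
      rw [hm]; exact odd_two_mul_add_one m
    have h5 : partPf n (eps _ 0 * wset lam) =
        partPf n (contr (fun q : Fin (n + 1) => partMat n (0 : Fin (n + 1)) q) (wset lam)) :=
      pfForm_eps_mul _ _ _
    have h6 : contr (fun q : Fin (n + 1) => partMat n (0 : Fin (n + 1)) q) (wset lam) =
        -contr (eVec n) (wset lam) := by
      rw [contr_eq_sum, contr_eq_sum, ← Finset.sum_neg_distrib]
      refine Finset.sum_congr rfl fun p _ => ?_
      by_cases hp : p = 0
      · rw [hp, contrBasis_zero_wset, smul_zero, smul_zero, neg_zero]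
      · rw [partMat_neg, partMat_of_lt (by
          rw [Fin.val_zero]; exact Nat.pos_of_ne_zero fun h => hp (Fin.ext h)), Fin.val_zero,
          qPair_zero, neg_smul]
        rfl
    have h7 : ((-1) ^ ((lam.sort (· ≥ ·)).map Fin.succ).length : PartWedge n) = -1 := by
      rw [List.length_map, hlen, hm]
      exact (odd_two_mul_add_one m).neg_one_pow
    rw [h2, h3, h7, h4, zero_add, neg_one_mul, map_neg]
    change -partPf n (eps _ 0 * wset lam) = _
    rw [h5, h6, map_neg, neg_neg]

end PartSets

/-! ### Grassmannian words acting on `Q̃` times staircases -/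

section Operators

variable {n : ℕ}

theorem sAct_neg_one_pow (i : Fin n) (k : ℕ) :
    sAct i ((-1) ^ k : MvPolynomial (Fin n) ℤ) = (-1) ^ k := by
  rw [map_pow, map_neg, map_one]

theorem tauW_neg_one_pow_mul (a : List (Fin n)) (k : ℕ) (f : MvPolynomial (Fin n) ℤ) :
    tauW a ((-1) ^ k * f) = (-1) ^ k * tauW a f :=
  tauW_mul_left (fun i _ => sAct_neg_one_pow i k) f

theorem neg_one_pow_mul_self (k : ℕ) (f : MvPolynomial (Fin n) ℤ) :
    (-1) ^ k * ((-1) ^ k * f) = f := by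
  rw [← mul_assoc, ← mul_pow]
  simp

/-- Pairing of the staircase monomial with the operators of Grassmannian elements. -/
theorem piOp_stair_mul_tauW_grassWord {l : List (Fin n)} (hl : l.Pairwise (· > ·))
    {F : MvPolynomial (Fin n) ℤ}
    (hdeg : ∀ j : Fin n, degreeOf j F + l.countP (· < j) ≤ j)
    (hinv : ∀ b ∈ l, ∀ i ≤ b, sAct i F = F) {r : ℕ} {x : PartWedge n}
    (hx : x ∈ wedgeSpan _ (n + 1) r) :
    piOp n (stair n n * tauW (grassWord l) (F * qForm n x)) =
      (-1) ^ (n * (n - 1) / 2) * (C (constantCoeff F) * qForm n (contrList l x)) := by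
  induction l generalizing F r x with
  | nil =>
    rw [grassWord, tauW_nil, Module.End.one_apply, contrList, ← mul_assoc,
      piOp_mul_right fun i hi => sAct_qForm hi hx, piOp_stair_mul fun j => by simpa using hdeg j,
      mul_assoc]
  | cons a l ih =>
    rw [List.pairwise_cons] at hl
    rw [grassWord, tauW_append, Module.End.mul_apply,
      tauW_mul_left fun i hi => hinv a (by simp) i (mem_descWordZero hi),
      tauW_descWordZero_qForm a hx, Finset.mul_sum, map_sum, Finset.mul_sum, map_sum]
    -- The coefficient of each contraction is absorbed into `F`. It has degree at most one in `x_j`,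
    -- and only for `a < j`, which is the room freed by removing `a` from the count.
    have key : ∀ p : Fin (n + 1), piOp n (stair n n * tauW (grassWord l)
        (F * (tailE n a p * qForm n (contrBasis p x)))) = (-1) ^ (n * (n - 1) / 2) *
          (C (constantCoeff (F * tailE n a p)) * qForm n (contrList l (contrBasis p x))) := by
      intro p
      rw [← mul_assoc]
      refine ih hl.2 ?_ ?_ (contrBasis_mem hx p)
      · intro j
        have h1 := hdeg j
        have h2 := degreeOf_mul_le j F (tailE n a p)
        have h3 := degreeOf_tailE_le (n := n) a p j
        rw [List.countP_cons] at h1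
        simp only [Fin.lt_def, decide_eq_true_eq] at h1 h3 ⊢
        split_ifs at h1 h3 <;> omega
      · intro b hb i hib
        rw [map_mul, hinv b (List.mem_cons_of_mem _ hb) i hib,
          sAct_tailE (Fin.le_def.1 (hib.trans (hl.1 b hb).le))]
    -- Only the coefficient equal to `1`, at `p = a + 1`, has a constant term.
    rw [Finset.sum_congr rfl fun p _ => key p, Finset.sum_eq_single a.succ]
    · rw [map_mul, constantCoeff_tailE, Fin.val_succ, if_pos rfl, mul_one, contrList]
    · intro p _ hp
      rw [map_mul, constantCoeff_tailE, if_neg fun h => hp (Fin.ext (by simpa using h)), mul_zero,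
        C_0, zero_mul, mul_zero]
    · simp

theorem pairwise_sort_gt (s : Finset (Fin n)) : (s.sort (· ≥ ·)).Pairwise (· > ·) :=
  (Finset.sortedGT_sort s).pairwise

theorem countP_le_of_pairwise {l : List (Fin n)} (hl : l.Pairwise (· > ·)) (j : Fin n) :
    l.countP (· < j) ≤ j := by
  rw [List.countP_eq_length_filter]
  have h1 : (l.filter (· < j)).Nodup := (hl.imp fun h => ne_of_gt h).filter _
  rw [← List.toFinset_card_of_nodup h1, ← Fin.card_Iio]
  refine Finset.card_le_card fun i hi => ?_
  simpa using (List.mem_filter.1 (List.mem_toFinset.1 hi)).2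

theorem piOp_stair_mul_tauW_qForm (s : Finset (Fin n)) {r : ℕ} {x : PartWedge n}
    (hx : x ∈ wedgeSpan _ (n + 1) r) :
    piOp n (stair n n * tauW (grassWord (s.sort (· ≥ ·))) (qForm n x)) =
      (-1) ^ (n * (n - 1) / 2) * qForm n (contrList (s.sort (· ≥ ·)) x) := by
  have h := piOp_stair_mul_tauW_grassWord (pairwise_sort_gt s) (F := 1) (fun j => by
    rw [degreeOf_one, zero_add]; exact countP_le_of_pairwise (pairwise_sort_gt s) j)
    (fun b _ i _ => map_one _) hx
  simpa using h

/-- The indices less than `m`. -/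
def lowSet (n m : ℕ) : Finset (Fin n) := Finset.univ.filter fun i => (i : ℕ) < m

/-- The `m` largest indices. -/
def topSet (n m : ℕ) : Finset (Fin n) := Finset.univ.filter fun i => n - m ≤ (i : ℕ)

theorem sort_lowSet_succ (a : Fin n) :
    (lowSet n (a + 1)).sort (· ≥ ·) = a :: (lowSet n a).sort (· ≥ ·) := by
  have h : lowSet n (a + 1) = insert a (lowSet n a) := by
    ext i
    simp only [lowSet, Finset.mem_filter, Finset.mem_univ, true_and, Finset.mem_insert,
      Fin.ext_iff]
    omega
  rw [h, Finset.sort_insert]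
  · intro b hb
    exact Fin.le_def.2 (Finset.mem_filter.1 hb).2.le
  · simp [lowSet]

theorem lowSet_self : lowSet n n = Finset.univ := by
  ext i; simp [lowSet]

theorem lowSet_zero : lowSet n 0 = ∅ := by
  ext i; simp [lowSet]

theorem topSet_self : topSet n n = Finset.univ := by
  ext i; simp [topSet]

theorem topSet_zero : topSet n 0 = ∅ := by
  ext i; simp [topSet]

theorem tauW_descWord_eq_zero {a : ℕ} (h : a + 1 < n) {f : MvPolynomial (Fin n) ℤ}
    (hf : sAct ⟨1, by omega⟩ f = f) : tauW (descWord (a + 1) h) f = 0 := by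
  induction a with
  | zero => simp [descWord, tau_of_sAct_eq hf]
  | succ a ih => rw [descWord, tauW_cons, Module.End.mul_apply, ih (by omega) hf, map_zero]

theorem tau_first_X_pow {z : Fin n} (hz : (z : ℕ) = 0) (k : ℕ) :
    tau z (X z ^ (k + 1)) = (if Even k then 1 else 0) * X z ^ k := by
  refine tau_eq_of ?_
  rw [dRoot_zero hz, map_pow, sAct_first_X hz, neg_pow, pow_succ]
  split_ifs with h
  · rw [pow_succ (-1) k, h.neg_one_pow]; ring
  · rw [pow_succ (-1) k, (Nat.not_even_iff_odd.1 h).neg_one_pow]; ring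

theorem tauW_descWordZero_stair (a : Fin n) {r : ℕ} {x : PartWedge n}
    (hx : x ∈ wedgeSpan _ (n + 1) r) :
    tauW (descWordZero a) (stair n (a + 1) * qForm n x) = stair n a *
      ∑ b : Fin n, esymmFrom n (a + 1) b * qForm n (contrBasis b.succ x) := by
  obtain ⟨a, ha⟩ := a
  set z : Fin n := ⟨0, by omega⟩ with hz
  have hz0 : (z : ℕ) = 0 := rfl
  let g : Fin n → ℕ := fun i => if (i : ℕ) = 0 then 0 else a - i
  have hst : stair n (a + 1) = X z ^ a * xpow g := by
    rw [stair, ← xpow_single, ← xpow_add]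
    congr 1
    funext i
    simp only [Pi.add_apply, Pi.single_apply, g, Fin.ext_iff, hz0]
    split_ifs <;> omega
  have hg : sAct z (xpow g) = xpow g := by
    rw [xpow, map_prod]
    refine Finset.prod_congr rfl fun i _ => ?_
    rw [map_pow, sAct_X_zero hz0]
    split_ifs with h
    · rw [h]
      simp [g, hz0]
    · rfl
  have hsz : sAct z (stair n (a + 1)) = (-1) ^ a * stair n (a + 1) := by
    rw [hst, map_mul, hg, map_pow, sAct_first_X hz0, neg_pow, mul_assoc]
  -- When `∂_0` hits the staircase, the exponents of the first two variables become equal. The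
  -- result is fixed by `s_1` and is killed by the next letter.
  have hz' : tauW (descWord a ha) (tau z (stair n (a + 1))) = 0 := by
    rw [hst, tau_mul_right hg]
    cases a with
    | zero => rw [pow_zero, tau_one, zero_mul, map_zero]
    | succ a =>
      rw [tau_first_X_pow hz0, mul_assoc]
      refine tauW_descWord_eq_zero ha ?_
      have h1 : X z ^ a * xpow g = xpow (Pi.single z a + g) := by rw [xpow_add, xpow_single]
      rw [h1, map_mul, sAct_xpow one_ne_zero]
      · split_ifs <;> simp
      · simp [Pi.single_apply, g, Fin.ext_iff, hz0]
  rw [descWordZero, tauW_append, Module.End.mul_apply, tauW_cons, tauW_nil, mul_one,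
    tau_mul, map_add, tauW_mul_right fun i hi => sAct_qForm (mem_descWord hi).1 hx, hz',
    zero_mul, zero_add, tau_first_qForm hz0 hx, hsz, contr_eq_sum, map_sum, Finset.mul_sum,
    map_sum, Fin.sum_univ_succ, LinearMap.map_smul]
  have h0 : shiftE n 0 = 0 := rfl
  simp only [Fin.val_zero, h0, zero_smul, mul_zero, map_zero, zero_add]
  rw [Finset.mul_sum]
  refine Finset.sum_congr rfl fun b _ => ?_
  have hs : shiftE n (b.succ : ℕ) = esymmFrom n 1 b := rfl
  rw [LinearMap.map_smul, smul_eq_mul, hs, ← mul_assoc,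
    tauW_mul_right fun i hi => sAct_qForm (mem_descWord hi).1 (contrBasis_mem hx _), mul_assoc,
    tauW_neg_one_pow_mul, tauW_descWord, neg_one_pow_mul_self]
  ring

theorem card_topSet {m : ℕ} (h : m ≤ n) : (topSet n m).card = m := by
  have h1 : (topSet n m).map Fin.valEmbedding = Finset.Ico (n - m) n := by
    ext x
    simp only [topSet, Finset.mem_map, Finset.mem_filter, Finset.mem_univ, true_and,
      Finset.mem_Ico, Fin.valEmbedding_apply]
    constructor
    · rintro ⟨j, hj, rfl⟩
      exact ⟨hj, j.isLt⟩
    · rintro ⟨h1, h2⟩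
      exact ⟨⟨x, h2⟩, h1, rfl⟩
  rw [← Finset.card_map Fin.valEmbedding, h1, Nat.card_Ico]
  omega

theorem tauW_grassWord_stair {m : ℕ} (hm : m ≤ n) :
    tauW (grassWord ((lowSet n m).sort (· ≥ ·))) (stair n m * qForm n (wset (topSet n m))) =
      (-1) ^ (m * (m - 1) / 2) * ∏ j ∈ Finset.range m, esymmFrom n (j + 1) (n - (j + 1)) := by
  rw [← Finset.sum_range_id]
  induction m with
  | zero => simp [lowSet_zero, topSet_zero, wset_empty, qForm_one, grassWord, stair, xpow]
  | succ m ih =>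
    set a : Fin n := ⟨m, hm⟩ with ha
    have h1 := sort_lowSet_succ a
    simp only [ha] at h1
    set b : Fin n := ⟨n - (m + 1), by omega⟩ with hb
    have hbn : b ∉ topSet n m := by
      simp only [topSet, Finset.mem_filter, hb]; omega
    have h2 : topSet n (m + 1) = insert b (topSet n m) := by
      ext i
      simp only [topSet, Finset.mem_filter, Finset.mem_univ, true_and, Finset.mem_insert,
        Fin.ext_iff, hb]
      omega
    have h3 : ((topSet n m).filter fun c => b < c) = topSet n m := by
      refine Finset.filter_true_of_mem fun c hc => ?_
      have := (Finset.mem_filter.1 hc).2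
      rw [Fin.lt_def]
      simp only [hb]; omega
    have h4 : stair n (m + 1) = stair n (a + 1) := rfl
    rw [h1, grassWord, tauW_append, Module.End.mul_apply, h4, tauW_descWordZero_stair a (wset_mem _),
      -- A larger index in the set needs an elementary polynomial of degree above the number of
      -- variables, and an index outside the set contracts to zero; only the smallest element `b`
      -- remains.
      Finset.sum_eq_single b]
    · rw [h2, contrBasis_wset_insert hbn, h3, card_topSet (by omega)]
      have h5 : qForm n ((-1) ^ m * wset (topSet n m)) = (-1) ^ m * qForm n (wset (topSet n m)) := by
        rcases neg_one_pow_eq_or (PartWedge n) m with h | h <;>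
          rcases Nat.even_or_odd m with h' | h' <;> simp [h'.neg_one_pow]
      have h6 : stair n a * (esymmFrom n (a + 1) b * qForm n ((-1) ^ m * wset (topSet n m))) =
          (-1) ^ m * (esymmFrom n (m + 1) (n - (m + 1)) *
            (stair n m * qForm n (wset (topSet n m)))) := by
        rw [h5]
        simp only [ha, hb]
        ring
      rw [h6, tauW_neg_one_pow_mul, tauW_mul_left, ih (by omega), Finset.sum_range_succ,
        Finset.prod_range_succ, pow_add]
      · ring
      · intro i hi
        refine sAct_esymmFrom ?_ _
        have : ∀ (l : List (Fin n)), (∀ c ∈ l, (c : ℕ) < m) → ∀ i ∈ grassWord l, (i : ℕ) < m := by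
          intro l hl i hi
          induction l with
          | nil => simp [grassWord] at hi
          | cons c l ih =>
            rw [grassWord, List.mem_append] at hi
            rcases hi with hi | hi
            · exact ih (fun c hc => hl c (List.mem_cons_of_mem _ hc)) hi
            · exact (Fin.le_def.1 (mem_descWordZero hi)).trans_lt (hl c (by simp))
        have := this _ (fun c hc => by
          rw [Finset.mem_sort] at hc
          exact (Finset.mem_filter.1 hc).2) i hi
        omega
    · intro c _ hc
      by_cases hcm : c ∈ topSet n (m + 1)
      · have := (Finset.mem_filter.1 hcm).2
        rw [esymmFrom_eq_zero, zero_mul]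
        have : (c : ℕ) ≠ n - (m + 1) := fun h => hc (Fin.ext h)
        simp only [ha]
        omega
      · rw [contrBasis_wset_of_notMem hcm, map_zero, mul_zero]
    · simp

end Operators

/-! ### Reduced words for `ϖ_0 w_0` and `w_0`, and the top operator -/

section GrassWords

variable {n : ℕ}

theorem sign_of_mem_perm {a : List (Fin n)} (ha : ∀ i ∈ a, (i : ℕ) ≠ 0) (j : Fin n) :
    (wordProd a).sign j = 1 := by rw [wordProd_mem_perm ha, ofPerm_sign]

theorem perm_descWordZero (a j : Fin n) : ((wordProd (descWordZero a)).perm j : ℕ) =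
    if (j : ℕ) = 0 then (a : ℕ) else if j ≤ a then (j : ℕ) - 1 else j := by
  rw [descWordZero, wordProd_append, wordProd_cons, wordProd_nil, mul_one, perm_mul,
    simpleRefl_zero rfl, ofSign_perm, mul_one, perm_descWord]
  rfl

theorem sign_descWordZero (a j : Fin n) : (wordProd (descWordZero a)).sign j =
    if (j : ℕ) = 0 then -1 else 1 := by
  rw [descWordZero, wordProd_append, wordProd_cons, wordProd_nil, mul_one, sign_mul,
    simpleRefl_zero rfl, sign_of_mem_perm fun i hi => (mem_descWord hi).1, mul_one, ofSign_sign,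
    Pi.mulSingle_apply]
  simp only [Fin.ext_iff]

theorem wordProd_grassWord_cons (a : Fin n) (l : List (Fin n)) :
    wordProd (grassWord (a :: l)) = wordProd (grassWord l) * wordProd (descWordZero a) := by
  rw [grassWord, wordProd_append]

theorem perm_grassWord_lowSet {m : ℕ} (h : m ≤ n) (j : Fin n) :
    ((wordProd (grassWord ((lowSet n m).sort (· ≥ ·)))).perm j : ℕ) =
      if (j : ℕ) < m then m - 1 - j else j := by
  induction m generalizing j with
  | zero => simp [lowSet_zero, grassWord]
  | succ m ih =>
    have h1 := sort_lowSet_succ (⟨m, h⟩ : Fin n)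
    dsimp only at h1
    rw [h1, wordProd_grassWord_cons, perm_mul, Equiv.Perm.mul_apply, ih (by omega),
      perm_descWordZero]
    simp only [Fin.le_def]
    split_ifs <;> omega

theorem sign_grassWord_lowSet {m : ℕ} (h : m ≤ n) (j : Fin n) :
    (wordProd (grassWord ((lowSet n m).sort (· ≥ ·)))).sign j =
      if (j : ℕ) < m then -1 else 1 := by
  induction m generalizing j with
  | zero => simp [lowSet_zero, grassWord]
  | succ m ih =>
    have h1 := sort_lowSet_succ (⟨m, h⟩ : Fin n)
    dsimp only at h1
    have h2 := perm_descWordZero (⟨m, h⟩ : Fin n) j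
    rw [h1, wordProd_grassWord_cons, sign_mul, ih (by omega), sign_descWordZero, h2]
    simp only [Fin.le_def]
    split_ifs <;> first | omega | simp

/-- The word `0, 1 0, 2 1 0, …`. -/
def bigWord (n : ℕ) : List (Fin n) := grassWord ((Finset.univ : Finset (Fin n)).sort (· ≥ ·))

theorem wordProd_bigWord : wordProd (bigWord n) = ofPerm Fin.revPerm * w0 n := by
  rw [bigWord, ← lowSet_self]
  refine SignedPerm.ext ?_ ?_
  · ext j
    rw [perm_grassWord_lowSet le_rfl, if_pos j.isLt, w0, perm_mul, ofSign_perm, mul_one,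
      ofPerm_perm, Fin.revPerm_apply, Fin.val_rev]
    omega
  · funext j
    rw [sign_grassWord_lowSet le_rfl, if_pos j.isLt, w0, sign_mul, ofSign_sign, ofPerm_sign,
      mul_one]

theorem w0_mul (w : SignedPerm n) : w0 n * w = w * w0 n := by
  refine SignedPerm.ext ?_ ?_
  · simp [w0]
  · funext i
    simp [w0, mul_comm]

theorem w0_mul_self : w0 n * w0 n = 1 := by
  refine SignedPerm.ext ?_ ?_
  · simp [w0]
  · funext i
    simp [w0]

theorem ofPerm_rev_mul_self : (ofPerm Fin.revPerm * ofPerm Fin.revPerm : SignedPerm n) = 1 := by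
  rw [← map_mul, revPerm_mul_self, map_one]

theorem tauW_bigWord_stair : tauW (bigWord n) (stair n n * qForm n (wset Finset.univ)) =
    (-1) ^ (n * (n - 1) / 2) * stairRev n := by
  have h := tauW_grassWord_stair (le_refl n)
  rwa [lowSet_self, topSet_self, prod_esymmFrom_top] at h

/-- The word does not kill the staircase times `Q̃` of the full set: `ϖ_0 w_0` carries it to the
opposite staircase up to sign, and `ϖ_0` carries that to `1`. -/
theorem isReducedWord_long_big : IsReducedWord (longWord n le_rfl ++ bigWord n) (w0 n) := by
  have h : wordProd (longWord n le_rfl ++ bigWord n) = w0 n := by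
    rw [wordProd_append, wordProd_longWord, wordProd_bigWord, ← mul_assoc, ofPerm_rev_mul_self,
      one_mul]
  rw [← h]
  refine isReducedWord_of_tauW_ne_zero (f := stair n n * qForm n (wset Finset.univ)) ?_
  rw [tauW_append, Module.End.mul_apply, tauW_bigWord_stair, tauW_neg_one_pow_mul, ← piOp,
    piOp_stairRev, mul_one]
  exact pow_ne_zero _ (by simp)

theorem isReducedWord_big_long : IsReducedWord (bigWord n ++ longWord n le_rfl) (w0 n) := by
  refine ⟨?_, ?_⟩
  · rw [wordProd_append, wordProd_longWord, wordProd_bigWord, ← w0_mul, mul_assoc,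
      ofPerm_rev_mul_self, mul_one]
  · rw [← isReducedWord_long_big.2, List.length_append, List.length_append, add_comm]

theorem isReducedWord_bigWord : IsReducedWord (bigWord n) (ofPerm Fin.revPerm * w0 n) := by
  refine ⟨wordProd_bigWord, le_antisymm ?_ ?_⟩
  · have h1 := length_mul_le (ofPerm Fin.revPerm) (ofPerm Fin.revPerm * w0 n)
    rw [← mul_assoc, ofPerm_rev_mul_self, one_mul, ← isReducedWord_long_big.2, List.length_append,
      isReducedWord_longWord.2] at h1
    omega
  · rw [← wordProd_bigWord]
    exact length_le _

/-- The operator `∂'_{ϖ_0 w_0}`. -/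
noncomputable def topOp (n : ℕ) : Module.End ℤ (MvPolynomial (Fin n) ℤ) := tauW (bigWord n)

theorem scalarProd_eq_topOp (f g : MvPolynomial (Fin n) ℤ) :
    scalarProd f g = topOp n (piOp n (f * g)) := by
  rw [scalarProd_eq isReducedWord_big_long, tauW_append]; rfl

theorem bigWord_eq_cons {i : Fin n} (hi : (i : ℕ) = 0) : ∃ l, bigWord n = i :: l := by
  have key : ∀ m ≤ n, 0 < m → ∃ l, grassWord ((lowSet n m).sort (· ≥ ·)) = i :: l := by
    intro m hm h0
    induction m with
    | zero => omega
    | succ m ih =>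
      have e := sort_lowSet_succ (⟨m, hm⟩ : Fin n)
      dsimp only at e
      rw [e, grassWord]
      rcases Nat.eq_zero_or_pos m with rfl | hm0
      · refine ⟨[], ?_⟩
        rw [lowSet_zero, Finset.sort_empty, grassWord, descWordZero]
        simp [descWord, Fin.ext_iff, hi]
      · obtain ⟨l, hl⟩ := ih (by omega) hm0
        exact ⟨l ++ descWordZero ⟨m, hm⟩, by rw [hl]; rfl⟩
  have := key n le_rfl i.pos
  rwa [lowSet_self] at this

theorem length_simpleRefl_mul_w0 (i : Fin n) :
    (simpleRefl i * w0 n).length ≤ (w0 n).length := by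
  by_cases hi : (i : ℕ) = 0
  · obtain ⟨l, hl⟩ := bigWord_eq_cons hi
    have h1 := isReducedWord_big_long (n := n)
    have h2 := length_le (l ++ longWord n le_rfl)
    rw [hl] at h1
    have h3 : wordProd (l ++ longWord n le_rfl) = simpleRefl i * w0 n := by
      rw [← h1.1, List.cons_append, wordProd_cons, ← mul_assoc, simpleRefl_mul_self, one_mul]
    rw [h3] at h2
    rw [← h1.2, List.cons_append, List.length_cons]
    omega
  · have h1 := length_mul_revPerm (Equiv.swap (prev i) i)
    have h2 := length_mul_le (simpleRefl i * ofPerm Fin.revPerm) (ofPerm Fin.revPerm * w0 n)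
    rw [mul_assoc, ← mul_assoc (ofPerm Fin.revPerm), ofPerm_rev_mul_self, one_mul,
      simpleRefl_pos hi, ← map_mul, ← isReducedWord_bigWord.2] at h2
    rw [simpleRefl_pos hi, ← isReducedWord_long_big.2, List.length_append, length_longWord]
    omega

theorem tau_topOp_piOp (i : Fin n) (f : MvPolynomial (Fin n) ℤ) :
    tau i (topOp n (piOp n f)) = 0 := by
  have h : tauW (i :: (bigWord n ++ longWord n le_rfl)) = 0 := by
    refine tauW_eq_zero ?_
    rw [wordProd_cons, isReducedWord_big_long.1, List.length_cons, isReducedWord_big_long.2]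
    have := length_simpleRefl_mul_w0 i
    omega
  rw [tauW_cons, tauW_append] at h
  exact LinearMap.congr_fun h f

theorem topOp_piOp_mul_tau (i : Fin n) : (topOp n * piOp n) * tau i = 0 := by
  have h : tauW ((bigWord n ++ longWord n le_rfl) ++ [i]) = 0 := by
    refine tauW_eq_zero ?_
    rw [wordProd_append, isReducedWord_big_long.1, wordProd_cons, wordProd_nil, mul_one,
      List.length_append, isReducedWord_big_long.2, w0_mul, List.length_singleton]
    have := length_simpleRefl_mul_w0 i
    omega
  rw [tauW_append, tauW_append] at h
  simpa [piOp, topOp] using h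

theorem sAct_topOp_piOp (i : Fin n) (f : MvPolynomial (Fin n) ℤ) :
    sAct i (topOp n (piOp n f)) = topOp n (piOp n f) := sAct_eq_of_tau (tau_topOp_piOp i f)

theorem piOp_stair_mul_of_sAct {f : MvPolynomial (Fin n) ℤ}
    (h : ∀ i : Fin n, (i : ℕ) ≠ 0 → sAct i f = f) :
    piOp n (stair n n * f) = (-1) ^ (n * (n - 1) / 2) * f := by
  rw [piOp_mul_right h, piOp_stair]

theorem topOp_neg_one_pow_mul (k : ℕ) (f : MvPolynomial (Fin n) ℤ) :
    topOp n ((-1) ^ k * f) = (-1) ^ k * topOp n f := tauW_neg_one_pow_mul _ _ _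

theorem piOp_neg_one_pow_mul (k : ℕ) (f : MvPolynomial (Fin n) ℤ) :
    piOp n ((-1) ^ k * f) = (-1) ^ k * piOp n f := tauW_neg_one_pow_mul _ _ _

/-- An `S_n`-invariant polynomial is, up to sign, the image under `π` of the staircase times itself,
so `T f` lies in the image of `∂'_{w_0}`. -/
theorem sAct_topOp {f : MvPolynomial (Fin n) ℤ}
    (h : ∀ i : Fin n, (i : ℕ) ≠ 0 → sAct i f = f) (i : Fin n) :
    sAct i (topOp n f) = topOp n f := by
  have h1 := sAct_topOp_piOp i (stair n n * f)
  rw [piOp_stair_mul_of_sAct h, topOp_neg_one_pow_mul, map_mul, sAct_neg_one_pow] at h1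
  exact mul_left_cancel₀ (pow_ne_zero _ (by simp)) h1

/-- `T` of an invariant polynomial is itself invariant, so inserting the staircase and `π` changes
it only by a sign; the pairing with Grassmannian words then applies to the full set. -/
theorem topOp_qForm {r : ℕ} {x : PartWedge n} (hx : x ∈ wedgeSpan _ (n + 1) r) :
    topOp n (qForm n x) =
      qForm n (contrList ((Finset.univ : Finset (Fin n)).sort (· ≥ ·)) x) := by
  have h1 := piOp_stair_mul_tauW_qForm Finset.univ hx
  have h2 := piOp_stair_mul_of_sAct fun i _ =>
    sAct_topOp (f := qForm n x) (fun i hi => sAct_qForm hi hx) i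
  exact mul_left_cancel₀ (pow_ne_zero _ (by simp)) (h2.symm.trans h1)

theorem topOp_qForm_wset (s : Finset (Fin n)) :
    topOp n (qForm n (wset s)) = if s = Finset.univ then 1 else 0 := by
  rw [topOp_qForm (wset_mem s), contrList_sort_wset (Finset.subset_univ s)]
  split_ifs
  · exact qForm_one
  · exact map_zero _

theorem qForm_wset_empty : qForm n (wset (∅ : Finset (Fin n))) = 1 := by
  rw [wset_empty, qForm_one]

/-- Reducedness again by nonvanishing: if the operator killed the staircase times `Q̃_s`, the
pairing formula would equate a sign with zero. -/
theorem isReducedWord_grass_long (s : Finset (Fin n)) :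
    IsReducedWord (grassWord (s.sort (· ≥ ·)) ++ longWord n le_rfl)
      (wordProd (grassWord (s.sort (· ≥ ·))) * ofPerm Fin.revPerm) := by
  have h : wordProd (grassWord (s.sort (· ≥ ·)) ++ longWord n le_rfl) =
      wordProd (grassWord (s.sort (· ≥ ·))) * ofPerm Fin.revPerm := by
    rw [wordProd_append, wordProd_longWord]
  rw [← h]
  refine isReducedWord_of_tauW_ne_zero (f := stair n n * qForm n (wset s)) fun h0 => ?_
  rw [tauW_append, Module.End.mul_apply, ← piOp,
    piOp_stair_mul_of_sAct fun i hi => sAct_qForm hi (wset_mem s), tauW_neg_one_pow_mul,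
    mul_eq_zero, or_iff_right (pow_ne_zero _ (by simp))] at h0
  have h1 := piOp_stair_mul_tauW_qForm s (wset_mem s)
  rw [h0, mul_zero, map_zero, contrList_sort_wset subset_rfl, if_pos rfl, qForm_one, mul_one] at h1
  exact pow_ne_zero _ (by simp) h1.symm

end GrassWords

/-! ### One-line notation of the Grassmannian words -/

section MaxGrass

variable {n : ℕ}

theorem perm_grassWord_of_lt {l : List (Fin n)} {j : Fin n} (h : ∀ a ∈ l, a < j) :
    (wordProd (grassWord l)).perm j = j := by
  induction l with
  | nil => simp [grassWord]
  | cons a l ih =>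
    have h1 : (wordProd (descWordZero a)).perm j = j := by
      ext
      have h2 := Fin.lt_def.1 (h a (by simp))
      rw [perm_descWordZero, if_neg (by omega), if_neg (by rw [Fin.le_def]; omega)]
    rw [wordProd_grassWord_cons, perm_mul, Equiv.Perm.mul_apply, h1,
      ih fun b hb => h b (List.mem_cons_of_mem _ hb)]

/-- The one-line notation of the element of a Grassmannian word. -/
structure IsGrassShape (w : SignedPerm n) (s : Finset (Fin n)) : Prop where
  sign_eq : ∀ j : Fin n, w.sign j = if (j : ℕ) < s.card then -1 else 1
  mem_iff : ∀ j : Fin n, w.perm j ∈ s ↔ (j : ℕ) < s.card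
  anti : ∀ i j : Fin n, i < j → (j : ℕ) < s.card → w.perm j < w.perm i
  mono : ∀ i j : Fin n, i < j → s.card ≤ (i : ℕ) → w.perm i < w.perm j

/-- Induction on the largest element `a`: right multiplication by `s_a ⋯ s_1 s_0` brings the entry
`a`, still fixed so far, to the front with a bar and shifts the preceding entries by one place. -/
theorem isGrassShape_wordProd (s : Finset (Fin n)) :
    IsGrassShape (wordProd (grassWord (s.sort (· ≥ ·)))) s := by
  induction s using Finset.induction_on_max with
  | empty =>
    rw [Finset.sort_empty, grassWord, wordProd_nil]
    exact ⟨by simp, by simp, by simp, by simp⟩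
  | insert a s hs ih =>
    have has : a ∉ s := fun h => lt_irrefl _ (hs a h)
    have hcard : s.card ≤ a := by
      rw [← Fin.card_Iio]
      exact Finset.card_le_card fun b hb => Finset.mem_Iio.2 (hs b hb)
    rw [Finset.sort_insert _ (fun b hb => (hs b hb).le) has, wordProd_grassWord_cons]
    set v := wordProd (grassWord (s.sort (· ≥ ·))) with hv
    set c := (wordProd (descWordZero a)) with hc
    have hva : v.perm a = a := perm_grassWord_of_lt fun b hb => hs b (by simpa using hb)
    have hcp : ∀ j : Fin n, (c.perm j : ℕ) =
        if (j : ℕ) = 0 then (a : ℕ) else if (j : ℕ) ≤ a then (j : ℕ) - 1 else j := by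
      intro j
      rw [hc, perm_descWordZero]
      rfl
    have hc0 : ∀ j : Fin n, (j : ℕ) = 0 → v.perm (c.perm j) = a := by
      intro j hj
      have : c.perm j = a := Fin.ext (by rw [hcp, if_pos hj])
      rw [this, hva]
    have hlt : ∀ j : Fin n, (j : ℕ) ≠ 0 → ((c.perm j : ℕ) < s.card ↔ (j : ℕ) < s.card + 1) := by
      intro j hj
      rw [hcp, if_neg hj]
      split_ifs <;> omega
    have hsm : ∀ i j : Fin n, i < j → (i : ℕ) ≠ 0 → c.perm i < c.perm j := by
      intro i j hij hi
      rw [Fin.lt_def] at hij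
      rw [Fin.lt_def, hcp, hcp]
      split_ifs <;> omega
    have hne : ∀ j : Fin n, (j : ℕ) ≠ 0 → c.perm j ≠ a := by
      intro j hj h
      have h1 := congrArg Fin.val h
      rw [hcp, if_neg hj] at h1
      split_ifs at h1 <;> omega
    refine ⟨?_, ?_, ?_, ?_⟩
    · intro j
      rw [sign_mul, ih.sign_eq, Finset.card_insert_of_notMem has, hc, sign_descWordZero, ← hc]
      by_cases hj : (j : ℕ) = 0
      · have h1 := hcp j
        rw [if_pos hj] at h1
        rw [if_pos hj, if_neg (by omega), if_pos (by omega), mul_one]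
      · rw [if_neg hj, one_mul]
        simp only [hlt j hj]
    · intro j
      rw [perm_mul, Equiv.Perm.mul_apply, Finset.card_insert_of_notMem has]
      by_cases hj : (j : ℕ) = 0
      · rw [hc0 j hj]
        simp [hj]
      · rw [Finset.mem_insert, ih.mem_iff, hlt j hj, or_iff_right]
        intro h
        exact hne j hj (v.perm.injective (h.trans hva.symm))
    · intro i j hij hj
      rw [Finset.card_insert_of_notMem has] at hj
      have hj0 : (j : ℕ) ≠ 0 := by rw [Fin.lt_def] at hij; omega
      rw [perm_mul, Equiv.Perm.mul_apply, Equiv.Perm.mul_apply]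
      by_cases hi : (i : ℕ) = 0
      · rw [hc0 i hi]
        exact hs _ ((ih.mem_iff _).2 ((hlt j hj0).2 hj))
      · exact ih.anti _ _ (hsm i j hij hi) ((hlt j hj0).2 hj)
    · intro i j hij hi
      rw [Finset.card_insert_of_notMem has] at hi
      rw [perm_mul, Equiv.Perm.mul_apply, Equiv.Perm.mul_apply]
      have hi0 : (i : ℕ) ≠ 0 := by omega
      refine ih.mono _ _ (hsm i j hij hi0) ?_
      have := (hlt i hi0).not
      omega

theorem sort_eq_of_pairwise_gt {l : List (Fin n)} {s : Finset (Fin n)} (h : l.Pairwise (· > ·))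
    (hm : ∀ x, x ∈ l ↔ x ∈ s) : l = s.sort (· ≥ ·) := by
  refine List.Perm.eq_of_pairwise' (h.imp fun h => le_of_lt h) (Finset.pairwise_sort s (· ≥ ·)) ?_
  refine List.perm_of_nodup_nodup_toFinset_eq (h.imp fun h => ne_of_gt h) (Finset.sort_nodup _ _) ?_
  ext x
  simp [hm]

theorem sort_eq_of_pairwise_lt {l : List (Fin n)} {s : Finset (Fin n)} (h : l.Pairwise (· < ·))
    (hm : ∀ x, x ∈ l ↔ x ∈ s) : l = s.sort (· ≤ ·) := by
  refine List.Perm.eq_of_pairwise' (h.imp fun h => le_of_lt h) (Finset.pairwise_sort s (· ≤ ·)) ?_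
  refine List.perm_of_nodup_nodup_toFinset_eq (h.imp fun h => ne_of_lt h) (Finset.sort_nodup _ _) ?_
  ext x
  simp [hm]

theorem maxGrass_perm_apply (s : StrictPartition n) (j : Fin n) :
    s.maxGrass.perm j = s.wordList.get (Fin.cast s.wordList_length.symm j) := rfl

theorem IsGrassShape.eq_maxGrass {w : SignedPerm n} {s : Finset (Fin n)} (h : IsGrassShape w s) :
    w = StrictPartition.maxGrass s := by
  have hcn : s.card ≤ n := by simpa using Finset.card_le_univ s
  have hL : List.ofFn w.perm = StrictPartition.wordList s := by
    rw [← List.take_append_drop s.card (List.ofFn w.perm), StrictPartition.wordList]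
    congr 1
    · refine sort_eq_of_pairwise_gt ?_ ?_
      · rw [List.pairwise_iff_getElem]
        intro i j hi hj hij
        simp only [List.getElem_take, List.getElem_ofFn]
        rw [List.length_take] at hj
        exact h.anti _ _ (Fin.lt_def.2 hij) (by simp only; omega)
      · intro x
        rw [List.mem_take_iff_getElem]
        constructor
        · rintro ⟨i, hi, rfl⟩
          rw [List.getElem_ofFn, h.mem_iff]
          simp only; omega
        · intro hx
          have h1 := h.mem_iff (w.perm.symm x)
          rw [Equiv.apply_symm_apply] at h1
          refine ⟨w.perm.symm x, ?_, ?_⟩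
          · rw [List.length_ofFn]
            exact lt_min (h1.1 hx) (Fin.isLt _)
          · rw [List.getElem_ofFn]
            simp
    · refine sort_eq_of_pairwise_lt ?_ ?_
      · rw [List.pairwise_iff_getElem]
        intro i j hi hj hij
        simp only [List.getElem_drop, List.getElem_ofFn]
        exact h.mono _ _ (Fin.lt_def.2 (by simp only; omega)) (by simp only; omega)
      · intro x
        rw [List.mem_drop_iff_getElem, Finset.mem_compl]
        constructor
        · rintro ⟨i, hi, rfl⟩
          rw [List.getElem_ofFn, h.mem_iff]
          simp only; omega
        · intro hx
          have h1 := h.mem_iff (w.perm.symm x)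
          rw [Equiv.apply_symm_apply] at h1
          have h2 : s.card ≤ (w.perm.symm x : ℕ) := not_lt.1 fun h => hx (h1.2 h)
          refine ⟨(w.perm.symm x : ℕ) - s.card, ?_, ?_⟩
          · rw [List.length_ofFn]
            have := (w.perm.symm x).isLt
            omega
          · rw [List.getElem_ofFn]
            simp [Nat.add_sub_cancel' h2]
  refine SignedPerm.ext ?_ ?_
  · ext1 j
    rw [maxGrass_perm_apply, List.get_eq_getElem]
    simp only [← hL, List.getElem_ofFn]
    rfl
  · funext j
    rw [h.sign_eq]
    rfl

theorem maxGrass_eq (s : StrictPartition n) :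
    s.maxGrass = wordProd (grassWord (s.sort (· ≥ ·))) :=
  (isGrassShape_wordProd s).eq_maxGrass.symm

theorem isGrassShape_maxGrass (s : StrictPartition n) : IsGrassShape s.maxGrass s := by
  rw [maxGrass_eq]
  exact isGrassShape_wordProd s

/-- Negating all entries and reading backwards exchanges the barred decreasing block with the
unbarred increasing one. -/
theorem w0_mul_maxGrass (s : StrictPartition n) :
    w0 n * StrictPartition.maxGrass s * ofPerm Fin.revPerm = StrictPartition.maxGrass sᶜ := by
  have h := isGrassShape_maxGrass s
  have hc : (sᶜ).card = n - s.card := by rw [Finset.card_compl, Fintype.card_fin]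
  have hcn : s.card ≤ n := by simpa using Finset.card_le_univ s
  refine IsGrassShape.eq_maxGrass ⟨?_, ?_, ?_, ?_⟩
  · intro j
    simp only [sign_mul, ofPerm_sign, ofPerm_perm, Fin.revPerm_apply, h.sign_eq, w0, ofSign_sign,
      one_mul, hc, Fin.val_rev]
    have := j.isLt
    split_ifs <;> first | omega | simp
  · intro j
    simp only [perm_mul, w0, ofSign_perm, one_mul, ofPerm_perm, Equiv.Perm.mul_apply,
      Fin.revPerm_apply, Finset.mem_compl, h.mem_iff, hc, Fin.val_rev]
    have := j.isLt
    omega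
  · intro i j hij hj
    simp only [perm_mul, w0, ofSign_perm, one_mul, ofPerm_perm, Equiv.Perm.mul_apply,
      Fin.revPerm_apply]
    refine h.mono _ _ (Fin.rev_lt_rev.2 hij) ?_
    rw [Fin.val_rev]
    omega
  · intro i j hij hi
    simp only [perm_mul, w0, ofSign_perm, one_mul, ofPerm_perm, Equiv.Perm.mul_apply,
      Fin.revPerm_apply]
    refine h.anti _ _ (Fin.rev_lt_rev.2 hij) ?_
    rw [Fin.val_rev]
    have := i.isLt
    omega

end MaxGrass

/-! ### Skew-symmetry of `Q̃_{i,j}` for odd `i + j` -/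

section QPairSymmetry

variable {n : ℕ}

theorem qPair_add_qPair (i j : ℕ) : qPair n i (j + 1) + qPair n (i + 1) j =
    esymm (Fin n) ℤ i * esymm (Fin n) ℤ (j + 1) - esymm (Fin n) ℤ (i + 1) * esymm (Fin n) ℤ j := by
  have h : ∑ k ∈ Finset.Icc 1 (j + 1), (-1) ^ k * esymm (Fin n) ℤ (i + k) *
      esymm (Fin n) ℤ (j + 1 - k) = -(esymm (Fin n) ℤ (i + 1) * esymm (Fin n) ℤ j) -
      ∑ k ∈ Finset.Icc 1 j, (-1) ^ k * esymm (Fin n) ℤ (i + 1 + k) * esymm (Fin n) ℤ (j - k) := by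
    have e : ∀ (m : ℕ) (F : ℕ → MvPolynomial (Fin n) ℤ),
        ∑ k ∈ Finset.Icc 1 m, F k = ∑ k ∈ Finset.range m, F (k + 1) := by
      intro m F
      rw [Finset.range_eq_Ico, Finset.sum_Ico_add' F 0 m 1]
      rfl
    rw [e, Finset.sum_range_succ', e]
    have h1 : ∀ k, (-1 : MvPolynomial (Fin n) ℤ) ^ (k + 1 + 1) * esymm (Fin n) ℤ (i + (k + 1 + 1)) *
        esymm (Fin n) ℤ (j + 1 - (k + 1 + 1)) = -((-1) ^ (k + 1) *
          esymm (Fin n) ℤ (i + 1 + (k + 1)) * esymm (Fin n) ℤ (j - (k + 1))) := by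
      intro k
      rw [show i + (k + 1 + 1) = i + 1 + (k + 1) by ring, Nat.add_sub_add_right]
      ring
    simp only [h1, Finset.sum_neg_distrib, zero_add, Nat.add_sub_cancel]
    ring
  rw [qPair, qPair, h]
  ring

theorem qPair_add_swap {i j : ℕ} (h : Odd (i + j)) : qPair n i j + qPair n j i = 0 := by
  have step : ∀ i j, qPair n i (j + 1) + qPair n (j + 1) i =
      -(qPair n (i + 1) j + qPair n j (i + 1)) := by
    intro i j
    linear_combination qPair_add_qPair (n := n) i j + qPair_add_qPair (n := n) j i
  have h1 : ∀ j i, qPair n i j + qPair n j i =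
      (-1) ^ j * (qPair n (i + j) 0 + qPair n 0 (i + j)) := by
    intro j
    induction j with
    | zero => intro i; simp
    | succ j ih =>
      intro i
      rw [step, ih, show i + 1 + j = i + (j + 1) by ring]
      ring
  -- Sliding the whole index across reproduces the same symmetric sum with the sign `(-1)^{i+j} =
  -- -1`, so it vanishes.
  have h2 := h1 (i + j) 0
  rw [h.neg_one_pow, zero_add] at h2
  have h3 : qPair n (i + j) 0 + qPair n 0 (i + j) = 0 := by
    refine (mul_eq_zero.1 (?_ : (2 : MvPolynomial (Fin n) ℤ) * _ = 0)).resolve_left two_ne_zero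
    linear_combination h2
  rw [h1, h3, mul_zero]

theorem qPair_eq_mul {p : ℕ} (h : n ≤ p) (q : ℕ) :
    qPair n p q = esymm (Fin n) ℤ p * esymm (Fin n) ℤ q := by
  rw [qPair, Finset.sum_eq_zero, mul_zero, add_zero]
  intro k hk
  rw [esymm_eq_zero (by have := (Finset.mem_Icc.1 hk).1; omega), mul_zero, zero_mul]

theorem qPair_eq_zero {p : ℕ} (h : n < p) (q : ℕ) : qPair n p q = 0 := by
  rw [qPair_eq_mul h.le, esymm_eq_zero h, zero_mul]

end QPairSymmetry

/-! ### Duality of powers of the first variable with the `E_p` -/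

section Shift

variable {n : ℕ} {z : Fin n} (hz : (z : ℕ) = 0)

/-- The staircase monomial in the variables other than the first one. -/
noncomputable def tailStair (n : ℕ) : MvPolynomial (Fin n) ℤ :=
  xpow fun i => if (i : ℕ) = 0 then 0 else n - 1 - i

include hz

theorem tailStair_mul (k : ℕ) : tailStair n * X z ^ k =
    xpow fun i => if (i : ℕ) = 0 then k else n - 1 - i := by
  rw [tailStair, ← xpow_single, ← xpow_add]
  congr 1
  funext i
  simp only [Pi.add_apply, Pi.single_apply]
  by_cases h : i = z
  · subst h; simp [hz]
  · have : (i : ℕ) ≠ 0 := fun h0 => h (Fin.ext (by omega))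
    simp [h, this]

theorem stair_eq_tailStair : stair n n = tailStair n * X z ^ (n - 1) := by
  rw [tailStair_mul hz, stair]
  congr 1
  funext i
  split_ifs with h
  · simp [h]
  · rfl

theorem sAct_tailStair : sAct z (tailStair n) = tailStair n := by
  rw [tailStair, xpow, map_prod]
  refine Finset.prod_congr rfl fun i _ => ?_
  rw [map_pow, sAct_X_zero hz]
  split_ifs with h1 h2 h2
  · simp
  · exact absurd (h1 ▸ hz) h2
  · simp
  · rfl

/-- The exponent of the first variable repeats the one at index `a - 1`. -/
theorem piOp_tailStair_mul_pow {a : ℕ} (h2 : 2 ≤ a) (ha : a ≤ n) :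
    piOp n (tailStair n * X z ^ (n - a)) = 0 := by
  rw [tailStair_mul hz]
  refine piOp_xpow_eq_zero (i := z) (j := ⟨a - 1, by omega⟩) ?_ ?_
  · intro h
    have := congrArg Fin.val h
    dsimp only at this
    omega
  · rw [if_pos hz, if_neg (by dsimp only; omega)]
    dsimp only
    omega

theorem sign_mul_piOp_shift_one (p : ℕ) :
    (-1) ^ (n * (n - 1) / 2) * piOp n (tailStair n * X z ^ (n - 1) * esymmFrom n 1 p) =
      if p = 0 then 1 else 0 := by
  rw [← stair_eq_tailStair hz, piOp_stair_mul, neg_one_pow_mul_self, constantCoeff_esymmFrom]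
  · split_ifs <;> simp
  · intro i
    refine (degreeOf_esymmFrom_le _ _ _).trans ?_
    split_ifs with h
    · exact h
    · omega

/-- From `E_p = e_p - x_1 E_{p-1}`: the invariant `e_p` leaves `π`, and what it multiplies vanishes
by repeated exponents unless `a = 0`. -/
theorem sign_mul_piOp_shift_succ {a : ℕ} (ha : a < n) (p : ℕ) :
    (-1) ^ (n * (n - 1) / 2) * piOp n (tailStair n * X z ^ (n - (a + 1)) * shiftE n (p + 1)) =
      (if a = 0 then esymm (Fin n) ℤ p else 0) -
      (-1) ^ (n * (n - 1) / 2) * piOp n (tailStair n * X z ^ (n - a) * shiftE n p) := by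
  have h1 : tailStair n * X z ^ (n - (a + 1)) * shiftE n (p + 1) =
      esymm (Fin n) ℤ p * (tailStair n * X z ^ (n - (a + 1))) -
        tailStair n * X z ^ (n - a) * shiftE n p := by
    have e : n - a = n - (a + 1) + 1 := by omega
    rw [e, esymm_eq_add hz, shiftE]
    ring
  rw [h1, map_sub, piOp_mul_left fun i hi => sAct_esymm hi p]
  have h2 : (-1) ^ (n * (n - 1) / 2) * (esymm (Fin n) ℤ p *
      piOp n (tailStair n * X z ^ (n - (a + 1)))) = if a = 0 then esymm (Fin n) ℤ p else 0 := by
    split_ifs with h0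
    · subst h0
      have := sign_mul_piOp_shift_one hz 0
      rw [esymmFrom_zero_right, mul_one, if_pos rfl] at this
      linear_combination esymm (Fin n) ℤ p * this
    · rw [piOp_tailStair_mul_pow hz (by omega) (by omega), mul_zero, mul_zero]
  rw [mul_sub, h2]

theorem sign_mul_piOp_shift_zero (p : ℕ) :
    (-1) ^ (n * (n - 1) / 2) * piOp n (tailStair n * X z ^ n * shiftE n (p + 1)) =
      esymm (Fin n) ℤ (p + 1) := by
  have h1 := sign_mul_piOp_shift_succ hz (a := 0) (by have := z.isLt; omega) (p + 1)
  rw [if_pos rfl, shiftE, zero_add, sign_mul_piOp_shift_one hz, if_neg (Nat.succ_ne_zero p),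
    Nat.sub_zero] at h1
  linear_combination h1

theorem sign_mul_piOp_shift {a : ℕ} (ha : a < n) (p : ℕ) :
    (-1) ^ (n * (n - 1) / 2) * piOp n (tailStair n * X z ^ (n - (a + 1)) * shiftE n (p + 1)) =
      if a = p then (-1) ^ p else 0 := by
  induction a generalizing p with
  | zero =>
    rw [shiftE, zero_add, sign_mul_piOp_shift_one hz]
    cases p <;> simp
  | succ a ih =>
    rw [sign_mul_piOp_shift_succ hz ha, if_neg (Nat.succ_ne_zero a)]
    cases p with
    | zero => simp [shiftE]
    | succ p =>
      rw [ih (by omega)]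
      simp only [Nat.add_right_cancel_iff]
      split_ifs <;> ring

end Shift

/-! ### An eigenvector of `s_0`, and moving generators across the pairing -/

section Eigen

variable {n : ℕ}

/-- The generating polynomial `∑_a (-1)^a x_1^{n-a} M_{b,a}`. -/
noncomputable def genPoly (z : Fin n) (b : ℕ) : MvPolynomial (Fin n) ℤ :=
  ∑ a ∈ Finset.range (n + 1), (-1) ^ a * X z ^ (n - a) * partMat n b a

/-- The quotient of `genPoly` by the first variable. -/
noncomputable def genQuot (z : Fin n) (b : ℕ) : MvPolynomial (Fin n) ℤ :=
  ∑ a ∈ Finset.range n, (-1) ^ a * X z ^ (n - (a + 1)) * partMat n b a -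
    (-1) ^ n * shiftE n n * esymm (Fin n) ℤ b

variable {z : Fin n} (hz : (z : ℕ) = 0)
include hz

theorem esymm_top : esymm (Fin n) ℤ n = X z * shiftE n n := by
  rw [esymm_eq_add hz, esymmFrom_eq_zero (by have := z.isLt; omega), zero_add]

theorem X_mul_genQuot {b : ℕ} (hb : b < n) : X z * genQuot z b = genPoly z b := by
  rw [genPoly, Finset.sum_range_succ, genQuot, mul_sub, Finset.mul_sum]
  have h1 : partMat n b n = -(X z * shiftE n n * esymm (Fin n) ℤ b) := by
    rw [partMat_neg, partMat_of_lt hb, qPair_eq_mul le_rfl, esymm_top hz]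
  rw [h1, Nat.sub_self, sub_eq_add_neg]
  congr 1
  · refine Finset.sum_congr rfl fun a ha => ?_
    have e : n - a = n - (a + 1) + 1 := by have := Finset.mem_range.1 ha; omega
    rw [e]
    ring
  · ring

theorem sum_qPair (b A : ℕ) :
    ∑ a ∈ Finset.range (A + 1), (-1) ^ a * X z ^ (A - a) * qPair n b a =
      (-1) ^ A * (esymm (Fin n) ℤ b * esymmFrom n 1 A +
        2 * ∑ k ∈ Finset.Icc 1 A, (-1) ^ k * esymm (Fin n) ℤ (b + k) * esymmFrom n 1 (A - k)) := by
  induction A with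
  | zero => simp [qPair_zero, esymmFrom_zero_right]
  | succ A ih =>
    rw [Finset.sum_range_succ, Nat.sub_self]
    have h1 : ∑ a ∈ Finset.range (A + 1), (-1) ^ a * X z ^ (A + 1 - a) * qPair n b a =
        X z * ∑ a ∈ Finset.range (A + 1), (-1) ^ a * X z ^ (A - a) * qPair n b a := by
      rw [Finset.mul_sum]
      refine Finset.sum_congr rfl fun a ha => ?_
      have e : A + 1 - a = A - a + 1 := by have := Finset.mem_range.1 ha; omega
      rw [e]
      ring
    have h2 : ∑ k ∈ Finset.Icc 1 (A + 1), (-1) ^ k * esymm (Fin n) ℤ (b + k) *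
        esymm (Fin n) ℤ (A + 1 - k) = ∑ k ∈ Finset.Icc 1 (A + 1), (-1) ^ k *
          esymm (Fin n) ℤ (b + k) * esymmFrom n 1 (A + 1 - k) +
        X z * ∑ k ∈ Finset.Icc 1 A, (-1) ^ k * esymm (Fin n) ℤ (b + k) *
          esymmFrom n 1 (A - k) := by
      have h3 : ∑ k ∈ Finset.Icc 1 A, (-1) ^ k * esymm (Fin n) ℤ (b + k) *
          esymmFrom n 1 (A - k) = ∑ k ∈ Finset.Icc 1 (A + 1), (-1) ^ k * esymm (Fin n) ℤ (b + k) *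
          shiftE n (A + 1 - k) := by
        rw [Finset.sum_Icc_succ_top (by omega), Nat.sub_self, shiftE, mul_zero, add_zero]
        refine Finset.sum_congr rfl fun k hk => ?_
        have e : A + 1 - k = A - k + 1 := by have := Finset.mem_Icc.1 hk; omega
        rw [e, shiftE]
      rw [h3, Finset.mul_sum, ← Finset.sum_add_distrib]
      refine Finset.sum_congr rfl fun k _ => ?_
      rw [esymm_eq_add hz (A + 1 - k)]
      ring
    rw [h1, ih, qPair, h2, esymm_eq_add hz (A + 1), shiftE]
    ring

/-- Multiplied by `x_1^n`, the sum extends to `a ≤ 2n`, and the full sum with entries `Q̃_{b,a}` is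
zero for degree reasons and may be subtracted. The new coefficients `M_{b,a} - Q̃_{b,a}` are fixed
by `s_0` and vanish for `a + b` odd, so only powers of `x_1` of the parity of `b` occur. -/
theorem sAct_genPoly {b : ℕ} (h0 : 0 < b) (hb : b < n) :
    sAct z (genPoly z b) = (-1) ^ (n + b) * genPoly z b := by
  set D : ℕ → MvPolynomial (Fin n) ℤ := fun a => partMat n b a - qPair n b a with hD
  have h1 : X z ^ n * genPoly z b =
      ∑ a ∈ Finset.range (2 * n + 1), (-1) ^ a * X z ^ (2 * n - a) * D a := by
    have h2 := sum_qPair hz b (2 * n)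
    rw [esymmFrom_eq_zero (by omega), mul_zero, zero_add, Finset.sum_eq_zero (s := Finset.Icc _ _),
      mul_zero, mul_zero] at h2
    · simp only [hD, mul_sub, Finset.sum_sub_distrib]
      rw [h2, sub_zero, genPoly, Finset.mul_sum]
      have e : Finset.range (n + 1) ⊆ Finset.range (2 * n + 1) :=
        Finset.range_subset_range.2 (by omega)
      rw [← Finset.sum_subset e]
      · refine Finset.sum_congr rfl fun a ha => ?_
        have e : 2 * n - a = n + (n - a) := by have := Finset.mem_range.1 ha; omega
        rw [e, pow_add]
        ring
      · intro a _ ha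
        rw [Finset.mem_range] at ha
        rw [partMat_neg, partMat_of_lt (by omega), qPair_eq_zero (by omega), neg_zero, mul_zero]
    · intro k hk
      rw [Finset.mem_Icc] at hk
      by_cases h : k ≤ n
      · rw [esymmFrom_eq_zero (by omega), mul_zero]
      · rw [esymm_eq_zero (by omega), mul_zero, zero_mul]
  have h2 : ∀ a, sAct z (D a) = D a := by
    intro a
    simp only [hD]
    rw [map_sub, sAct_first_partMat hz, sAct_first_qPair hz]
    ring
  have h3 : ∀ a, Odd (b + a) → D a = 0 := by
    intro a ha
    simp only [hD]
    rcases lt_trichotomy a b with h | rfl | h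
    · rw [partMat_of_lt h, sub_self]
    · rw [← two_mul] at ha
      exact absurd ha (by simp)
    · rw [partMat_neg, partMat_of_lt h]
      linear_combination -qPair_add_swap ha
  have h4 : sAct z (X z ^ n * genPoly z b) = (-1) ^ b * (X z ^ n * genPoly z b) := by
    rw [h1, map_sum, Finset.mul_sum]
    refine Finset.sum_congr rfl fun a ha => ?_
    rw [map_mul, map_mul, h2, map_pow, map_pow, sAct_first_X hz, map_neg, map_one, neg_pow (X z : MvPolynomial (Fin n) ℤ)]
    rcases Nat.even_or_odd (b + a) with h | h
    · have e : (-1 : MvPolynomial (Fin n) ℤ) ^ (2 * n - a) = (-1) ^ b := by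
        have := Finset.mem_range.1 ha
        have e1 : (-1 : MvPolynomial (Fin n) ℤ) ^ (2 * n - a) * (-1) ^ (b + a) = (-1) ^ b := by
          rw [← pow_add, show 2 * n - a + (b + a) = b + 2 * n by omega, pow_add, pow_mul]
          simp
        rwa [h.neg_one_pow, mul_one] at e1
      rw [e]
      ring
    · rw [h3 a h]
      simp
  rw [map_mul, map_pow, sAct_first_X hz, neg_pow] at h4
  refine mul_left_cancel₀ (pow_ne_zero n (X_ne_zero z)) ?_
  have e : (-1 : MvPolynomial (Fin n) ℤ) ^ n * (-1) ^ n = 1 := by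
    rw [← mul_pow]; simp
  rw [pow_add]
  linear_combination (-1) ^ n * h4 - X z ^ n * sAct z (genPoly z b) * e

theorem sAct_genQuot {b : ℕ} (h0 : 0 < b) (hb : b < n) :
    sAct z (genQuot z b) = -((-1) ^ (n + b) * genQuot z b) := by
  have h := sAct_genPoly hz h0 hb
  rw [← X_mul_genQuot hz hb, map_mul, sAct_first_X hz] at h
  refine mul_left_cancel₀ (X_ne_zero z) ?_
  linear_combination -h

/-- One `e_b` comes from the term `a = 0`, the other from the correction by `E_{n-1}` that makes the
division by `x_1` possible. -/
theorem sign_mul_piOp_genQuot {b : ℕ} (h0 : 0 < b) :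
    (-1) ^ (n * (n - 1) / 2) * piOp n (tailStair n * genQuot z b) = 2 * esymm (Fin n) ℤ b := by
  have hn : 0 < n := by have := z.isLt; omega
  have hE := fun i hi => sAct_esymm (n := n) (i := i) hi b
  rw [genQuot, mul_sub, map_sub, Finset.mul_sum, map_sum]
  rw [Finset.sum_eq_single 0]
  · have h1 := sign_mul_piOp_shift_one hz 0
    rw [esymmFrom_zero_right, mul_one, if_pos rfl] at h1
    have h2 := sign_mul_piOp_shift hz (a := n - 1) (by omega) (n - 1)
    rw [Nat.sub_add_cancel hn, Nat.sub_self, pow_zero, mul_one, if_pos rfl] at h2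
    have e1 : tailStair n * ((-1) ^ 0 * X z ^ (n - (0 + 1)) * partMat n b 0) =
        esymm (Fin n) ℤ b * (tailStair n * X z ^ (n - 1)) := by
      rw [partMat_of_lt h0, qPair_zero]; ring
    have e2 : tailStair n * ((-1) ^ n * shiftE n n * esymm (Fin n) ℤ b) =
        esymm (Fin n) ℤ b * ((-1) ^ n * (tailStair n * shiftE n n)) := by ring
    have e3 : (-1 : MvPolynomial (Fin n) ℤ) ^ n * (-1) ^ (n - 1) = -1 := by
      obtain ⟨m, rfl⟩ : ∃ m, n = m + 1 := ⟨n - 1, by omega⟩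
      rw [Nat.add_sub_cancel, pow_succ, mul_right_comm, ← mul_pow]
      simp
    rw [e1, e2, piOp_mul_left hE, piOp_mul_left hE, piOp_neg_one_pow_mul]
    linear_combination esymm (Fin n) ℤ b * h1 - esymm (Fin n) ℤ b * (-1) ^ n * h2 -
      esymm (Fin n) ℤ b * e3
  · intro a ha ha0
    have e : tailStair n * ((-1) ^ a * X z ^ (n - (a + 1)) * partMat n b a) =
        (-1) ^ a * (tailStair n * X z ^ (n - (a + 1)) * partMat n b a) := by ring
    rw [e, piOp_neg_one_pow_mul, piOp_mul_right fun i hi => sAct_partMat hi _ _,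
      piOp_tailStair_mul_pow hz (by omega) (Finset.mem_range.1 ha), zero_mul, mul_zero]
  · intro h
    exact absurd (Finset.mem_range.2 hn) h

theorem sign_mul_piOp_genPoly {b p : ℕ} (h0 : 0 < b) (hp : p < n) :
    (-1) ^ (n * (n - 1) / 2) * piOp n (tailStair n * genPoly z b * shiftE n (p + 1)) =
      esymm (Fin n) ℤ b * esymm (Fin n) ℤ (p + 1) - partMat n b (p + 1) := by
  have h1 : ∀ a, (-1) ^ (n * (n - 1) / 2) * piOp n
      (tailStair n * ((-1) ^ a * X z ^ (n - a) * partMat n b a) * shiftE n (p + 1)) =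
      (-1) ^ a * ((-1) ^ (n * (n - 1) / 2) *
        piOp n (tailStair n * X z ^ (n - a) * shiftE n (p + 1))) * partMat n b a := by
    intro a
    have e : tailStair n * ((-1) ^ a * X z ^ (n - a) * partMat n b a) * shiftE n (p + 1) =
      (-1) ^ a * (tailStair n * X z ^ (n - a) * shiftE n (p + 1) * partMat n b a) := by ring
    rw [e, piOp_neg_one_pow_mul, piOp_mul_right fun i hi => sAct_partMat hi _ _]
    ring
  rw [genPoly, Finset.mul_sum, Finset.sum_mul, map_sum, Finset.mul_sum]
  simp only [h1]
  rw [Finset.sum_range_succ', Nat.sub_zero, sign_mul_piOp_shift_zero hz, Finset.sum_eq_single p,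
    sign_mul_piOp_shift hz hp, if_pos rfl, partMat_of_lt h0, qPair_zero]
  · have e : (-1 : MvPolynomial (Fin n) ℤ) ^ (p + 1) * (-1) ^ p = -1 := by
      rw [pow_succ, mul_right_comm, ← mul_pow]; simp
    linear_combination partMat n b (p + 1) * e
  · intro a ha hap
    rw [sign_mul_piOp_shift hz (Finset.mem_range.1 ha), if_neg hap, mul_zero, zero_mul]
  · intro h
    exact absurd (Finset.mem_range.2 hp) h

/-- Insert `s_0 Q̃ = Q̃ - 2 x_1 ∂_0 Q̃`. The first term gives `2 e_c Q̃`, the second gives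
contractions by `e` and by row `c` of the matrix, and together they assemble into left
multiplication by `ε_c`. -/
theorem sign_mul_piOp_genQuot_mul_qForm (c : Fin (n + 1)) (h0 : 0 < (c : ℕ)) (hc : (c : ℕ) < n)
    {r : ℕ} {x : PartWedge n} (hx : x ∈ wedgeSpan _ (n + 1) r) (hx0 : contrBasis 0 x = 0) :
    (-1) ^ (n * (n - 1) / 2) * piOp n (tailStair n * genQuot z c * sAct z (qForm n x)) =
      2 * qForm n (eps _ c * x) := by
  have hsym : ∀ i : Fin n, (i : ℕ) ≠ 0 → sAct i (qForm n x) = qForm n x :=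
    fun i hi => sAct_qForm hi hx
  have h1 : tailStair n * genQuot z c * sAct z (qForm n x) =
      tailStair n * genQuot z c * qForm n x -
        (tailStair n * genPoly z c * tau z (qForm n x) + tailStair n * genPoly z c * tau z (qForm n x)) := by
    have := dRoot_mul_tau z (qForm n x)
    rw [dRoot_zero hz] at this
    rw [← X_mul_genQuot hz hc]
    linear_combination tailStair n * genQuot z c * this
  have h2 : (-1) ^ (n * (n - 1) / 2) * piOp n (tailStair n * genPoly z c * tau z (qForm n x)) =
      esymm (Fin n) ℤ c * qForm n (contr (eVec n) x) -
        qForm n (contr (fun p : Fin (n + 1) => partMat n c p) x) := by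
    rw [tau_first_qForm hz hx]
    simp only [contr_eq_sum, map_sum, LinearMap.map_smul, smul_eq_mul, Finset.mul_sum]
    rw [← Finset.sum_sub_distrib]
    refine Finset.sum_congr rfl fun p _ => ?_
    refine Fin.cases ?_ (fun p => ?_) p
    · rw [hx0]; simp
    · rw [← mul_assoc (tailStair n * _), piOp_mul_right fun i hi => sAct_qForm hi (contrBasis_mem hx _),
        ← mul_assoc, Fin.val_succ, sign_mul_piOp_genPoly hz h0 p.isLt, eVec, Fin.val_succ]
      ring
  rw [h1, map_sub, map_add, piOp_mul_right hsym, qForm_eps_mul, eVec, mul_sub, mul_add, h2,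
    ← mul_assoc, sign_mul_piOp_genQuot hz h0, qForm_contr_eVec, qForm_apply]
  ring

/-- Twice either side is, up to sign, `Tπ` of the tail staircase times the eigenvector with `s_0`
applied to one of the two factors. The reflection exchanges the two situations, `Tπ` is
antisymmetric under it, and the eigenvalue supplies the sign. -/
theorem topOp_move (c : Fin (n + 1)) (h0 : 0 < (c : ℕ)) (hc : (c : ℕ) < n)
    {r s : ℕ} {x y : PartWedge n} (hx : x ∈ wedgeSpan _ (n + 1) r) (hx0 : contrBasis 0 x = 0)
    (hy : y ∈ wedgeSpan _ (n + 1) s) (hy0 : contrBasis 0 y = 0) :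
    topOp n (qForm n (eps _ c * x) * qForm n y) =
      (-1) ^ (n + c : ℕ) * topOp n (qForm n x * qForm n (eps _ c * y)) := by
  have key : ∀ {r s : ℕ} {x y : PartWedge n}, x ∈ wedgeSpan _ (n + 1) r → contrBasis 0 x = 0 →
      y ∈ wedgeSpan _ (n + 1) s →
      topOp n (qForm n (eps _ c * x) * qForm n y) + topOp n (qForm n (eps _ c * x) * qForm n y) =
        (-1) ^ (n * (n - 1) / 2) *
          topOp n (piOp n (tailStair n * genQuot z c * sAct z (qForm n x) * qForm n y)) := by
    intro r s x y hx hx0 hy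
    rw [← map_add, ← topOp_neg_one_pow_mul, piOp_mul_right fun i hi => sAct_qForm hi hy, ← mul_assoc,
      sign_mul_piOp_genQuot_mul_qForm hz c h0 hc hx hx0]
    congr 1
    ring
  have h1 := key hx hx0 hy
  have h2 := key hy hy0 hx
  have h3 := map_sAct (topOp_piOp_mul_tau z) (tailStair n * genQuot z c * qForm n x * sAct z (qForm n y))
  have e : sAct z (tailStair n * genQuot z c * qForm n x * sAct z (qForm n y)) =
      (-1) ^ (n + c + 1) * (tailStair n * genQuot z c * sAct z (qForm n x) * qForm n y) := by
    rw [map_mul, map_mul, map_mul, sAct_sAct, sAct_tailStair hz, sAct_genQuot hz h0 hc]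
    ring
  rw [e, Module.End.mul_apply, Module.End.mul_apply, piOp_neg_one_pow_mul, topOp_neg_one_pow_mul] at h3
  have e2 : tailStair n * genQuot z c * qForm n x * sAct z (qForm n y) =
    tailStair n * genQuot z c * sAct z (qForm n y) * qForm n x := by ring
  have e3 := neg_one_pow_mul_self (n + (c : ℕ))
    (topOp n (piOp n (tailStair n * genQuot z c * sAct z (qForm n x) * qForm n y)))
  rw [e2] at h3
  rw [mul_comm (qForm n x)]
  refine mul_left_cancel₀ (two_ne_zero (α := MvPolynomial (Fin n) ℤ)) ?_
  rw [pow_succ] at h3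
  linear_combination h1 - (-1) ^ (n + (c : ℕ)) * h2 - (-1) ^ (n * (n - 1) / 2) * (-1) ^ (n + (c : ℕ)) * h3 - (-1) ^ (n * (n - 1) / 2) * e3

theorem sAct_esymm_top : sAct z (esymm (Fin n) ℤ n) = -esymm (Fin n) ℤ n := by
  rw [esymm_top hz, map_mul, sAct_first_X hz, sAct_first_shiftE hz, neg_mul]

end Eigen

/-! ### Orthogonality of the `Q̃_λ` -/

section Orthogonality

variable {n : ℕ}

/-- Since `e_{n+k} = 0` for `k > 0`, row `n` of the matrix is `e_n` times the vector of the `e_q`.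
-/
theorem qForm_last_mul {x : PartWedge n} (hx : contrBasis (Fin.last n) x = 0) :
    qForm n (eps _ (Fin.last n) * x) = esymm (Fin n) ℤ n * qForm n x := by
  have h : contr (fun q : Fin (n + 1) => partMat n (Fin.last n) q) x =
      esymm (Fin n) ℤ n • contr (eVec n) x := by
    rw [contr_eq_sum, contr_eq_sum, Finset.smul_sum]
    refine Finset.sum_congr rfl fun p _ => ?_
    rw [smul_smul]
    by_cases hp : p = Fin.last n
    · rw [hp, hx, smul_zero, smul_zero]
    · have : (p : ℕ) < n := by
        rcases lt_or_eq_of_le (Nat.lt_succ_iff.1 p.isLt) with h | h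
        · exact h
        · exact absurd (Fin.ext h) hp
      rw [Fin.val_last, partMat_of_lt this, qPair_eq_mul le_rfl, eVec]
  rw [qForm_eps_mul, h, LinearMap.map_smul, smul_eq_mul, qForm_contr_eVec, qForm_apply, eVec,
    Fin.val_last]
  ring

theorem wset_eq_insert_last {m : ℕ} {s : Finset (Fin (m + 1))} (h : Fin.last m ∉ s) :
    qForm (m + 1) (wset (insert (Fin.last m) s)) = esymm (Fin (m + 1)) ℤ (m + 1) * qForm (m + 1) (wset s) := by
  rw [wset_insert_max fun b hb => lt_of_le_of_ne (Fin.le_last b) fun e => h (e ▸ hb), Fin.succ_last]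
  refine qForm_last_mul ?_
  rw [← Fin.succ_last]
  exact contrBasis_wset_of_notMem h

theorem topOp_mul_of_notMem {m : ℕ} {s : Finset (Fin (m + 1))} (hs : Fin.last m ∉ s)
    (u : Finset (Fin (m + 1))) :
    topOp (m + 1) (qForm (m + 1) (wset s) * qForm (m + 1) (wset u)) = if u = sᶜ then 1 else 0 := by
  induction s using Finset.induction_on_max generalizing u with
  | empty => rw [qForm_wset_empty, one_mul, topOp_qForm_wset, Finset.compl_empty]
  | insert c s hmax ih =>
    rw [Finset.mem_insert, not_or] at hs
    have hcs : c ∉ s := fun h => lt_irrefl _ (hmax c h)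
    have hc : (c : ℕ) < m := by
      rcases lt_or_eq_of_le (Nat.lt_succ_iff.1 c.isLt) with h | h
      · exact h
      · exact absurd (Fin.ext h.symm) hs.1
    rw [wset_insert_max hmax, topOp_move (z := 0) rfl c.succ (by simp) (by simpa using hc) (wset_mem s)
      (contrBasis_zero_wset s) (wset_mem u) (contrBasis_zero_wset u), eps_mul_wset]
    by_cases hu : c ∈ u
    · rw [if_pos hu, map_zero, mul_zero, map_zero, mul_zero, if_neg]
      rintro rfl
      simp at hu
    · rw [if_neg hu]
      have e1 : ∀ (k : ℕ) (x : PartWedge (m + 1)), qForm (m + 1) ((-1) ^ k * x) =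
          (-1) ^ k * qForm (m + 1) x := by
        intro k x
        rcases neg_one_pow_eq_or (PartWedge (m + 1)) k with h | h <;>
        rcases Nat.even_or_odd k with h' | h' <;> simp [h'.neg_one_pow]
      rw [e1, mul_left_comm, topOp_neg_one_pow_mul, ih hs.2]
      have e2 : insert c u = sᶜ ↔ u = (insert c s)ᶜ := by
        constructor
        · intro h
          ext j
          have := Finset.ext_iff.1 h j
          simp only [Finset.mem_insert, Finset.mem_compl, not_or] at this ⊢
          by_cases hj : j = c
          · subst hj; simp [hu]
          · simpa [hj] using this
        · rintro rfl
          ext j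
          simp only [Finset.mem_insert, Finset.mem_compl, not_or]
          by_cases hj : j = c
          · subst hj; simp [hcs]
          · simp [hj]
      by_cases hu' : u = (insert c s)ᶜ
      · rw [if_pos hu', if_pos (e2.2 hu'), mul_one]
        -- As `c` is the maximum, `u` contains every index above `c`. The resulting reordering sign
        -- cancels the one from `topOp_move`.
        have e3 : u.filter (fun j => c < j) = Finset.Ioi c := by
          ext j
          rw [hu', Finset.mem_filter, Finset.mem_compl, Finset.mem_Ioi, Finset.mem_insert, not_or]
          refine ⟨fun h => h.2, fun h => ⟨⟨h.ne', fun hj => lt_asymm h (hmax j hj)⟩, h⟩⟩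
        rw [e3, Fin.card_Ioi, ← pow_add, Fin.val_succ]
        refine Even.neg_one_pow ⟨m + 1, by omega⟩
      · rw [if_neg hu', if_neg fun h => hu' (e2.1 h), mul_zero, mul_zero]

/-- The `Q̃`-polynomials are orthogonal under the top operator. -/
theorem topOp_qForm_mul_qForm (s u : Finset (Fin n)) :
    topOp n (qForm n (wset s) * qForm n (wset u)) = if u = sᶜ then 1 else 0 := by
  cases n with
  | zero =>
    obtain rfl : s = ∅ := Subsingleton.elim _ _
    rw [qForm_wset_empty, one_mul, topOp_qForm_wset, Finset.compl_empty]
  | succ m =>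
    by_cases hs : Fin.last m ∈ s
    · obtain ⟨s, hs', rfl⟩ : ∃ t, Fin.last m ∉ t ∧ s = insert (Fin.last m) t :=
        ⟨s.erase _, Finset.notMem_erase _ _, (Finset.insert_erase hs).symm⟩
      rw [wset_eq_insert_last hs']
      by_cases hu : Fin.last m ∈ u
      · obtain ⟨u, hu', rfl⟩ : ∃ t, Fin.last m ∉ t ∧ u = insert (Fin.last m) t :=
          ⟨u.erase _, Finset.notMem_erase _ _, (Finset.insert_erase hu).symm⟩
        -- If both sets contain the part `n`, then `e_n²` is invariant under `W_n` and factors out;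
        -- the remaining pairing is zero because neither set now contains `n`.
        rw [wset_eq_insert_last hu', mul_mul_mul_comm, topOp, tauW_mul_left, ← topOp,
          topOp_mul_of_notMem hs', if_neg, mul_zero, if_neg]
        · intro h
          have := Finset.ext_iff.1 h (Fin.last m)
          simp at this
        · rintro rfl
          simp [hs'] at hu'
        · intro i _
          by_cases hi : (i : ℕ) = 0
          · rw [map_mul, sAct_esymm_top hi]; ring
          · rw [map_mul, sAct_esymm hi]
      -- If only `s` contains the part `n`, its factor `e_n` is handed over to the other set.
      · rw [mul_assoc, mul_left_comm, ← wset_eq_insert_last hu, topOp_mul_of_notMem hs']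
        congr 1
        rw [eq_iff_iff]
        constructor
        · intro h
          ext j
          have := Finset.ext_iff.1 h j
          simp only [Finset.mem_insert, Finset.mem_compl, not_or] at this ⊢
          by_cases hj : j = Fin.last m
          · subst hj; simp [hu]
          · simpa [hj] using this
        · rintro rfl
          ext j
          simp only [Finset.mem_insert, Finset.mem_compl, not_or]
          by_cases hj : j = Fin.last m
          · subst hj; simp [hs']
          · simp [hj]
    · exact topOp_mul_of_notMem hs u

end Orthogonality

/-! ### Setting `Y = 0` -/

section Specialization

variable {n : ℕ} {A B : Type*} [CommRing A] [CommRing B]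

theorem map_act (φ : A →+* B) (w : SignedPerm n) (f : MvPolynomial (Fin n) A) :
    map φ (act A w f) = act B w (map φ f) := by
  have h : (map φ).comp (act A w).toRingHom = (act B w).toRingHom.comp (map φ) := by
    refine MvPolynomial.ringHom_ext (fun r => ?_) fun i => ?_
    · simp [← algebraMap_eq]
    · simp [act_X]
  exact RingHom.congr_fun h f

theorem map_dRoot (φ : A →+* B) (i : Fin n) : map φ (dRoot A i) = dRoot B i := by
  unfold dRoot
  split_ifs
  · rw [map_mul, map_ofNat, map_X]
  · rw [map_sub, map_X, map_X]

theorem map_divDiffW' [IsDomain B] [CharZero B] (φ : A →+* B) (w : SignedPerm n)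
    (f : MvPolynomial (Fin n) A) : map φ (divDiffW' w f) = divDiffW' w (map φ f) := by
  have h : ∀ a : List (Fin n), map φ (a.foldr divDiff' f) = a.foldr divDiff' (map φ f) := by
    intro a
    induction a with
    | nil => rfl
    | cons i a ih =>
      rw [List.foldr_cons, List.foldr_cons, ← ih]
      refine (divDiff'_eq_of ?_).symm
      rw [← map_dRoot φ, ← map_mul, dRoot_mul_divDiff', map_sub, map_act]
  exact h _

theorem map_constantCoeff_deltaKernel : map constantCoeff (deltaKernel n) = stair n n := by
  rw [deltaKernel, map_prod, Finset.prod_filter, Fintype.prod_prod_type, stair, xpow]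
  refine Finset.prod_congr rfl fun i _ => ?_
  simp only [map_sub, map_X, map_C, constantCoeff_X, map_zero, sub_zero]
  rw [← Finset.prod_filter, Finset.prod_const]
  congr 1
  have h : (Finset.univ.filter fun j : Fin n => (i : ℕ) + 1 + ((j : ℕ) + 1) ≤ n).map Fin.valEmbedding =
      Finset.range (n - 1 - i) := by
    ext x
    simp only [Finset.mem_map, Finset.mem_filter, Finset.mem_univ, true_and, Fin.valEmbedding_apply,
      Finset.mem_range]
    constructor
    · rintro ⟨j, hj, rfl⟩
      omega
    · intro hx
      exact ⟨⟨x, by omega⟩, by dsimp only; omega, rfl⟩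
  rw [← Finset.card_map Fin.valEmbedding, h, Finset.card_range]

theorem constantCoeff_esymm {k : ℕ} (h : k ≠ 0) : constantCoeff (esymm (Fin n) ℤ k) = 0 := by
  rw [← esymmFrom_zero_left, constantCoeff_esymmFrom, if_neg h]

theorem constantCoeff_qPair {p : ℕ} (h : p ≠ 0) (q : ℕ) : constantCoeff (qPair n p q) = 0 := by
  have h1 : ∀ k, constantCoeff (esymm (Fin n) ℤ (p + k)) = 0 := fun k =>
    constantCoeff_esymm (by omega)
  simp [qPair, constantCoeff_esymm h, h1]

theorem constantCoeff_partMat (p q : ℕ) : constantCoeff (partMat n p q) = 0 := by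
  unfold partMat
  split_ifs
  · exact constantCoeff_qPair (by omega) q
  · rw [map_neg, constantCoeff_qPair (by omega), neg_zero]
  · exact map_zero _

/-- Taking constant terms replaces the matrix by zero, whose Pfaffian functional kills every product
starting with a generator. -/
theorem constantCoeff_partPf_eps_mul (p : Fin (n + 1)) {r : ℕ} {x : PartWedge n}
    (hx : x ∈ wedgeSpan _ (n + 1) r) : constantCoeff (partPf n (eps _ p * x)) = 0 := by
  have h0 : ∀ p q : Fin (n + 1), (fun _ _ : Fin (n + 1) => (0 : MvPolynomial (Fin n) ℤ)) p q =
    -(fun _ _ : Fin (n + 1) => (0 : MvPolynomial (Fin n) ℤ)) q p := fun _ _ => neg_zero.symm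
  have h1 := map_pfForm (fun p q : Fin (n + 1) => partMat_neg (n := n) p q) h0 (C.comp constantCoeff)
    (fun p q => by rw [RingHom.comp_apply, constantCoeff_partMat, map_zero]) (eps_mul_mem hx p)
  have h2 : pfForm h0 (eps _ p * x) = 0 := by
    rw [pfForm_eps_mul, contr_eq_sum]
    simp
  exact C_injective _ _ ((h1.trans h2).trans (map_zero C).symm)

theorem constantCoeff_partPf_wset {s : Finset (Fin n)} (hs : s.Nonempty) :
    constantCoeff (partPf n (wset s)) = 0 := by
  obtain ⟨a, t, ht, rfl⟩ : ∃ a t, (∀ b ∈ t, b < a) ∧ s = insert a t :=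
    ⟨s.max' hs, s.erase (s.max' hs), fun b hb => s.lt_max'_of_mem_erase_max' hs hb,
      (Finset.insert_erase (s.max'_mem hs)).symm⟩
  rw [wset_insert_max ht]
  exact constantCoeff_partPf_eps_mul _ (wset_mem t)

theorem constantCoeff_qForm_wset (s : Finset (Fin n)) :
    constantCoeff (qForm n (wset s)) = if s = ∅ then 1 else 0 := by
  split_ifs with h
  · rw [h, qForm_wset_empty, map_one]
  · rw [qForm_apply, map_add, constantCoeff_partPf_wset (Finset.nonempty_iff_ne_empty.2 h),
      contr_eq_sum, map_sum, map_sum, zero_add]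
    refine Finset.sum_eq_zero fun p _ => ?_
    refine Fin.cases ?_ (fun p => ?_) p
    · rw [contrBasis_zero_wset, smul_zero, map_zero, map_zero]
    · rw [LinearMap.map_smul, smul_eq_mul, map_mul, eVec, constantCoeff_esymm (by simp), zero_mul]

theorem map_constantCoeff_qKernel :
    map constantCoeff (qKernel n) = qForm n (wset (Finset.univ : Finset (Fin n))) := by
  rw [qKernel, map_sum, Finset.sum_eq_single Finset.univ]
  · rw [map_mul, map_C, map_map, Finset.compl_univ, qTilde_eq_qForm ∅, constantCoeff_qForm_wset,
      if_pos rfl, map_one, mul_one, qTilde_eq_qForm]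
    have h : (constantCoeff : MvPolynomial (Fin n) ℤ →+* ℤ).comp C = RingHom.id ℤ :=
      RingHom.ext fun r => constantCoeff_C _ r
    rw [h, map_id]
  · intro s _ hs
    rw [map_mul, map_C, qTilde_eq_qForm sᶜ, constantCoeff_qForm_wset, if_neg, map_zero, mul_zero]
    rwa [Finset.compl_eq_empty_iff]
  · intro h
    exact absurd (Finset.mem_univ _) h

theorem schubertC_eq (w : SignedPerm n) : schubertC w = (-1) ^ (n * (n - 1) / 2) *
    divOp (w⁻¹ * w0 n) (stair n n * qForm n (wset (Finset.univ : Finset (Fin n)))) := by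
  rw [schubertC, doubleSchubertC, map_mul, map_pow, map_neg, map_one, map_divDiffW', map_mul,
    map_constantCoeff_deltaKernel, map_constantCoeff_qKernel, divDiffW'_eq (reducedWord_spec _)]
  rfl

/-- Since `u⁻¹ w_0 = (u⁻¹ ϖ_0)(ϖ_0 w_0)` with lengths adding, the second factor first turns the
kernel into the opposite staircase up to sign, and only a type A operator remains. -/
theorem schubertCPerm_eq (u : Equiv.Perm (Fin n)) : schubertCPerm u = schubPerm u := by
  have h1 : (ofPerm u)⁻¹ * w0 n = ofPerm (u⁻¹ * Fin.revPerm) * (ofPerm Fin.revPerm * w0 n) := by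
    rw [← mul_assoc, ← map_mul, mul_assoc u⁻¹, revPerm_mul_self, mul_one, map_inv]
  have h2 : (w0 n).length = (ofPerm (n := n) Fin.revPerm).length + (ofPerm Fin.revPerm * w0 n).length := by
    rw [← isReducedWord_long_big.2, List.length_append, isReducedWord_longWord.2,
      isReducedWord_bigWord.2]
  have h3 := length_ofPerm_add u
  have h4 := length_mul_revPerm u⁻¹
  rw [map_inv, length_inv] at h4
  have h5 := length_mul_le (ofPerm (u⁻¹ * Fin.revPerm)) (ofPerm Fin.revPerm * w0 n)
  have h6 := length_mul_le (ofPerm u) ((ofPerm u)⁻¹ * w0 n)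
  rw [mul_inv_cancel_left, h1] at h6
  have h7 := length_revPerm (n := n)
  rw [schubertCPerm, schubertC_eq, h1, ← divOp_mul_of_eq (by omega), Module.End.mul_apply,
    ← tauW_eq_divOp isReducedWord_bigWord, tauW_bigWord_stair, divOp, tauW_neg_one_pow_mul,
    neg_one_pow_mul_self, schubPerm, divOp]

/-- From `w_{λ'} ϖ_0 = w_0 w_λ`, reversing the reduced word of the left side gives one for `w_λ⁻¹
w_0` that ends by applying `π`. -/
theorem schubertCPart_eq_piOp (s : StrictPartition n) : schubertCPart s =
    (-1) ^ (n * (n - 1) / 2) * piOp n (tauW (grassWord (Finset.sort sᶜ (· ≥ ·))).reverse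
      (stair n n * qForm n (wset (Finset.univ : Finset (Fin n))))) := by
  have h1 := (isReducedWord_grass_long sᶜ).reverse
  rw [← maxGrass_eq, ← w0_mul_maxGrass, mul_assoc _ (ofPerm Fin.revPerm), ofPerm_rev_mul_self,
    mul_one, mul_inv_rev, inv_eq_of_mul_eq_one_left w0_mul_self, List.reverse_append] at h1
  have h2 : tauW (longWord n le_rfl).reverse = piOp n := by
    have h := (isReducedWord_longWord (n := n)).reverse
    rw [inv_eq_of_mul_eq_one_left ofPerm_rev_mul_self] at h
    exact tauW_congr h isReducedWord_longWord
  rw [schubertCPart, schubertC_eq, ← tauW_eq_divOp h1, tauW_append, h2, Module.End.mul_apply]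

end Specialization

/-! ### Nondegeneracy over the fraction field -/

section Nondegenerate

variable {n : ℕ}

theorem act_injective (w : SignedPerm n) : Function.Injective (act ℤ w) := by
  refine Function.LeftInverse.injective (g := act ℤ w⁻¹) fun f => ?_
  rw [← act_mul, inv_mul_cancel, act_one]

theorem exists_tauW_eq_sum (a : List (Fin n)) :
    ∃ c : SignedPerm n → FractionRing (MvPolynomial (Fin n) ℤ), ∀ f : MvPolynomial (Fin n) ℤ,
      algebraMap _ (FractionRing (MvPolynomial (Fin n) ℤ)) (tauW a f) =
        ∑ w, c w * algebraMap _ _ (act ℤ w f) := by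
  classical
  induction a using List.reverseRecOn with
  | nil =>
    refine ⟨Pi.single 1 1, fun f => ?_⟩
    simp [Pi.single_apply, act_one]
  | append_singleton a i ih =>
    obtain ⟨c, hc⟩ := ih
    refine ⟨fun w => c w / algebraMap _ _ (act ℤ w (dRoot ℤ i)) -
      c (w * simpleRefl i) / algebraMap _ _ (act ℤ (w * simpleRefl i) (dRoot ℤ i)), fun f => ?_⟩
    have h1 : ∀ w, algebraMap _ (FractionRing (MvPolynomial (Fin n) ℤ)) (act ℤ w (dRoot ℤ i)) ≠ 0 := by
      intro w h
      rw [FaithfulSMul.algebraMap_eq_zero_iff, map_eq_zero_iff _ (act_injective w)] at h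
      exact dRoot_ne_zero i h
    have h2 : ∀ w, algebraMap _ (FractionRing (MvPolynomial (Fin n) ℤ)) (act ℤ w (tau i f)) =
        (algebraMap _ _ (act ℤ w f) - algebraMap _ _ (act ℤ (w * simpleRefl i) f)) /
          algebraMap _ _ (act ℤ w (dRoot ℤ i)) := by
      intro w
      rw [eq_div_iff (h1 w), ← map_mul, ← map_mul, mul_comm, dRoot_mul_tau, map_sub, map_sub, act_mul]
    rw [tauW_append, tauW_cons, tauW_nil, mul_one, Module.End.mul_apply, hc]
    simp only [h2, sub_mul, Finset.sum_sub_distrib]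
    have h3 : ∑ w, c (w * simpleRefl i) /
        algebraMap _ (FractionRing (MvPolynomial (Fin n) ℤ)) (act ℤ (w * simpleRefl i) (dRoot ℤ i)) *
          algebraMap _ _ (act ℤ w f) = ∑ w, c w / algebraMap _ _ (act ℤ w (dRoot ℤ i)) *
          algebraMap _ _ (act ℤ (w * simpleRefl i) f) := by
      refine Fintype.sum_equiv (Equiv.mulRight (simpleRefl i)) _ _ fun w => ?_
      rw [Equiv.coe_mulRight, mul_assoc w, simpleRefl_mul_self, mul_one]
    rw [h3, ← Finset.sum_sub_distrib]
    refine Finset.sum_congr rfl fun w _ => ?_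
    ring

theorem eq_zero_of_pairing {I : Type*} [Fintype I] [DecidableEq I] (e : I ≃ SignedPerm n)
    {a : List (Fin n)} {b b' : I → MvPolynomial (Fin n) ℤ}
    (h : ∀ i j, tauW a (b i * b' j) = if i = j then 1 else 0) {f : MvPolynomial (Fin n) ℤ}
    (hf : ∀ j, tauW a (f * b' j) = 0) : f = 0 := by
  obtain ⟨c, hc⟩ := exists_tauW_eq_sum a
  let ι := algebraMap (MvPolynomial (Fin n) ℤ) (FractionRing (MvPolynomial (Fin n) ℤ))
  let M : Matrix I I (FractionRing (MvPolynomial (Fin n) ℤ)) :=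
    Matrix.of fun i k => c (e k) * ι (act ℤ (e k) (b i))
  let N : Matrix I I (FractionRing (MvPolynomial (Fin n) ℤ)) :=
    Matrix.of fun k j => ι (act ℤ (e k) (b' j))
  let v : I → FractionRing (MvPolynomial (Fin n) ℤ) := fun k => c (e k) * ι (act ℤ (e k) f)
  have hsum : ∀ g j, ∑ k, c (e k) * ι (act ℤ (e k) g) * ι (act ℤ (e k) (b' j)) =
      ι (tauW a (g * b' j)) := by
    intro g j
    rw [hc, ← e.sum_comp]
    refine Finset.sum_congr rfl fun k _ => ?_
    rw [map_mul, map_mul, mul_assoc]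
  have hMN : M * N = 1 := by
    ext i j
    rw [Matrix.mul_apply, Matrix.one_apply]
    refine (hsum (b i) j).trans ?_
    rw [h]
    split_ifs <;> simp
  -- Both matrices are square because the index set has as many elements as `W_n`, so the one-sided
  -- inverse is two-sided.
  have hNM : N * M = 1 := mul_eq_one_comm.1 hMN
  have hv : Matrix.vecMul v N = 0 := by
    funext j
    refine (hsum f j).trans ?_
    rw [hf, map_zero, Pi.zero_apply]
  have hv0 : v = 0 := by
    rw [← Matrix.vecMul_one v, ← hNM, ← Matrix.vecMul_vecMul, hv, Matrix.zero_vecMul]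
  -- Otherwise the column of `M` belonging to the identity element would vanish, contradicting `N M
  -- = 1`.
  have hc1 : c 1 ≠ 0 := by
    intro h0
    have h2 := congrFun (congrFun hNM (e.symm 1)) (e.symm 1)
    rw [Matrix.mul_apply, Matrix.one_apply_eq, Finset.sum_eq_zero] at h2
    · exact zero_ne_one h2
    · intro i _
      simp [M, h0]
  have h3 := congrFun hv0 (e.symm 1)
  simp only [v, Equiv.apply_symm_apply, act_one, Pi.zero_apply, mul_eq_zero, hc1, false_or] at h3
  exact (FaithfulSMul.algebraMap_eq_zero_iff _ _).1 h3

theorem card_index : Fintype.card (Equiv.Perm (Fin n) × Finset (Fin n)) =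
    Fintype.card (SignedPerm n) := by
  have e : SignedPerm n ≃ Equiv.Perm (Fin n) × (Fin n → ℤˣ) :=
    ⟨fun w => (w.perm, w.sign), fun p => ⟨p.1, p.2⟩, fun _ => rfl, fun _ => rfl⟩
  rw [Fintype.card_congr e, Fintype.card_prod, Fintype.card_prod, Fintype.card_finset,
    Fintype.card_fun, Fintype.card_units_int]

end Nondegenerate

/-! ### The basis and the identification of `ℭ_λ` with `Q̃_λ` -/

section Basis

variable {n : ℕ}

theorem mem_weylInvariants_iff {f : MvPolynomial (Fin n) ℤ} :
    f ∈ weylInvariants n ↔ ∀ i, sAct i f = f := by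
  refine ⟨fun h i => h _, fun h w => ?_⟩
  obtain ⟨a, rfl⟩ := exists_word w
  induction a with
  | nil => exact act_one f
  | cons i a ih =>
    rw [wordProd_cons, act_mul, ih]
    exact h i

theorem scalarProd_mul_of_sAct {f g p q : MvPolynomial (Fin n) ℤ}
    (hp : ∀ i : Fin n, (i : ℕ) ≠ 0 → sAct i p = p) (hq : ∀ i : Fin n, (i : ℕ) ≠ 0 → sAct i q = q) :
    scalarProd (f * p) (g * q) = topOp n (piOp n (f * g) * (p * q)) := by
  rw [scalarProd_eq_topOp, mul_mul_mul_comm, piOp_mul_right]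
  intro i hi
  rw [map_mul, hp i hi, hq i hi]

theorem scalarProd_eq_tauW (f g : MvPolynomial (Fin n) ℤ) :
    scalarProd f g = tauW (bigWord n ++ longWord n le_rfl) (f * g) :=
  scalarProd_eq isReducedWord_big_long f g

theorem scalarProd_mem (f g : MvPolynomial (Fin n) ℤ) : scalarProd f g ∈ weylInvariants n := by
  rw [scalarProd_eq_topOp, mem_weylInvariants_iff]
  exact fun i => sAct_topOp_piOp i _

theorem scalarProd_smul_left (c : weylInvariants n) (f g : MvPolynomial (Fin n) ℤ) :
    scalarProd (c • f) g = c * scalarProd f g := by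
  rw [Subalgebra.smul_def, smul_eq_mul, scalarProd_eq_tauW, scalarProd_eq_tauW, mul_assoc,
    tauW_mul_left fun i _ => mem_weylInvariants_iff.1 c.2 i]

theorem scalarProd_sum_left {ι : Type*} (s : Finset ι) (f : ι → MvPolynomial (Fin n) ℤ)
    (g : MvPolynomial (Fin n) ℤ) : scalarProd (∑ i ∈ s, f i) g = ∑ i ∈ s, scalarProd (f i) g := by
  simp only [scalarProd_eq_tauW, Finset.sum_mul, map_sum]

theorem scalarProd_sub_left (f f' g : MvPolynomial (Fin n) ℤ) :
    scalarProd (f - f') g = scalarProd f g - scalarProd f' g := by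
  simp only [scalarProd_eq_tauW, sub_mul, map_sub]

theorem scalarProd_schubPerm_negRev (u v : Equiv.Perm (Fin n)) (s t : Finset (Fin n)) :
    scalarProd (schubPerm u * qForm n (wset s))
      (negRev (schubPerm (v * Fin.revPerm)) * qForm n (wset tᶜ)) =
        if u = v ∧ s = t then 1 else 0 := by
  rw [scalarProd_mul_of_sAct (fun i hi => sAct_qForm hi (wset_mem s))
    (fun i hi => sAct_qForm hi (wset_mem tᶜ)), piOp_schubPerm_negRev]
  by_cases h : u = v
  · rw [if_pos h, one_mul, topOp_qForm_mul_qForm]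
    simp [h, compl_inj_iff, eq_comm]
  · simp [h]

theorem eq_zero_of_scalarProd {f : MvPolynomial (Fin n) ℤ}
    (h : ∀ (v : Equiv.Perm (Fin n)) (t : Finset (Fin n)),
      scalarProd f (negRev (schubPerm (v * Fin.revPerm)) * qForm n (wset tᶜ)) = 0) : f = 0 := by
  refine eq_zero_of_pairing (Fintype.equivOfCardEq (card_index (n := n)))
    (a := bigWord n ++ longWord n le_rfl)
    (b := fun i => schubPerm i.1 * qForm n (wset i.2))
    (b' := fun i => negRev (schubPerm (i.1 * Fin.revPerm)) * qForm n (wset i.2ᶜ)) (fun i j => ?_)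
    fun j => ?_
  · rw [← scalarProd_eq_tauW, scalarProd_schubPerm_negRev]
    simp only [Prod.ext_iff]
  · rw [← scalarProd_eq_tauW, h]

/-- Adjointness transfers the reversed word to `Q̃_t` as the Grassmannian word of `λ'`, which
contracts it. Pairing with `Q̃` of the full set then leaves only `t = λ'`. -/
theorem topOp_schubertCPart_mul (s t : StrictPartition n) :
    topOp n (schubertCPart s * qForm n (wset t)) = if t = sᶜ then 1 else 0 := by
  have hT : ∀ i ∈ (grassWord (Finset.sort sᶜ (· ≥ ·))).reverse, (topOp n * piOp n) * tau i = 0 :=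
    fun i _ => topOp_piOp_mul_tau i
  have h1 := map_tauW_mul hT (stair n n * qForm n (wset (Finset.univ : Finset (Fin n))))
    (qForm n (wset t))
  rw [Module.End.mul_apply, Module.End.mul_apply, List.reverse_reverse, mul_right_comm,
    piOp_mul_right (fun i hi => sAct_qForm hi (wset_mem t)),
    piOp_mul_right (fun i hi => sAct_qForm hi (wset_mem Finset.univ)),
    piOp_stair_mul_tauW_qForm sᶜ (wset_mem t)] at h1
  rw [schubertCPart_eq_piOp, mul_assoc, topOp_neg_one_pow_mul, h1, mul_assoc, topOp_neg_one_pow_mul,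
    neg_one_pow_mul_self, mul_comm]
  rcases contrList_wset (Finset.sort_nodup sᶜ (· ≥ ·)) t with h | ⟨hsub, k, h⟩
  · rw [h, map_zero, mul_zero, map_zero, if_neg]
    rintro rfl
    rw [contrList_sort_wset subset_rfl, if_pos rfl] at h
    have := congrArg (qForm n) h
    rw [qForm_one, map_zero] at this
    exact one_ne_zero this
  · rw [Finset.sort_toFinset] at hsub h
    by_cases ht : t = sᶜ
    · rw [if_pos ht, ht, contrList_sort_wset subset_rfl, if_pos rfl, qForm_one, mul_one,
        topOp_qForm_wset, if_pos rfl]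
    · have e1 : qForm n ((-1) ^ k * wset (t \ sᶜ)) = (-1) ^ k * qForm n (wset (t \ sᶜ)) := by
        rcases Nat.even_or_odd k with h' | h' <;> simp [h'.neg_one_pow]
      rw [if_neg ht, h, e1, mul_left_comm, topOp_neg_one_pow_mul, topOp_qForm_mul_qForm, if_neg,
        mul_zero]
      rw [Finset.compl_univ, Finset.sdiff_eq_empty_iff_subset]
      exact fun h' => ht (h'.antisymm hsub)

theorem schubPerm_one : schubPerm (1 : Equiv.Perm (Fin n)) = 1 := by
  rw [schubPerm, inv_one, one_mul, ← piOp_eq, piOp_stairRev]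

theorem sAct_schubertCPart {i : Fin n} (hi : (i : ℕ) ≠ 0) (s : StrictPartition n) :
    sAct i (schubertCPart s) = schubertCPart s := by
  rw [schubertCPart_eq_piOp, map_mul, sAct_neg_one_pow, sAct_piOp hi]

/-- Both sides are `S_n`-invariant, so the type A factor contributes the same scalar to their
pairings, and `T` does not distinguish them on any `Q̃_t`. Nondegeneracy gives equality without
computing `ℭ_λ`. -/
theorem schubertCPart_eq (s : StrictPartition n) : schubertCPart s = qForm n (wset s) := by
  rw [← sub_eq_zero]
  refine eq_zero_of_scalarProd fun v t => ?_
  have h : ∀ f : MvPolynomial (Fin n) ℤ, (∀ i : Fin n, (i : ℕ) ≠ 0 → sAct i f = f) →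
      scalarProd f (negRev (schubPerm (v * Fin.revPerm)) * qForm n (wset tᶜ)) =
        topOp n ((if (1 : Equiv.Perm (Fin n)) = v then 1 else 0) * (f * qForm n (wset tᶜ))) := by
    intro f hf
    rw [← piOp_schubPerm_negRev, ← scalarProd_mul_of_sAct hf
      (fun i hi => sAct_qForm hi (wset_mem tᶜ)), schubPerm_one, one_mul]
  rw [scalarProd_sub_left, h _ fun i hi => sAct_schubertCPart hi s,
    h _ fun i hi => sAct_qForm hi (wset_mem s)]
  split_ifs
  · rw [one_mul, one_mul, topOp_schubertCPart_mul, topOp_qForm_mul_qForm, sub_self]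
  · simp

theorem linearIndependent_schubPerm_mul : LinearIndependent (weylInvariants n)
    fun p : Equiv.Perm (Fin n) × StrictPartition n => schubPerm p.1 * qForm n (wset p.2) := by
  rw [Fintype.linearIndependent_iff]
  intro g hg p
  have h1 := congrArg (fun f => scalarProd f
    (negRev (schubPerm (p.1 * Fin.revPerm)) * qForm n (wset p.2ᶜ))) hg
  simp only [scalarProd_sum_left, scalarProd_smul_left] at h1
  rw [Finset.sum_eq_single p] at h1
  · rw [scalarProd_schubPerm_negRev, if_pos ⟨rfl, rfl⟩, scalarProd_eq_topOp, zero_mul, map_zero,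
      map_zero, mul_one] at h1
    exact Subtype.ext h1
  · intro q _ hq
    rw [scalarProd_schubPerm_negRev, if_neg fun h => hq (Prod.ext h.1 h.2), mul_zero]
  · intro h
    exact absurd (Finset.mem_univ _) h

theorem span_schubPerm_mul : ⊤ ≤ Submodule.span (weylInvariants n)
    (Set.range fun p : Equiv.Perm (Fin n) × StrictPartition n =>
      schubPerm p.1 * qForm n (wset p.2)) := by
  intro f _
  -- The coordinates are the pairings with the dual family; they are invariant, and the difference
  -- of the two sides is orthogonal to that family.
  have h : f = ∑ p : Equiv.Perm (Fin n) × StrictPartition n,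
      (⟨_, scalarProd_mem f (negRev (schubPerm (p.1 * Fin.revPerm)) * qForm n (wset p.2ᶜ))⟩ :
        weylInvariants n) • (schubPerm p.1 * qForm n (wset p.2)) := by
    rw [← sub_eq_zero]
    refine eq_zero_of_scalarProd fun v t => ?_
    simp only [scalarProd_sub_left, scalarProd_sum_left, scalarProd_smul_left]
    rw [Finset.sum_eq_single (v, t)]
    · rw [scalarProd_schubPerm_negRev, if_pos ⟨rfl, rfl⟩, mul_one, sub_self]
    · intro q _ hq
      rw [scalarProd_schubPerm_negRev, if_neg fun h => hq (Prod.ext h.1 h.2), mul_zero]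
    · intro h
      exact absurd (Finset.mem_univ _) h
  rw [h]
  exact Submodule.sum_mem _ fun p _ => Submodule.smul_mem _ _ (Submodule.subset_span ⟨p, rfl⟩)

end Basis

theorem proposition1p4 (n : ℕ) :
    (∃ b : Module.Basis (Equiv.Perm (Fin n) × StrictPartition n) (weylInvariants n)
        (MvPolynomial (Fin n) ℤ),
      ∀ (u : Equiv.Perm (Fin n)) (lam : StrictPartition n),
        b (u, lam) = schubertCPerm u * schubertCPart lam) ∧
    (∀ (u v : Equiv.Perm (Fin n)) (lam mu : StrictPartition n),
      scalarProd (schubertCPerm u * schubertCPart lam)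
          (negRev (schubertCPerm (v * Fin.revPerm)) * schubertCPart muᶜ) =
        if u = v ∧ lam = mu then 1 else 0) ∧
    (∀ (u v : Equiv.Perm (Fin n)) (lam mu : StrictPartition n),
      (SignedPerm.ofPerm u).length + (SignedPerm.ofPerm v).length = n * (n - 1) / 2 →
      scalarProd (schubertCPerm u * schubertCPart lam) (schubertCPerm v * schubertCPart mu) =
        if v = Fin.revPerm * u ∧ mu = lamᶜ then 1 else 0) := by
  refine ⟨⟨Module.Basis.mk linearIndependent_schubPerm_mul span_schubPerm_mul, fun u lam => ?_⟩,
    fun u v lam mu => ?_, fun u v lam mu h => ?_⟩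
  · rw [Module.Basis.mk_apply, schubertCPerm_eq, schubertCPart_eq]
  · rw [schubertCPerm_eq, schubertCPerm_eq, schubertCPart_eq, schubertCPart_eq,
      scalarProd_schubPerm_negRev]
  · rw [schubertCPerm_eq, schubertCPerm_eq, schubertCPart_eq, schubertCPart_eq,
      scalarProd_mul_of_sAct (fun i hi => sAct_qForm hi (wset_mem lam))
        (fun i hi => sAct_qForm hi (wset_mem mu)), piOp_schubPerm_mul u v h]
    by_cases hv : v = Fin.revPerm * u
    · rw [if_pos hv, one_mul, topOp_qForm_mul_qForm]
      simp [hv]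
    · simp [hv]
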